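/- **Proposition 3.5.** Let $k$ be a field and let $\mathcal P$ be a (symmetric, unital) operad in unbounded cochain complexes over $k$ (differential of degree $1$, Koszul sign rule). Write $\mathcal P(V)=\bigoplus_{n\ge 0}(\mathcal P(n)\otimes V^{\otimes n})_{\mathbb S_n}$ for the free algebra functor, and assume that $\mathcal P$ *reflects homotopy equivalences*: $\mathcal P(-)$ sends quasi-isomorphisms of cochain complexes to quasi-isomorphisms. Let $A$ be a $\mathcal P$-algebra, let $N\ge 0$, and let $f:(S,d)\to A$ be an $N$-step Sullivan model of $A$, that is: $(S,d)$ is a dg $\mathcal P$-algebra whose underlying graded algebra is the free algebra $\mathcal P(V_0\oplus\dots\oplus V_N)$ on graded vector spaces $V_0,\dots,V_N$; $dV_0=0$, and $dV_i\subseteq\mathcal P(V_0\oplus\dots\oplus V_{i-1})$ for $1\le i\le N$; $f$ is a morphism of $\mathcal P$-algebras; and the restrictions of $f$ to $V_0\to A$ and, for $1\le i\le N$, to $V_i\oplus\mathcal P(V_0\oplus\dots\oplus V_{i-1})\to A$ are quasi-isomorphisms. Let $\sigma\in S$ be a cocycle that lies in the $\mathcal P$-ideal generated by $V_1\oplus\dots\oplus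 V_N$. For a $\mathcal P$-algebra $C$ and a morphism of $\mathcal P$-algebras $h:S\to C$, the *$\sigma$-cotriple product set* of $C$ with respect to $h$ is $$\langle\sigma\rangle_{h}=\{H^*(g)[\sigma] \;:\; g:S\to C \text{ a morphism of } \mathcal P\text{-algebras with } H^*(g)|_{V_0}=H^*(h)|_{V_0}\}\subseteq H^*(C).$$ Let $\varphi:A\to B$ be a morphism of $\mathcal P$-algebras. Then: 1. $\varphi_*=H^*(\varphi)$ maps $\langle\sigma\rangle_{f}\subseteq H^*(A)$ into $\langle\sigma\rangle_{\varphi f}\subseteq H^*(B)$. 2. If $\varphi$ is a quasi-isomorphism, then $\varphi f:S\to B$ is an $N$-step Sullivan model of $B$, and $\varphi_*$ restricts to a bijection $\langle\sigma\rangle_{f}\to\langle\sigma\rangle_{\varphi f}$. -/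

import Mathlib

open scoped TensorProduct

universe u

namespace CotripleProducts

noncomputable section

/-! # Graded modules and cochain complexes

A (dg-)module is a module `M = ⨁ₙ Mⁿ` with an internal `ℤ`-grading (and, for dg-modules, a
differential of degree `1`); the complexes are unbounded and cohomologically graded. -/

/-- A `ℤ`-graded `k`-module. -/
structure GMod (k : Type u) [CommRing k] where
  carrier : Type u
  [addCommGroup : AddCommGroup carrier]
  [module : Module k carrier]
  /-- the homogeneous components -/
  gr : ℤ → Submodule k carrier
  internal : DirectSum.IsInternal gr

instance {k : Type u} [CommRing k] : CoeSort (GMod k) (Type u) := ⟨GMod.carrier⟩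
instance {k : Type u} [CommRing k] (M : GMod k) : AddCommGroup M := M.addCommGroup
instance {k : Type u} [CommRing k] (M : GMod k) : Module k M := M.module

/-- The linear involution of a graded module that is `x ↦ (-1)ⁿ x` on the component of
degree `n`. -/
def GMod.sgn {k : Type u} [CommRing k] (M : GMod k) : M →ₗ[k] M :=
  (DirectSum.toModule k ℤ M fun n => n.negOnePow • (M.gr n).subtype) ∘ₗ
    (LinearEquiv.ofBijective (DirectSum.coeLinearMap M.gr) M.internal).symm.toLinearMap

theorem GMod.sgn_of_mem {k : Type u} [CommRing k] (M : GMod k) {n : ℤ} {x : M}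
    (hx : x ∈ M.gr n) : M.sgn x = n.negOnePow • x := by
  have h : (LinearEquiv.ofBijective (DirectSum.coeLinearMap M.gr) M.internal).symm x
      = DirectSum.lof k ℤ (fun n => M.gr n) n ⟨x, hx⟩ := by
    rw [LinearEquiv.symm_apply_eq]
    exact (DirectSum.coeLinearMap_lof M.gr n ⟨x, hx⟩).symm
  rw [GMod.sgn, LinearMap.comp_apply, LinearEquiv.coe_coe, h, DirectSum.toModule_lof]
  rfl

/-- A dg-module (unbounded cochain complex): a graded module with a differential of
degree `1`. -/
structure DGMod (k : Type u) [CommRing k] extends GMod k where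
  d : carrier →ₗ[k] carrier
  d_mem : ∀ {n : ℤ} {x : carrier}, x ∈ gr n → d x ∈ gr (n + 1)
  d_d : ∀ x : carrier, d (d x) = 0

instance {k : Type u} [CommRing k] : CoeSort (DGMod k) (Type u) := ⟨fun M => M.carrier⟩

/-- A morphism of dg-modules: a linear map of degree `0` that commutes with the
differentials. -/
structure DGMod.Hom {k : Type u} [CommRing k] (M N : DGMod k) where
  toLin : M →ₗ[k] N
  map_mem : ∀ {n : ℤ} {x : M}, x ∈ M.gr n → toLin x ∈ N.gr n
  map_d : ∀ x : M, toLin (M.d x) = N.d (toLin x)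

/-- The cohomology `ker d / im d` of a module with a differential; for a complex it is the sum
of the cohomology groups of all degrees. -/
abbrev Cohomology {k M : Type u} [CommRing k] [AddCommGroup M] [Module k M]
    (d : M →ₗ[k] M) : Type u :=
  LinearMap.ker d ⧸ (LinearMap.range d).submoduleOf (LinearMap.ker d)

/-- The cohomology class of a cocycle. -/
def Cohomology.mk {k M : Type u} [CommRing k] [AddCommGroup M] [Module k M]
    {d : M →ₗ[k] M} (z : LinearMap.ker d) : Cohomology d :=
  Submodule.Quotient.mk z

/-- The map induced on cohomology by a linear map that commutes with the differentials. -/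
def Cohomology.map {k M N : Type u} [CommRing k] [AddCommGroup M] [Module k M]
    [AddCommGroup N] [Module k N] {d : M →ₗ[k] M} {d' : N →ₗ[k] N} (f : M →ₗ[k] N)
    (hf : ∀ x, f (d x) = d' (f x)) : Cohomology d →ₗ[k] Cohomology d' :=
  Submodule.mapQ _ _
    (f.restrict (p := LinearMap.ker d) (q := LinearMap.ker d') (by
      intro x hx
      rw [LinearMap.mem_ker] at hx ⊢
      rw [← hf, hx, map_zero]))
    (by
      rintro ⟨x, hx⟩ ⟨y, hy⟩
      exact ⟨f y, by rw [← hf, hy]; rfl⟩)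

/-- A morphism of dg-modules is a quasi-isomorphism if it is bijective on cohomology. -/
def DGMod.Hom.IsQuasiIso {k : Type u} [CommRing k] {M N : DGMod k} (f : M.Hom N) : Prop :=
  Function.Bijective (Cohomology.map f.toLin f.map_d)

/-! # Operads -/

/-- `(T ⊔ {*}) ⊔ S ≃ (T ⊔ S) ⊔ {*}` -/
def optionSumLeft (T S : Type) : Option T ⊕ S ≃ Option (T ⊕ S) where
  toFun
    | .inl none => none
    | .inl (some t) => some (.inl t)
    | .inr s => some (.inr s)
  invFun
    | none => .inl none
    | some (.inl t) => .inl (some t)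
    | some (.inr s) => .inr s
  left_inv := by rintro ((_ | _) | _) <;> rfl
  right_inv := by rintro (_ | (_ | _)) <;> rfl

/-- `T ⊔ (S ⊔ {*}) ≃ (T ⊔ S) ⊔ {*}` -/
def optionSumRight (T S : Type) : T ⊕ Option S ≃ Option (T ⊕ S) where
  toFun
    | .inr none => none
    | .inr (some s) => some (.inr s)
    | .inl t => some (.inl t)
  invFun
    | none => .inr none
    | some (.inl t) => .inl t
    | some (.inr s) => .inr (some s)
  left_inv := by rintro (_ | (_ | _)) <;> rfl
  right_inv := by rintro (_ | (_ | _)) <;> rfl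

/-- The exchange of the two added points of `(S ⊔ {*}) ⊔ {*}`. -/
def optionSwap (S : Type) : Option (Option S) ≃ Option (Option S) where
  toFun
    | none => some none
    | some none => none
    | some (some s) => some (some s)
  invFun
    | none => some none
    | some none => none
    | some (some s) => some (some s)
  left_inv := by rintro (_ | (_ | _)) <;> rfl
  right_inv := by rintro (_ | (_ | _)) <;> rfl

/-- `T ⊔ (U ⊔ S) ≃ U ⊔ (T ⊔ S)` -/
def sumLeftComm (T U S : Type) : T ⊕ (U ⊕ S) ≃ U ⊕ (T ⊕ S) where
  toFun
    | .inl t => .inr (.inl t)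
    | .inr (.inl v) => .inl v
    | .inr (.inr s) => .inr (.inr s)
  invFun
    | .inl v => .inr (.inl v)
    | .inr (.inl t) => .inl t
    | .inr (.inr s) => .inr (.inr s)
  left_inv := by rintro (_ | (_ | _)) <;> rfl
  right_inv := by rintro (_ | (_ | _)) <;> rfl

/-- `S ⊔ {*} ≃ {*} ⊔ S` -/
def optionEquivUnitSum (S : Type) : Option S ≃ Unit ⊕ S where
  toFun
    | none => .inl ()
    | some s => .inr s
  invFun
    | .inl _ => none
    | .inr s => some s
  left_inv := by rintro (_ | _) <;> rfl
  right_inv := by rintro (_ | _) <;> rfl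

/-- `{*} ≃ ∅ ⊔ {*}` -/
def unitEquivOptionEmpty : Unit ≃ Option Empty where
  toFun _ := none
  invFun _ := ()
  left_inv := by rintro ⟨⟩; rfl
  right_inv := by rintro (_ | x); · rfl
                  · exact x.elim

/-- A (symmetric, unital, dg-)operad over `k`, by partial compositions, with operations whose
inputs are labelled by finite sets: `obj S` is the complex of operations with set of inputs `S`,
so that `obj (Fin n)` is what is usually written `P(n)`, with its action `map` of the symmetric
group.  `comp x y` is the partial composite which plugs the operation `y` into the input
`* = none` of `x`.  Arity `0` is allowed. -/
structure Operad (k : Type u) [CommRing k] where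
  obj : (S : Type) → [Finite S] → DGMod.{u} k
  /-- relabelling of the inputs -/
  map : {S T : Type} → [Finite S] → [Finite T] → (S ≃ T) → obj S →ₗ[k] obj T
  map_mem : ∀ {S T : Type} [Finite S] [Finite T] (e : S ≃ T) {n : ℤ} {x : obj S},
    x ∈ (obj S).gr n → map e x ∈ (obj T).gr n
  map_d : ∀ {S T : Type} [Finite S] [Finite T] (e : S ≃ T) (x : obj S),
    map e ((obj S).d x) = (obj T).d (map e x)
  map_refl : ∀ {S : Type} [Finite S] (x : obj S), map (Equiv.refl S) x = x
  map_map : ∀ {S T U : Type} [Finite S] [Finite T] [Finite U] (e : S ≃ T) (e' : T ≃ U)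
    (x : obj S), map e' (map e x) = map (e.trans e') x
  /-- partial composition -/
  comp : {S T : Type} → [Finite S] → [Finite T] →
    obj (Option S) →ₗ[k] obj T →ₗ[k] obj (T ⊕ S)
  comp_mem : ∀ {S T : Type} [Finite S] [Finite T] {p q : ℤ} {x : obj (Option S)} {y : obj T},
    x ∈ (obj (Option S)).gr p → y ∈ (obj T).gr q → comp x y ∈ (obj (T ⊕ S)).gr (p + q)
  d_comp : ∀ {S T : Type} [Finite S] [Finite T] {p : ℤ} {x : obj (Option S)} (y : obj T),
    x ∈ (obj (Option S)).gr p →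
    (obj (T ⊕ S)).d (comp x y)
      = comp ((obj (Option S)).d x) y + p.negOnePow • comp x ((obj T).d y)
  /-- equivariance -/
  comp_map : ∀ {S S' T T' : Type} [Finite S] [Finite S'] [Finite T] [Finite T']
    (e : S ≃ S') (e' : T ≃ T') (x : obj (Option S)) (y : obj T),
    comp (map (Equiv.optionCongr e) x) (map e' y) = map (Equiv.sumCongr e' e) (comp x y)
  /-- sequential composition axiom -/
  comp_comp : ∀ {S T U : Type} [Finite S] [Finite T] [Finite U]
    (x : obj (Option S)) (y : obj (Option T)) (z : obj U),
    comp (map (optionSumLeft T S) (comp x y)) z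
      = map (Equiv.sumAssoc U T S) (comp x (comp y z))
  /-- parallel composition axiom -/
  comp_comm : ∀ {S T U : Type} [Finite S] [Finite T] [Finite U] {p q : ℤ}
    (x : obj (Option (Option S))) {y : obj T} {z : obj U},
    y ∈ (obj T).gr p → z ∈ (obj U).gr q →
    comp (map (optionSumRight T S) (comp x y)) z
      = (p * q).negOnePow • map (sumLeftComm T U S)
          (comp (map (optionSumRight U S) (comp (map (optionSwap S) x) z)) y)
  /-- the identity operation -/
  one : obj Unit
  one_mem : one ∈ (obj Unit).gr 0
  d_one : (obj Unit).d one = 0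
  one_comp : ∀ {T : Type} [Finite T] (y : obj T),
    comp (map unitEquivOptionEmpty one) y = map (Equiv.sumEmpty T Empty).symm y
  comp_one : ∀ {S : Type} [Finite S] (x : obj (Option S)),
    comp x one = map (optionEquivUnitSum S) x

/-- The Koszul sign of the rearrangement of a word `a₁ ⋯ aₙ` of homogeneous elements of degrees
`q₁, …, qₙ` into the word `a_{σ 1} ⋯ a_{σ n}`. -/
def koszulSign {n : ℕ} (σ : Equiv.Perm (Fin n)) (q : Fin n → ℤ) : ℤˣ :=
  (∑ i, ∑ j, if i < j ∧ σ j < σ i then q (σ i) * q (σ j) else 0).negOnePow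

/-! # The free algebra functor -/

/-- The graded module `⨁ₙ P(n) ⊗ V^{⊗ n}`. -/
abbrev PreSchur {k : Type u} [CommRing k] (P : Operad k) (V : GMod k) : Type u :=
  DirectSum ℕ fun n => (P.obj (Fin n)).carrier ⊗[k] (⨂[k] _ : Fin n, V.carrier)

/-- The element `μ ⊗ v₁ ⊗ ⋯ ⊗ vₙ`. -/
def PreSchur.mk {k : Type u} [CommRing k] {P : Operad k} {V : GMod k} {n : ℕ}
    (μ : P.obj (Fin n)) (v : Fin n → V) : PreSchur P V :=
  DirectSum.lof k ℕ (fun n => (P.obj (Fin n)).carrier ⊗[k] (⨂[k] _ : Fin n, V.carrier)) n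
    (μ ⊗ₜ PiTensorProduct.tprod k v)

/-- The submodule spanned by the differences that vanish in the coinvariants under the
symmetric groups. -/
def coinvRel {k : Type u} [CommRing k] (P : Operad k) (V : GMod k) :
    Submodule k (PreSchur P V) :=
  Submodule.span k {t | ∃ (n : ℕ) (μ : P.obj (Fin n)) (σ : Equiv.Perm (Fin n))
    (q : Fin n → ℤ) (v : Fin n → V), (∀ i, v i ∈ V.gr (q i)) ∧
    t = PreSchur.mk (P.map σ μ) v - koszulSign σ q • PreSchur.mk μ (v ∘ σ)}

/-- The underlying module of the free algebra `P(V) = ⨁ₙ (P(n) ⊗ V^{⊗ n})_{𝕊ₙ}`. -/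
abbrev Schur {k : Type u} [CommRing k] (P : Operad k) (V : GMod k) : Type u :=
  PreSchur P V ⧸ coinvRel P V

/-- The differential of `V^{⊗ n}`:
`v₁ ⋯ vₙ ↦ ∑ᵢ (-1)^{|v₁| + ⋯ + |vᵢ₋₁|} v₁ ⋯ d vᵢ ⋯ vₙ`. -/
def tensorD {k : Type u} [CommRing k] (V : DGMod k) (n : ℕ) :
    (⨂[k] _ : Fin n, V.carrier) →ₗ[k] (⨂[k] _ : Fin n, V.carrier) :=
  ∑ i, PiTensorProduct.map fun j =>
    if j < i then V.sgn else if j = i then V.d else LinearMap.id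

/-- The differential of `⨁ₙ P(n) ⊗ V^{⊗ n}`:
`μ ⊗ w ↦ dμ ⊗ w + (-1)^{|μ|} μ ⊗ dw`. -/
def PreSchur.d {k : Type u} [CommRing k] (P : Operad k) (V : DGMod k) :
    PreSchur P V.toGMod →ₗ[k] PreSchur P V.toGMod :=
  DirectSum.lmap fun n => TensorProduct.map (P.obj (Fin n)).d LinearMap.id +
    TensorProduct.map (P.obj (Fin n)).sgn (tensorD V n)

theorem Operad.sgn_map {k : Type u} [CommRing k] (P : Operad k) {S T : Type} [Finite S]
    [Finite T] (e : S ≃ T) (x : P.obj S) :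
    (P.obj T).sgn (P.map e x) = P.map e ((P.obj S).sgn x) := by
  have hx : x ∈ ⨆ n, (P.obj S).gr n := by
    rw [(P.obj S).internal.submodule_iSup_eq_top]; trivial
  induction hx using Submodule.iSup_induction' with
  | mem n x hx =>
    rw [GMod.sgn_of_mem _ hx, GMod.sgn_of_mem _ (P.map_mem e hx)]
    simp [Units.smul_def]
  | zero => simp
  | add x y _ _ hx hy => simp [hx, hy]

theorem tensorD_tprod {k : Type u} [CommRing k] (V : DGMod k) {n : ℕ} {q : Fin n → ℤ}
    {v : Fin n → V} (hv : ∀ i, v i ∈ V.gr (q i)) :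
    tensorD V n (PiTensorProduct.tprod k v) =
      ∑ i, (∑ j, if j < i then q j else 0).negOnePow •
        PiTensorProduct.tprod k (Function.update v i (V.d (v i))) := by
  rw [tensorD, LinearMap.sum_apply]
  refine Finset.sum_congr rfl fun i _ => ?_
  rw [PiTensorProduct.map_tprod]
  have hpow : ∀ s : Finset (Fin n), (∏ j ∈ s, (if j < i then (q j).negOnePow else 1 : ℤˣ))
      = (∑ j ∈ s, if j < i then q j else 0).negOnePow := by
    intro s
    induction s using Finset.induction_on with
    | empty => simp
    | insert a s ha ih =>
      rw [Finset.prod_insert ha, Finset.sum_insert ha, ih, Int.negOnePow_add]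
      split_ifs <;> simp
  have hfun : (fun j => (if j < i then V.sgn else if j = i then V.d else LinearMap.id) (v j))
      = fun j => ((((if j < i then (q j).negOnePow else 1 : ℤˣ) : ℤ) : k)) •
          Function.update v i (V.d (v i)) j := by
    funext j
    rcases lt_trichotomy j i with h | h | h
    · rw [if_pos h, if_pos h, V.sgn_of_mem (hv j), Function.update_of_ne h.ne, Units.smul_def,
        Int.cast_smul_eq_zsmul]
    · subst h
      simp
    · rw [if_neg h.not_gt, if_neg h.ne', if_neg h.not_gt, Function.update_of_ne h.ne']
      simp
  rw [hfun, MultilinearMap.map_smul_univ, ← hpow, Units.smul_def, ← Int.cast_prod,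
    Int.cast_smul_eq_zsmul, Units.coe_prod]

theorem koszulSign_update {n : ℕ} (σ : Equiv.Perm (Fin n)) (q : Fin n → ℤ) (b : Fin n) :
    koszulSign σ q * (∑ j, if j < b then q (σ j) else 0).negOnePow =
      (∑ j, if j < σ b then q j else 0).negOnePow *
        koszulSign σ (Function.update q (σ b) (q (σ b) + 1)) := by
  have h1 : (∑ j, if j < σ b then q j else 0) = ∑ j, if σ j < σ b then q (σ j) else 0 :=
    (Equiv.sum_comp σ fun j => if j < σ b then q j else 0).symm
  have h2 : (∑ i, ∑ j, if i < j ∧ σ j < σ i then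
        Function.update q (σ b) (q (σ b) + 1) (σ i) *
          Function.update q (σ b) (q (σ b) + 1) (σ j) else 0)
      = (∑ i, ∑ j, if i < j ∧ σ j < σ i then q (σ i) * q (σ j) else 0)
        + (∑ i, if i < b ∧ σ b < σ i then q (σ i) else 0)
        + (∑ j, if b < j ∧ σ j < σ b then q (σ j) else 0) := by
    have e1 : (∑ i, if i < b ∧ σ b < σ i then q (σ i) else 0)
        = ∑ i, ∑ j, if j = b then (if i < b ∧ σ b < σ i then q (σ i) else 0) else 0 := by
      simp
    have e2 : (∑ j, if b < j ∧ σ j < σ b then q (σ j) else 0)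
        = ∑ i, ∑ j, if i = b then (if b < j ∧ σ j < σ b then q (σ j) else 0) else 0 := by
      rw [Finset.sum_comm]
      simp
    rw [e1, e2, ← Finset.sum_add_distrib, ← Finset.sum_add_distrib]
    refine Finset.sum_congr rfl fun i _ => ?_
    rw [← Finset.sum_add_distrib, ← Finset.sum_add_distrib]
    refine Finset.sum_congr rfl fun j _ => ?_
    simp only [Function.update_apply, σ.injective.eq_iff]
    by_cases hi : i = b
    · subst hi
      by_cases hj : j = i
      · subst hj
        simp
      · simp only [hj, if_true, if_false]
        split_ifs <;> ring
    · by_cases hj : j = b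
      · subst hj
        simp only [hi, if_true, if_false]
        split_ifs <;> ring
      · simp [hi, hj]
  rw [koszulSign, koszulSign, h2, h1, ← Int.negOnePow_add, ← Int.negOnePow_add,
    Int.negOnePow_eq_iff]
  have h3 : (∑ j, if j < b then q (σ j) else 0)
      = (∑ j, if σ j < σ b then q (σ j) else 0)
        + (∑ i, if i < b ∧ σ b < σ i then q (σ i) else 0)
        - (∑ j, if b < j ∧ σ j < σ b then q (σ j) else 0) := by
    rw [← Finset.sum_add_distrib, ← Finset.sum_sub_distrib]
    refine Finset.sum_congr rfl fun j _ => ?_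
    rcases lt_trichotomy j b with h | h | h
    · rcases lt_or_gt_of_ne (σ.injective.ne h.ne) with h' | h' <;>
        simp [h, h', h.not_gt, h'.not_gt]
    · subst h
      simp
    · rcases lt_or_gt_of_ne (σ.injective.ne h.ne) with h' | h' <;>
        simp [h, h', h.not_gt, h'.not_gt]
  rw [h3]
  refine ⟨-(∑ j, if b < j ∧ σ j < σ b then q (σ j) else 0), ?_⟩
  ring

theorem PreSchur.d_mk {k : Type u} [CommRing k] (P : Operad k) (V : DGMod k) {n : ℕ}
    (μ : P.obj (Fin n)) {q : Fin n → ℤ} {v : Fin n → V} (hv : ∀ i, v i ∈ V.gr (q i)) :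
    PreSchur.d P V (PreSchur.mk (V := V.toGMod) μ v) =
      PreSchur.mk (V := V.toGMod) ((P.obj (Fin n)).d μ) v +
      ∑ i, (∑ j, if j < i then q j else 0).negOnePow •
        PreSchur.mk (V := V.toGMod) ((P.obj (Fin n)).sgn μ)
          (Function.update v i (V.d (v i))) := by
  have hz : ∀ (z : ℤ) (ν : P.obj (Fin n)) (t : ⨂[k] _ : Fin n, V.carrier),
      ν ⊗ₜ[k] (z • t) = z • (ν ⊗ₜ[k] t) := fun z ν t =>
    map_zsmul (TensorProduct.mk k (P.obj (Fin n)).carrier (⨂[k] _ : Fin n, V.carrier) ν) z t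
  simp only [PreSchur.d, PreSchur.mk, DirectSum.lmap_lof, LinearMap.add_apply,
    TensorProduct.map_tmul, LinearMap.id_apply, tensorD_tprod V hv, TensorProduct.tmul_sum,
    map_add, map_sum, Units.smul_def, hz, map_zsmul]

theorem PreSchur.d_mem {k : Type u} [CommRing k] (P : Operad k) (V : DGMod k) :
    coinvRel P V.toGMod ≤ (coinvRel P V.toGMod).comap (PreSchur.d P V) := by
  refine Submodule.span_le.2 ?_
  rintro _ ⟨n, μ, σ, q, v, hv, rfl⟩
  have hrel : ∀ (ν : P.obj (Fin n)) (q : Fin n → ℤ) (v : Fin n → V),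
      (∀ i, v i ∈ V.gr (q i)) → PreSchur.mk (V := V.toGMod) (P.map σ ν) v -
        koszulSign σ q • PreSchur.mk (V := V.toGMod) ν (v ∘ σ) ∈ coinvRel P V.toGMod :=
    fun ν q v hv => Submodule.subset_span ⟨n, ν, σ, q, v, hv, rfl⟩
  have hmem : ∀ (b : Fin n) (i : Fin n), Function.update v (σ b) (V.d (v (σ b))) i ∈
      V.gr (Function.update q (σ b) (q (σ b) + 1) i) := by
    intro b i
    by_cases h : i = σ b
    · subst h
      simpa using V.d_mem (hv (σ b))
    · simpa [h] using hv i
  have key : PreSchur.d P V (PreSchur.mk (V := V.toGMod) (P.map σ μ) v -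
        koszulSign σ q • PreSchur.mk (V := V.toGMod) μ (v ∘ σ)) =
      (PreSchur.mk (V := V.toGMod) (P.map σ ((P.obj (Fin n)).d μ)) v -
        koszulSign σ q • PreSchur.mk (V := V.toGMod) ((P.obj (Fin n)).d μ) (v ∘ σ)) +
      ∑ b, (∑ j, if j < σ b then q j else 0).negOnePow •
        (PreSchur.mk (V := V.toGMod) (P.map σ ((P.obj (Fin n)).sgn μ))
            (Function.update v (σ b) (V.d (v (σ b)))) -
          koszulSign σ (Function.update q (σ b) (q (σ b) + 1)) •
            PreSchur.mk (V := V.toGMod) ((P.obj (Fin n)).sgn μ)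
              (Function.update v (σ b) (V.d (v (σ b))) ∘ σ)) := by
    have hv' : ∀ i, (v ∘ σ) i ∈ V.gr ((q ∘ σ) i) := fun i => hv (σ i)
    rw [map_sub, Units.smul_def, map_zsmul, PreSchur.d_mk P V _ hv, PreSchur.d_mk P V _ hv',
      P.map_d, P.sgn_map, ← Equiv.sum_comp σ]
    simp only [smul_sub, Finset.sum_sub_distrib, smul_add, Finset.smul_sum, smul_smul,
      ← koszulSign_update, ← Units.smul_def]
    have : ∀ b, Function.update v (σ b) (V.d (v (σ b))) ∘ σ
        = Function.update (v ∘ σ) b (V.d ((v ∘ σ) b)) := by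
      intro b
      exact Function.update_comp_eq_of_injective v σ.injective b _
    simp only [this, Function.comp_apply]
    abel
  rw [SetLike.mem_coe, Submodule.mem_comap, key]
  refine add_mem (hrel _ _ _ hv) (sum_mem fun b _ => ?_)
  rw [Units.smul_def]
  exact zsmul_mem (hrel _ _ _ (hmem b)) _

/-- The differential of the complex `P(V)`. -/
def Schur.d {k : Type u} [CommRing k] (P : Operad k) (V : DGMod k) :
    Schur P V.toGMod →ₗ[k] Schur P V.toGMod :=
  Submodule.mapQ _ _ (PreSchur.d P V) (PreSchur.d_mem P V)

/-- The linear map `μ ⊗ v₁ ⋯ vₙ ↦ μ ⊗ f v₁ ⋯ f vₙ`. -/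
def PreSchur.map {k : Type u} [CommRing k] (P : Operad k) {V W : GMod k} (f : V →ₗ[k] W) :
    PreSchur P V →ₗ[k] PreSchur P W :=
  DirectSum.lmap fun _ => TensorProduct.map LinearMap.id (PiTensorProduct.map fun _ => f)

theorem PreSchur.map_mk {k : Type u} [CommRing k] (P : Operad k) {V W : GMod k}
    (f : V →ₗ[k] W) {n : ℕ} (μ : P.obj (Fin n)) (v : Fin n → V) :
    PreSchur.map P f (PreSchur.mk μ v) = PreSchur.mk μ (f ∘ v) := by
  simp only [PreSchur.map, PreSchur.mk, DirectSum.lmap_lof, TensorProduct.map_tmul,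
    LinearMap.id_apply, PiTensorProduct.map_tprod]
  rfl

/-- The map `P(f) : P(V) → P(W)` induced by a linear map `f` of degree `0`. -/
def Schur.map {k : Type u} [CommRing k] (P : Operad k) {V W : GMod k} (f : V →ₗ[k] W)
    (hf : ∀ {n : ℤ} {x : V}, x ∈ V.gr n → f x ∈ W.gr n) : Schur P V →ₗ[k] Schur P W :=
  Submodule.mapQ _ _ (PreSchur.map P f) (by
    refine Submodule.span_le.2 ?_
    rintro _ ⟨n, μ, σ, q, v, hv, rfl⟩
    refine Submodule.subset_span ⟨n, μ, σ, q, f ∘ v, fun i => hf (hv i), ?_⟩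
    rw [map_sub, Units.smul_def, map_zsmul, PreSchur.map_mk, PreSchur.map_mk]
    rfl)

theorem tensorD_map {k : Type u} [CommRing k] {V W : DGMod k} (f : V.Hom W) {n : ℕ}
    (w : ⨂[k] _ : Fin n, V.carrier) :
    PiTensorProduct.map (fun _ => f.toLin) (tensorD V n w)
      = tensorD W n (PiTensorProduct.map (fun _ => f.toLin) w) := by
  have hs : ∀ x : V, f.toLin (V.sgn x) = W.sgn (f.toLin x) := by
    intro x
    have hx : x ∈ ⨆ n, V.gr n := by
      rw [V.internal.submodule_iSup_eq_top]; trivial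
    induction hx using Submodule.iSup_induction' with
    | mem n x hx =>
      rw [GMod.sgn_of_mem _ hx, GMod.sgn_of_mem _ (f.map_mem hx)]
      simp [Units.smul_def]
    | zero => simp
    | add x y _ _ hx hy => simp [hx, hy]
  rw [tensorD, tensorD, LinearMap.sum_apply, LinearMap.sum_apply, map_sum]
  refine Finset.sum_congr rfl fun i _ => ?_
  rw [← LinearMap.comp_apply, ← LinearMap.comp_apply, ← PiTensorProduct.map_comp,
    ← PiTensorProduct.map_comp]
  congr 2
  funext j
  ext x
  rcases lt_trichotomy j i with h | h | h
  · simp [h, hs]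
  · simp [h, f.map_d]
  · simp [h.not_gt, h.ne']

theorem Schur.map_d {k : Type u} [CommRing k] (P : Operad k) {V W : DGMod k} (f : V.Hom W)
    (x : Schur P V.toGMod) :
    Schur.map P f.toLin f.map_mem (Schur.d P V x)
      = Schur.d P W (Schur.map P f.toLin f.map_mem x) := by
  obtain ⟨x, rfl⟩ := Submodule.Quotient.mk_surjective _ x
  refine congrArg (Submodule.Quotient.mk (p := coinvRel P W.toGMod)) ?_
  induction x using DirectSum.induction_on with
  | zero => simp
  | add x y hx hy => simp only [map_add, hx, hy]
  | of n t =>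
    change PreSchur.map P f.toLin (PreSchur.d P V (DirectSum.lof k ℕ _ n t))
      = PreSchur.d P W (PreSchur.map P f.toLin (DirectSum.lof k ℕ _ n t))
    simp only [PreSchur.map, PreSchur.d, DirectSum.lmap_lof]
    congr 1
    induction t using TensorProduct.induction_on with
    | zero => simp
    | add x y hx hy => simp only [map_add, hx, hy]
    | tmul μ w => simp [tensorD_map]

/-- An operad *reflects homotopy equivalences* if its free algebra functor sends
quasi-isomorphisms of cochain complexes to quasi-isomorphisms. -/
def Operad.ReflectsHomotopyEquivalences {k : Type u} [CommRing k] (P : Operad k) : Prop :=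
  ∀ (V W : DGMod.{u} k) (f : V.Hom W), f.IsQuasiIso →
    Function.Bijective (Cohomology.map (d := Schur.d P V) (d' := Schur.d P W)
      (Schur.map P f.toLin f.map_mem) (Schur.map_d P f))

/-! # Algebras over an operad -/

/-- A (dg-)algebra over the operad `P`.  By equivariance it suffices to state compatibility with
partial composition in the first input, where it carries no sign. -/
structure Operad.Alg {k : Type u} [CommRing k] (P : Operad k) extends DGMod k where
  act : (n : ℕ) → P.obj (Fin n) →ₗ[k] MultilinearMap k (fun _ : Fin n => carrier) carrier
  act_mem : ∀ {n : ℕ} {p : ℤ} {q : Fin n → ℤ} {μ : P.obj (Fin n)} {a : Fin n → carrier},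
    μ ∈ (P.obj (Fin n)).gr p → (∀ i, a i ∈ gr (q i)) → act n μ a ∈ gr (p + ∑ i, q i)
  d_act : ∀ {n : ℕ} {p : ℤ} {q : Fin n → ℤ} {μ : P.obj (Fin n)} {a : Fin n → carrier},
    μ ∈ (P.obj (Fin n)).gr p → (∀ i, a i ∈ gr (q i)) →
    d (act n μ a) = act n ((P.obj (Fin n)).d μ) a +
      ∑ i, (p + ∑ j, if j < i then q j else 0).negOnePow •
        act n μ (Function.update a i (d (a i)))
  act_map : ∀ {n : ℕ} {q : Fin n → ℤ} (σ : Equiv.Perm (Fin n)) (μ : P.obj (Fin n))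
    {a : Fin n → carrier}, (∀ i, a i ∈ gr (q i)) →
    act n (P.map σ μ) a = koszulSign σ q • act n μ (a ∘ σ)
  act_one : ∀ a : Fin 1 → carrier, act 1 (P.map (Equiv.ofUnique Unit (Fin 1)) P.one) a = a 0
  act_comp : ∀ {m n : ℕ} (μ : P.obj (Option (Fin m))) (ν : P.obj (Fin n))
    (a : Fin (n + m) → carrier),
    act (n + m) (P.map finSumFinEquiv (P.comp μ ν)) a =
      act (m + 1) (P.map (finSuccEquiv m).symm μ)
        (Fin.cons (act n ν (a ∘ Fin.castAdd m)) (a ∘ Fin.natAdd n))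

instance {k : Type u} [CommRing k] {P : Operad k} : CoeSort P.Alg (Type u) :=
  ⟨fun A => A.carrier⟩

/-- A morphism of (dg-)algebras over an operad. -/
structure Operad.Alg.Hom {k : Type u} [CommRing k] {P : Operad k} (A B : P.Alg) extends
    DGMod.Hom A.toDGMod B.toDGMod where
  map_act : ∀ (n : ℕ) (μ : P.obj (Fin n)) (a : Fin n → A),
    toLin (A.act n μ a) = B.act n μ (toLin ∘ a)

/-- Composition of morphisms of algebras: first `f`, then `g`. -/
def Operad.Alg.Hom.comp {k : Type u} [CommRing k] {P : Operad k} {A B C : P.Alg}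
    (g : B.Hom C) (f : A.Hom B) : A.Hom C where
  toLin := g.toLin ∘ₗ f.toLin
  map_mem hx := g.map_mem (f.map_mem hx)
  map_d x := by simp [f.map_d, g.map_d]
  map_act n μ a := by
    simp only [LinearMap.comp_apply, f.map_act, g.map_act]
    rfl

/-- The cohomology of an algebra. -/
abbrev Operad.Alg.H {k : Type u} [CommRing k] {P : Operad k} (A : P.Alg) : Type u :=
  Cohomology A.d

/-- The map `H^*(f)` induced on cohomology by a morphism of algebras. -/
def Operad.Alg.Hom.onH {k : Type u} [CommRing k] {P : Operad k} {A B : P.Alg}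
    (f : A.Hom B) : A.H →ₗ[k] B.H :=
  Cohomology.map f.toLin f.map_d

/-- The ideal of an algebra generated by a set: the least submodule containing the set that
contains every `μ(a₁, …, aₙ)` one of whose arguments it contains. -/
def Operad.Alg.ideal {k : Type u} [CommRing k] {P : Operad k} (A : P.Alg) (X : Set A) :
    Submodule k A :=
  sInf {J | X ⊆ J ∧ ∀ (n : ℕ) (μ : P.obj (Fin n)) (a : Fin n → A) (i : Fin n),
    a i ∈ J → A.act n μ a ∈ J}

/-- The canonical map `P(V) → A`, `μ ⊗ v₁ ⋯ vₙ ↦ μ(ι v₁, …, ι vₙ)`, which extends a linear map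
`ι : V → A` of degree `0` to a morphism of graded algebras. -/
def Operad.Alg.extend {k : Type u} [CommRing k] {P : Operad k} (A : P.Alg) {V : GMod k}
    (ι : V →ₗ[k] A) (hι : ∀ {n : ℤ} {x : V}, x ∈ V.gr n → ι x ∈ A.gr n) :
    Schur P V →ₗ[k] A :=
  Submodule.liftQ _
    (DirectSum.toModule k ℕ A fun n =>
      TensorProduct.lift ((PiTensorProduct.lift (R := k) (s := fun _ : Fin n => V.carrier)
        (E := A.carrier)).toLinearMap ∘ₗ
          MultilinearMap.compLinearMapₗ (fun _ => ι) ∘ₗ A.act n))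
    (by
      refine Submodule.span_le.2 ?_
      rintro _ ⟨n, μ, σ, q, v, hv, rfl⟩
      have h := A.act_map σ μ (a := fun i => ι (v i)) fun i => hι (hv i)
      rw [SetLike.mem_coe, LinearMap.mem_ker, map_sub, Units.smul_def, map_zsmul, sub_eq_zero]
      simp only [PreSchur.mk, DirectSum.toModule_lof, TensorProduct.lift.tmul,
        LinearMap.comp_apply, LinearEquiv.coe_coe, PiTensorProduct.lift.tprod]
      exact h)

/-- The image in `A` of the free algebra `P(U)` on a submodule `U ⊆ V`, under `ι : V → A`: the
submodule spanned by all `μ(ι v₁, …, ι vₙ)` with `vⱼ ∈ U`. -/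
def Operad.Alg.freeSpan {k : Type u} [CommRing k] {P : Operad k} (A : P.Alg) {V : GMod k}
    (ι : V →ₗ[k] A) (U : Submodule k V) : Submodule k A :=
  Submodule.span k {a | ∃ (n : ℕ) (μ : P.obj (Fin n)) (v : Fin n → V),
    (∀ j, v j ∈ U) ∧ a = A.act n μ (ι ∘ v)}

/-! # Sullivan algebras and Sullivan models -/

/-- An `N`-step Sullivan algebra: an algebra `S` whose underlying graded algebra is the free
algebra on a graded module `V = V₀ ⊕ ⋯ ⊕ V_N` (via `ι : V → S`), with `d V₀ = 0` and
`d V_i ⊆ P(V₀ ⊕ ⋯ ⊕ V_{i-1})` for `i ≥ 1`. -/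
structure SullivanAlgebra {k : Type u} [CommRing k] (P : Operad k) (N : ℕ) where
  alg : P.Alg
  V : GMod k
  /-- the summands `V_i` -/
  stage : Fin (N + 1) → Submodule k V
  stage_internal : DirectSum.IsInternal stage
  /-- each `V_i` is a graded submodule -/
  stage_graded : ∀ i, stage i ≤ ⨆ n, stage i ⊓ V.gr n
  ι : V →ₗ[k] alg
  ι_mem : ∀ {n : ℤ} {x : V}, x ∈ V.gr n → ι x ∈ alg.gr n
  free : Function.Bijective (alg.extend ι ι_mem)
  d_stage_zero : ∀ x ∈ stage 0, alg.d (ι x) = 0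
  d_stage : ∀ i, i ≠ 0 → ∀ x ∈ stage i, alg.d (ι x) ∈
    alg.freeSpan ι (⨆ l, ⨆ _ : l < i, stage l)

/-- The subalgebra `P(V₀ ⊕ ⋯ ⊕ V_{i-1})` of a Sullivan algebra. -/
def SullivanAlgebra.below {k : Type u} [CommRing k] {P : Operad k} {N : ℕ}
    (S : SullivanAlgebra P N) (i : Fin (N + 1)) : Submodule k S.alg :=
  S.alg.freeSpan S.ι (⨆ l, ⨆ _ : l < i, S.stage l)

/-- The ideal `I(V₁ ⊕ ⋯ ⊕ V_N)` of a Sullivan algebra. -/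
def SullivanAlgebra.positiveIdeal {k : Type u} [CommRing k] {P : Operad k} {N : ℕ}
    (S : SullivanAlgebra P N) : Submodule k S.alg :=
  S.alg.ideal {a | ∃ i, i ≠ 0 ∧ ∃ x ∈ S.stage i, a = S.ι x}

/-- For a subcomplex `U` of `A`: the restriction of `f : A → B` to `U` is bijective on
cohomology, spelled out as injectivity and surjectivity. -/
def IsQuasiIsoOn {k : Type u} [CommRing k] {P : Operad k} {A B : P.Alg}
    (U : Submodule k A) (f : A.Hom B) : Prop :=
  (∀ x ∈ U, A.d x = 0 → (∃ b, B.d b = f.toLin x) → ∃ y ∈ U, A.d y = x) ∧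
  (∀ b, B.d b = 0 → ∃ x ∈ U, A.d x = 0 ∧ ∃ c, B.d c = b - f.toLin x)

/-- A morphism `f : S → A` from an `N`-step Sullivan algebra is an `N`-step Sullivan model of
`A` if `V₀ → A` is a quasi-isomorphism and
`V_i ⊕ P(V₀ ⊕ ⋯ ⊕ V_{i-1}) → A` is a quasi-isomorphism for `1 ≤ i ≤ N`. -/
structure SullivanAlgebra.IsModel {k : Type u} [CommRing k] {P : Operad k} {N : ℕ}
    (S : SullivanAlgebra P N) {A : P.Alg} (f : S.alg.Hom A) : Prop where
  zero : IsQuasiIsoOn ((S.stage 0).map S.ι) f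
  pos : ∀ i, i ≠ 0 → IsQuasiIsoOn ((S.stage i).map S.ι ⊔ S.below i) f

/-- The class in `H^*(S)` of an element of `V₀`. -/
def SullivanAlgebra.stageZeroClass {k : Type u} [CommRing k] {P : Operad k} {N : ℕ}
    (S : SullivanAlgebra P N) (x : S.stage 0) : S.alg.H :=
  Cohomology.mk ⟨S.ι x, S.d_stage_zero x x.2⟩

/-! # Cotriple product sets -/

/-- A defining system, with respect to `f : S → A`: a morphism of algebras `g : S → A` such that
`H^*(g)` and `H^*(f)` agree on `V₀`. -/
def SullivanAlgebra.IsDefiningSystem {k : Type u} [CommRing k] {P : Operad k} {N : ℕ}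
    (S : SullivanAlgebra P N) {A : P.Alg} (f g : S.alg.Hom A) : Prop :=
  ∀ x : S.stage 0, g.onH (S.stageZeroClass x) = f.onH (S.stageZeroClass x)

/-- The `σ`-cotriple product set in `H^*(A)`, with respect to `f : S → A`: the set of all
`H^*(g)(σ)`, for `g` a defining system. -/
def SullivanAlgebra.productSet {k : Type u} [CommRing k] {P : Operad k} {N : ℕ}
    (S : SullivanAlgebra P N) {A : P.Alg} (f : S.alg.Hom A)
    (σ : LinearMap.ker S.alg.d) : Set A.H :=
  {c | ∃ g : S.alg.Hom A, S.IsDefiningSystem f g ∧ c = g.onH (Cohomology.mk σ)}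

end

end CotripleProducts

open CotripleProducts

open scoped TensorProduct

/-! Everything except surjectivity in the second part is formal. Composition with φ carries defining
systems to defining systems, a model followed by a quasi-isomorphism is a model, and φ_* is
injective. For surjectivity, put ψ = φ f and let h : S → B be a defining system with respect to ψ.
It suffices to find an endomorphism g of S with H(ψ g) = H(h) (`IsModel.exists_onH_eq`): then H(φ)
H(f g) = H(h), and injectivity of H(φ) makes f g a defining system with respect to f.

To find g, factor ψ as S → E → B, where E is S with generators x_m and d x_m adjoined, one pair for
each homogeneous element m of B, and x_m is sent to m. The retraction E → S kills the new
generators, and E → B is surjective even on the kernel of this retraction. The kernel is acyclic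
(`cone_acyclic`). Indeed, order the words by the stages of the generators of S that occur in them.
The differential of such a generator is lighter than the generator, so the leading part of the
differential of E is that of P(V), where V is the complex in which the generators of S are closed
and d maps x_m to d x_m. The projection of V onto the closed generators is a quasi-isomorphism,
hence so is its image under P by the hypothesis on P, and every cocycle killed by it is a boundary.
Well-founded induction on the weight passes from the leading part to the whole differential
(`Words.exists_deriv_eq`).

A model need not be a quasi-isomorphism on all of S; only its restrictions to V_0 and to the pieces
V_i ⊕ P(V_0 ⊕ ⋯ ⊕ V_{i-1}) are. Therefore h is lifted to H : S → E one stage at a time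
(`exists_lift_letter`, `exists_lift_stage`), subject to the invariant that the retraction sends H(v)
into the i-th piece for every basis vector v of V_i. At the next stage the invariant places the
obstruction in a piece on which ψ is injective on cohomology. Finally g is H followed by the
retraction. Since the inclusion after the retraction differs from the identity of E by a map into
the acyclic kernel, ψ g and h agree on cohomology.

The larger part of the work makes free algebras over P computable. Generators are treated as
operations of arity zero, so that the algebra structure and all its Koszul signs come from the
partial compositions (`Words`). Derivations are obtained from the universal property, as sections of
a square-zero extension (`tangent`). A homogeneous basis compatible with the stages identifies this
model with P(V) as defined by coinvariants. -/

namespace CotripleProducts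

noncomputable section

/-! # Koszul signs of rearrangements -/

/-- The Koszul sign of the passage between two enumerations of a family of homogeneous elements
of degrees `q`. -/
def inversionSign {T : Type} [Fintype T] {m n : ℕ} (e : T ≃ Fin m) (e' : T ≃ Fin n)
    (q : T → ℤ) : ℤˣ :=
  (∑ i, ∑ j, if e i < e j ∧ e' j < e' i then q i * q j else 0).negOnePow

/-- Modulo 2 the terms at (i, j) and (j, i) cancel under the swap of coordinates, whose fixed points
contribute zero. -/
theorem even_sum_sum {T : Type} [Fintype T] (F : T → T → ℤ) (h : ∀ i j, Even (F i j + F j i))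
    (h0 : ∀ i, F i i = 0) : Even (∑ i, ∑ j, F i j) := by
  classical
  rw [← ZMod.intCast_eq_zero_iff_even, ← Fintype.sum_prod_type', Int.cast_sum]
  refine Finset.sum_involution (fun p _ => (p.2, p.1)) ?_ ?_ ?_ ?_
  · intro p _
    have := (ZMod.intCast_eq_zero_iff_even).2 (h p.1 p.2)
    push_cast at this
    exact this
  · intro p _ hp heq
    apply hp
    have : p.1 = p.2 := (congrArg Prod.snd heq)
    rw [this, h0, Int.cast_zero]
  · intro p _
    exact Finset.mem_univ _
  · intro p _
    rfl

theorem inversionSign_self {T : Type} [Fintype T] {m n : ℕ} (e : T ≃ Fin m) (e' : T ≃ Fin n)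
    (q : T → ℤ) (h : ∀ i j, e i < e j ↔ e' i < e' j) : inversionSign e e' q = 1 := by
  rw [inversionSign, Finset.sum_eq_zero, Int.negOnePow_zero]
  refine fun i _ => Finset.sum_eq_zero fun j _ => if_neg ?_
  rw [h]
  exact fun h => lt_asymm h.1 h.2

theorem inversionSign_symm {T : Type} [Fintype T] {m n : ℕ} (e : T ≃ Fin m) (e' : T ≃ Fin n)
    (q : T → ℤ) : inversionSign e e' q = inversionSign e' e q := by
  rw [inversionSign, inversionSign, Finset.sum_comm]
  congr 1
  refine Finset.sum_congr rfl fun i _ => Finset.sum_congr rfl fun j _ => ?_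
  simp only [and_comm, mul_comm]

/-- A pair is inverted between the first and the last enumeration exactly when it is inverted in
precisely one of the two intermediate passages. This cocycle identity replaces direct manipulation
of permutations in all later sign computations. -/
theorem inversionSign_trans {T : Type} [Fintype T] {m n p : ℕ} (e : T ≃ Fin m) (e' : T ≃ Fin n)
    (e'' : T ≃ Fin p) (q : T → ℤ) :
    inversionSign e e' q * inversionSign e' e'' q = inversionSign e e'' q := by
  rw [inversionSign, inversionSign, inversionSign, ← Int.negOnePow_add, Int.negOnePow_eq_iff,
    ← Finset.sum_add_distrib, ← Finset.sum_sub_distrib]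
  simp only [← Finset.sum_add_distrib, ← Finset.sum_sub_distrib]
  refine even_sum_sum _ (fun i j => ?_) (fun i => by simp)
  by_cases hij : i = j
  · subst hij; simp
  have h1 := e.injective.ne hij
  have h2 := e'.injective.ne hij
  have h3 := e''.injective.ne hij
  rcases lt_or_gt_of_ne h1 with a | a <;> rcases lt_or_gt_of_ne h2 with b | b <;>
    rcases lt_or_gt_of_ne h3 with c | c <;> simp [a, b, c, a.not_gt, b.not_gt, c.not_gt] <;>
    exact ⟨q i * q j, by ring⟩

theorem inversionSign_comp {T U : Type} [Fintype T] [Fintype U] {m n : ℕ} (f : T ≃ U)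
    (e : U ≃ Fin m) (e' : U ≃ Fin n) (q : U → ℤ) :
    inversionSign (f.trans e) (f.trans e') (q ∘ f) = inversionSign e e' q := by
  rw [inversionSign, inversionSign, ← f.sum_comp]
  congr 1
  exact Finset.sum_congr rfl fun i _ => f.sum_comp fun j =>
    if e (f i) < e j ∧ e' j < e' (f i) then q (f i) * q j else 0

theorem koszulSign_eq_inversionSign {n : ℕ} (σ : Equiv.Perm (Fin n)) (q : Fin n → ℤ) :
    koszulSign σ q = inversionSign (Equiv.refl _) σ (q ∘ σ) := rfl

/-- The cocycle identity for the three enumerations id, τ and στ of the same set of positions. -/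
theorem koszulSign_mul {n : ℕ} (σ τ : Equiv.Perm (Fin n)) (q : Fin n → ℤ) :
    koszulSign (σ * τ) q = koszulSign σ q * koszulSign τ (q ∘ σ) := by
  rw [koszulSign_eq_inversionSign, koszulSign_eq_inversionSign, koszulSign_eq_inversionSign,
    ← inversionSign_comp τ (Equiv.refl _) σ (q ∘ σ), mul_comm]
  exact (inversionSign_trans (Equiv.refl (Fin n)) (τ.trans (Equiv.refl _)) (τ.trans σ) _).symm

/-- The enumeration of `T ⊔ U` which lists first `T` and then `U`. -/
def sumEnum {T U : Type} {m n : ℕ} (e : T ≃ Fin m) (e' : U ≃ Fin n) : T ⊕ U ≃ Fin (m + n) :=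
  (Equiv.sumCongr e e').trans finSumFinEquiv

/-! ### Signs of concatenated enumerations -/

section sumEnum
variable {T U : Type} {m n : ℕ} (e : T ≃ Fin m) (e' : U ≃ Fin n)

theorem sumEnum_inl (t : T) : sumEnum e e' (.inl t) = Fin.castAdd n (e t) := rfl
theorem sumEnum_inr (v : U) : sumEnum e e' (.inr v) = Fin.natAdd m (e' v) := rfl

@[simp] theorem sumEnum_inl_lt_inl (t t' : T) :
    sumEnum e e' (.inl t) < sumEnum e e' (.inl t') ↔ e t < e t' := by
  simp only [sumEnum_inl, Fin.lt_def, Fin.val_castAdd]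

@[simp] theorem sumEnum_inl_lt_inr (t : T) (v : U) :
    sumEnum e e' (.inl t) < sumEnum e e' (.inr v) ↔ True := by
  simp only [sumEnum_inl, sumEnum_inr, Fin.lt_def, Fin.val_castAdd, Fin.val_natAdd, iff_true]
  omega

@[simp] theorem sumEnum_inr_lt_inl (t : T) (v : U) :
    sumEnum e e' (.inr v) < sumEnum e e' (.inl t) ↔ False := by
  simp only [sumEnum_inl, sumEnum_inr, Fin.lt_def, Fin.val_castAdd, Fin.val_natAdd, iff_false]
  omega

@[simp] theorem sumEnum_inr_lt_inr (v v' : U) :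
    sumEnum e e' (.inr v) < sumEnum e e' (.inr v') ↔ e' v < e' v' := by
  simp only [sumEnum_inr, Fin.lt_def, Fin.val_natAdd, Nat.add_lt_add_iff_left]

theorem inversionSign_sumEnum [Fintype T] [Fintype U] {m' n' : ℕ} (f : T ≃ Fin m')
    (f' : U ≃ Fin n') (q : T ⊕ U → ℤ) :
    inversionSign (sumEnum e e') (sumEnum f f') q =
      inversionSign e f (q ∘ .inl) * inversionSign e' f' (q ∘ .inr) := by
  rw [inversionSign, inversionSign, inversionSign, ← Int.negOnePow_add]
  congr 1
  simp [Fintype.sum_sum_type]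

/-- Exactly the mixed pairs are inverted, and all of them are, so the exponent factors as a product
of the two total degrees. -/
theorem inversionSign_sumEnum_swap [Fintype T] [Fintype U] (q : T ⊕ U → ℤ) :
    inversionSign (sumEnum e e') ((Equiv.sumComm T U).trans (sumEnum e' e)) q =
      ((∑ t, q (.inl t)) * ∑ v, q (.inr v)).negOnePow := by
  rw [inversionSign, Finset.sum_mul_sum]
  congr 1
  simp only [Fintype.sum_sum_type, Equiv.trans_apply, Equiv.sumComm_apply, Sum.swap_inl,
    Sum.swap_inr, sumEnum_inl_lt_inl, sumEnum_inl_lt_inr, sumEnum_inr_lt_inl,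
    sumEnum_inr_lt_inr]
  simp only [and_true, and_false, if_true, if_false, Finset.sum_const_zero]
  have h1 : ∀ i j : T, ¬ (e i < e j ∧ e j < e i) := fun i j h => lt_asymm h.1 h.2
  have h2 : ∀ i j : U, ¬ (e' i < e' j ∧ e' j < e' i) := fun i j h => lt_asymm h.1 h.2
  simp [h1, h2]

end sumEnum

/-! # Homogeneous components -/

namespace GMod
variable {k : Type u} [CommRing k]

theorem induction_gr (M : GMod k) {p : M → Prop} (hom : ∀ n, ∀ x ∈ M.gr n, p x)
    (zero : p 0) (add : ∀ x y, p x → p y → p (x + y)) (x : M) : p x := by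
  have hx : x ∈ ⨆ n, M.gr n := by
    rw [M.internal.submodule_iSup_eq_top]; trivial
  exact Submodule.iSup_induction M.gr (motive := p) hx hom zero add

theorem ext_gr {M : GMod k} {N : Type*} [AddCommGroup N] [Module k N] {f g : M →ₗ[k] N}
    (h : ∀ n, ∀ x ∈ M.gr n, f x = g x) : f = g := by
  ext x
  exact M.induction_gr (p := fun x => f x = g x) h (by simp)
    (fun x y hx hy => by simp [hx, hy]) x

/-- The projection onto the component of degree `n`. -/
def proj (M : GMod k) (n : ℤ) : M →ₗ[k] M :=
  (M.gr n).subtype ∘ₗ DirectSum.component k ℤ (fun n => M.gr n) n ∘ₗ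
    (LinearEquiv.ofBijective (DirectSum.coeLinearMap M.gr) M.internal).symm.toLinearMap

theorem proj_mem (M : GMod k) (n : ℤ) (x : M) : M.proj n x ∈ M.gr n := by
  simp [proj]

theorem proj_of_mem_eq (M : GMod k) (n : ℤ) {m : ℤ} {x : M} (hx : x ∈ M.gr m) :
    M.proj n x = if m = n then x else 0 := by
  have h : (LinearEquiv.ofBijective (DirectSum.coeLinearMap M.gr) M.internal).symm x
      = DirectSum.lof k ℤ (fun n => M.gr n) m ⟨x, hx⟩ := by
    rw [LinearEquiv.symm_apply_eq]
    exact (DirectSum.coeLinearMap_lof M.gr m ⟨x, hx⟩).symm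
  rw [proj, LinearMap.comp_apply, LinearMap.comp_apply, LinearEquiv.coe_coe, h]
  split_ifs with hmn
  · subst hmn
    rw [DirectSum.component.lof_self]
    rfl
  · have : DirectSum.component k ℤ (fun n => M.gr n) n
        (DirectSum.lof k ℤ (fun n => M.gr n) m ⟨x, hx⟩) = 0 :=
      DirectSum.of_eq_of_ne m n _ (Ne.symm hmn)
    rw [this]
    rfl

theorem proj_of_mem (M : GMod k) {n : ℤ} {x : M} (hx : x ∈ M.gr n) : M.proj n x = x := by
  rw [M.proj_of_mem_eq n hx, if_pos rfl]

theorem proj_of_mem_of_ne (M : GMod k) {m n : ℤ} (h : m ≠ n) {x : M} (hx : x ∈ M.gr m) :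
    M.proj n x = 0 := by
  rw [M.proj_of_mem_eq n hx, if_neg h]

/-- A linear map of degree `c` intertwines the projections. -/
theorem map_proj {M N : GMod k} (f : M →ₗ[k] N) (c : ℤ)
    (hf : ∀ {n : ℤ} {x : M}, x ∈ M.gr n → f x ∈ N.gr (n + c)) (n : ℤ) (x : M) :
    f (M.proj n x) = N.proj (n + c) (f x) := by
  induction x using M.induction_gr with
  | hom m x hx =>
    rw [M.proj_of_mem_eq n hx, N.proj_of_mem_eq _ (hf hx)]
    simp only [add_left_inj]
    split_ifs <;> simp
  | zero => simp
  | add x y hx hy => simp [hx, hy]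

theorem map_proj_zero {M N : GMod k} (f : M →ₗ[k] N)
    (hf : ∀ {n : ℤ} {x : M}, x ∈ M.gr n → f x ∈ N.gr n) (n : ℤ) (x : M) :
    f (M.proj n x) = N.proj n (f x) := by
  have h := map_proj f 0 (fun {n x} hx => by rw [add_zero]; exact hf hx) n x
  rwa [add_zero] at h

theorem map_sgn {M N : GMod k} (f : M →ₗ[k] N)
    (hf : ∀ {n : ℤ} {x : M}, x ∈ M.gr n → f x ∈ N.gr n) (x : M) :
    N.sgn (f x) = f (M.sgn x) := by
  induction x using M.induction_gr with
  | hom n x hx => rw [M.sgn_of_mem hx, N.sgn_of_mem (hf hx), Units.smul_def, Units.smul_def,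
      map_zsmul]
  | zero => simp
  | add x y hx hy => simp [hx, hy]

/-- The operator `x ↦ (-1)^{a n} x` on the component of degree `n`. -/
def sgnPow (M : GMod k) (a : ℤ) : M →ₗ[k] M := if Even a then LinearMap.id else M.sgn

theorem sgnPow_of_mem (M : GMod k) (a : ℤ) {n : ℤ} {x : M} (hx : x ∈ M.gr n) :
    M.sgnPow a x = (a * n).negOnePow • x := by
  rw [sgnPow]
  split_ifs with h
  · rw [Int.negOnePow_even _ (h.mul_right n), one_smul, LinearMap.id_apply]
  · rw [M.sgn_of_mem hx]
    congr 1
    rw [Int.negOnePow_eq_iff]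
    obtain ⟨c, rfl⟩ := Int.not_even_iff_odd.1 h
    exact ⟨-(c * n), by ring⟩

theorem map_sgnPow {M N : GMod k} (f : M →ₗ[k] N)
    (hf : ∀ {n : ℤ} {x : M}, x ∈ M.gr n → f x ∈ N.gr n) (a : ℤ) (x : M) :
    N.sgnPow a (f x) = f (M.sgnPow a x) := by
  rw [sgnPow, sgnPow]
  split_ifs
  · rfl
  · exact map_sgn f hf x

/-- An element of the n-th component that is also a sum of elements of the others is both fixed and
killed by `pr n`. All gradings constructed below are verified through such projections. -/
theorem isInternal_of_proj {M : Type*} [AddCommGroup M] [Module k M] (gr : ℤ → Submodule k M)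
    (pr : ℤ → M →ₗ[k] M) (h1 : ∀ n, ∀ x ∈ gr n, pr n x = x)
    (h2 : ∀ m n, m ≠ n → ∀ x ∈ gr m, pr n x = 0) (ht : ⨆ n, gr n = ⊤) :
    DirectSum.IsInternal gr := by
  rw [DirectSum.isInternal_submodule_iff_iSupIndep_and_iSup_eq_top]
  refine ⟨fun n => ?_, ht⟩
  rw [Submodule.disjoint_def]
  intro x hx hx'
  rw [← h1 n x hx]
  have : ⨆ j, ⨆ (_ : j ≠ n), gr j ≤ LinearMap.ker (pr n) :=
    iSup_le fun j => iSup_le fun hj y hy => h2 j n hj y hy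
  exact this hx'

end GMod

theorem unitsSmul_mem {k M : Type*} [CommRing k] [AddCommGroup M] [Module k M]
    {N : Submodule k M} (s : ℤˣ) {x : M} (hx : x ∈ N) : s • x ∈ N := by
  rw [Units.smul_def]
  exact zsmul_mem hx _

theorem map_unitsSmul {M N F : Type*} [AddCommGroup M] [AddCommGroup N] [FunLike F M N]
    [AddMonoidHomClass F M N] (f : F) (s : ℤˣ) (x : M) : f (s • x) = s • f x := by
  rw [Units.smul_def, Units.smul_def, map_zsmul]

/-! # Operations in letters -/

namespace Operad
variable {k : Type u} [CommRing k] (P : Operad k)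

theorem map_sgnPow {S T : Type} [Finite S] [Finite T] (e : S ≃ T) (a : ℤ) (x : P.obj S) :
    (P.obj T).sgnPow a (P.map e x) = P.map e ((P.obj S).sgnPow a x) :=
  GMod.map_sgnPow (M := (P.obj S).toGMod) (N := (P.obj T).toGMod) (P.map e)
    (fun hx => P.map_mem e hx) a x

theorem map_eq_self {S : Type} [Finite S] {e : S ≃ S} (h : ∀ s, e s = s) (x : P.obj S) :
    P.map e x = x := by
  have : e = Equiv.refl S := Equiv.ext h
  rw [this, P.map_refl]

theorem map_congr {S T : Type} [Finite S] [Finite T] {e e' : S ≃ T} (h : ∀ s, e s = e' s)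
    (x : P.obj S) : P.map e x = P.map e' x := by
  rw [Equiv.ext h]

end Operad

section Words
variable {k : Type u} [CommRing k] (P : Operad k) {β : Type u} (deg : β → ℤ)

/-- The degree of a word. -/
def wordDegree {T : Type} [Fintype T] (l : T → β) : ℤ := ∑ t, deg (l t)

theorem wordDegree_comp_equiv {T U : Type} [Fintype T] [Fintype U] (e : T ≃ U) (l : U → β) :
    wordDegree deg (l ∘ e) = wordDegree deg l := e.sum_comp fun t => deg (l t)

theorem wordDegree_sumElim {T U : Type} [Fintype T] [Fintype U] (l : T → β) (l' : U → β) :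
    wordDegree deg (Sum.elim l l') = wordDegree deg l + wordDegree deg l' := by
  simp [wordDegree, Fintype.sum_sum_type]

/-- The sum of all `P(Fin n ⊔ S)` over the words `l₁ ⋯ lₙ` in the alphabet `β`. -/
abbrev PreWords (β : Type u) (S : Type) [Finite S] : Type u :=
  DirectSum (Σ n : ℕ, Fin n → β) fun w => (P.obj (Fin w.1 ⊕ S)).carrier

instance (β : Type u) : DecidableEq (Σ n : ℕ, Fin n → β) := Classical.decEq _

/-- The operation `μ` applied to the letters `l`. -/
def PreWords.mk {S : Type} [Finite S] {n : ℕ} (l : Fin n → β) :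
    P.obj (Fin n ⊕ S) →ₗ[k] PreWords P β S :=
  DirectSum.lof k (Σ n : ℕ, Fin n → β) (fun w => (P.obj (Fin w.1 ⊕ S)).carrier) ⟨n, l⟩

/-- The relations under the symmetric groups. -/
def PreWords.rel (S : Type) [Finite S] : Submodule k (PreWords P β S) :=
  Submodule.span k {t | ∃ (n : ℕ) (l : Fin n → β) (μ : P.obj (Fin n ⊕ S))
    (σ : Equiv.Perm (Fin n)),
    t = PreWords.mk P l (P.map (Equiv.sumCongr σ (Equiv.refl S)) μ) -
      koszulSign σ (deg ∘ l) • PreWords.mk P (l ∘ σ) μ}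

/-- The operations with set of inputs `S` in the operad obtained from `P` by freely adjoining
the elements of a graded set `β` of letters as operations of arity zero. -/
abbrev Words (S : Type) [Finite S] : Type u := PreWords P β S ⧸ PreWords.rel P deg S

variable {S : Type} [Finite S]

/-- The operation `μ` applied to the letters `l`. -/
def word {n : ℕ} (l : Fin n → β) : P.obj (Fin n ⊕ S) →ₗ[k] Words P deg S :=
  (PreWords.rel P deg S).mkQ ∘ₗ PreWords.mk P l

/-- The operation `μ` applied to a family of letters, in the order given by an enumeration. -/
def wordOf {T : Type} [Finite T] {n : ℕ} (e : T ≃ Fin n) (l : T → β) :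
    P.obj (T ⊕ S) →ₗ[k] Words P deg S :=
  word P deg (l ∘ e.symm) ∘ₗ P.map (Equiv.sumCongr e (Equiv.refl S))

theorem word_map {n : ℕ} (l : Fin n → β) (σ : Equiv.Perm (Fin n)) (μ : P.obj (Fin n ⊕ S)) :
    word P deg l (P.map (Equiv.sumCongr σ (Equiv.refl S)) μ) =
      koszulSign σ (deg ∘ l) • word P deg (l ∘ σ) μ := by
  rw [← map_unitsSmul]
  simp only [word, LinearMap.comp_apply, map_unitsSmul]
  rw [← map_unitsSmul, ← sub_eq_zero, ← map_sub, Submodule.mkQ_apply,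
    Submodule.Quotient.mk_eq_zero]
  exact Submodule.subset_span ⟨n, l, μ, σ, rfl⟩

theorem wordOf_refl {n : ℕ} (l : Fin n → β) (μ : P.obj (Fin n ⊕ S)) :
    wordOf P deg (Equiv.refl _) l μ = word P deg l μ := by
  rw [wordOf, LinearMap.comp_apply, P.map_eq_self (by rintro (_ | _) <;> rfl)]
  rfl

theorem wordOf_map {T U : Type} [Finite T] [Finite U] {n : ℕ} (f : T ≃ U) (e : U ≃ Fin n)
    (l : U → β) (μ : P.obj (T ⊕ S)) :
    wordOf P deg e l (P.map (Equiv.sumCongr f (Equiv.refl S)) μ) =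
      wordOf P deg (f.trans e) (l ∘ f) μ := by
  rw [wordOf, wordOf, LinearMap.comp_apply, LinearMap.comp_apply, P.map_map]
  have : (l ∘ f) ∘ (f.trans e).symm = l ∘ e.symm := by
    funext i; simp
  rw [this]
  congr 1
  exact P.map_congr (by rintro (_ | _) <;> rfl) _

/-- Passage to another enumeration of the letters. -/
theorem wordOf_eq {T : Type} [Fintype T] {m n : ℕ} (e : T ≃ Fin m) (e' : T ≃ Fin n)
    (l : T → β) (μ : P.obj (T ⊕ S)) :
    wordOf P deg e l μ = inversionSign e e' (deg ∘ l) • wordOf P deg e' l μ := by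
  obtain rfl : m = n := by simpa using Fintype.card_congr (e.symm.trans e')
  have h := word_map P deg (l ∘ e.symm) (e'.symm.trans e)
    (P.map (Equiv.sumCongr e' (Equiv.refl S)) μ)
  rw [P.map_map] at h
  have h1 : (l ∘ e.symm) ∘ (e'.symm.trans e) = l ∘ e'.symm := by funext i; simp
  have h2 : koszulSign (e'.symm.trans e) (deg ∘ l ∘ e.symm) = inversionSign e e' (deg ∘ l) := by
    rw [koszulSign_eq_inversionSign, ← inversionSign_comp e', inversionSign_symm]
    congr 1
    · ext i; simp
    · funext i; simp
  rw [h1, h2] at h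
  rw [wordOf, wordOf, LinearMap.comp_apply, LinearMap.comp_apply, ← h]
  congr 1
  exact P.map_congr (by rintro (_ | _) <;> simp) _

theorem wordOf_eq_of_lt {T : Type} [Fintype T] {m n : ℕ} (e : T ≃ Fin m) (e' : T ≃ Fin n)
    (h : ∀ i j, e i < e j ↔ e' i < e' j) (l : T → β) (μ : P.obj (T ⊕ S)) :
    wordOf P deg e l μ = wordOf P deg e' l μ := by
  rw [wordOf_eq P deg e e', inversionSign_self e e' _ h, one_smul]

theorem Words.induction {p : Words P deg S → Prop}
    (word : ∀ (n : ℕ) (l : Fin n → β) (q : ℤ) (μ : P.obj (Fin n ⊕ S)),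
      μ ∈ (P.obj (Fin n ⊕ S)).gr q → p (word P deg l μ))
    (zero : p 0) (add : ∀ x y, p x → p y → p (x + y)) (x : Words P deg S) : p x := by
  obtain ⟨x, rfl⟩ := Submodule.Quotient.mk_surjective _ x
  induction x using DirectSum.induction_on with
  | zero => exact zero
  | of w μ =>
    change p (CotripleProducts.word P deg w.2 μ)
    induction μ using (P.obj (Fin w.1 ⊕ S)).toGMod.induction_gr with
    | hom q μ hμ => exact word w.1 w.2 q μ hμ
    | zero => simpa only [map_zero] using zero
    | add x y hx hy =>
      rw [map_add]
      exact add _ _ hx hy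
  | add x y hx hy => exact add _ _ hx hy

theorem Words.hom_ext {M : Type*} [AddCommGroup M] [Module k M]
    {f g : Words P deg S →ₗ[k] M}
    (h : ∀ (n : ℕ) (l : Fin n → β) (μ : P.obj (Fin n ⊕ S)),
      f (word P deg l μ) = g (word P deg l μ)) : f = g := by
  refine LinearMap.ext fun x => ?_
  induction x using Words.induction with
  | word n l q μ hμ => exact h n l μ
  | zero => simp
  | add x y hx hy => rw [map_add, map_add, hx, hy]

/-- Linear maps out of `Words`. -/
def Words.lift {M : Type*} [AddCommGroup M] [Module k M]
    (f : ∀ n : ℕ, (Fin n → β) → (P.obj (Fin n ⊕ S) →ₗ[k] M))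
    (hf : ∀ (n : ℕ) (l : Fin n → β) (μ : P.obj (Fin n ⊕ S)) (σ : Equiv.Perm (Fin n)),
      f n l (P.map (Equiv.sumCongr σ (Equiv.refl S)) μ) =
        koszulSign σ (deg ∘ l) • f n (l ∘ σ) μ) : Words P deg S →ₗ[k] M :=
  Submodule.liftQ _ (DirectSum.toModule k _ M fun w => f w.1 w.2) (by
    rw [PreWords.rel, Submodule.span_le]
    rintro _ ⟨n, l, μ, σ, rfl⟩
    rw [SetLike.mem_coe, LinearMap.mem_ker, map_sub, map_unitsSmul, sub_eq_zero, PreWords.mk,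
      PreWords.mk, DirectSum.toModule_lof, DirectSum.toModule_lof]
    exact hf n l μ σ)

theorem Words.lift_word {M : Type*} [AddCommGroup M] [Module k M]
    (f : ∀ n : ℕ, (Fin n → β) → (P.obj (Fin n ⊕ S) →ₗ[k] M)) (hf) {n : ℕ} (l : Fin n → β)
    (μ : P.obj (Fin n ⊕ S)) : Words.lift P deg f hf (word P deg l μ) = f n l μ := by
  rw [word, LinearMap.comp_apply, Submodule.mkQ_apply, Words.lift, Submodule.liftQ_apply,
    PreWords.mk, DirectSum.toModule_lof]

/-! ## Relabelling of the inputs -/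

/-- The relabelling of the inputs. -/
def Words.map {S' : Type} [Finite S'] (g : S ≃ S') : Words P deg S →ₗ[k] Words P deg S' :=
  Words.lift P deg (fun n l => word P deg l ∘ₗ P.map (Equiv.sumCongr (Equiv.refl (Fin n)) g)) (by
    intro n l μ σ
    rw [LinearMap.comp_apply, LinearMap.comp_apply, ← word_map, P.map_map, P.map_map]
    congr 1
    exact P.map_congr (by rintro (_ | _) <;> rfl) _)

variable {P deg}

theorem Words.map_word {S' : Type} [Finite S'] (g : S ≃ S') {n : ℕ} (l : Fin n → β)
    (μ : P.obj (Fin n ⊕ S)) : Words.map P deg g (word P deg l μ) =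
      word P deg l (P.map (Equiv.sumCongr (Equiv.refl (Fin n)) g) μ) :=
  Words.lift_word P deg _ _ l μ

theorem Words.map_wordOf {S' : Type} [Finite S'] (g : S ≃ S') {T : Type} [Finite T] {n : ℕ}
    (e : T ≃ Fin n) (l : T → β) (μ : P.obj (T ⊕ S)) : Words.map P deg g (wordOf P deg e l μ) =
      wordOf P deg e l (P.map (Equiv.sumCongr (Equiv.refl T) g) μ) := by
  rw [wordOf, wordOf, LinearMap.comp_apply, LinearMap.comp_apply, Words.map_word, P.map_map,
    P.map_map]
  congr 1
  exact P.map_congr (by rintro (_ | _) <;> rfl) _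

theorem Words.map_map {S' S'' : Type} [Finite S'] [Finite S''] (g : S ≃ S') (g' : S' ≃ S'')
    (x : Words P deg S) :
    Words.map P deg g' (Words.map P deg g x) = Words.map P deg (g.trans g') x := by
  induction x using Words.induction with
  | word n l q μ hμ =>
    rw [Words.map_word, Words.map_word, Words.map_word, P.map_map]
    congr 1
    exact P.map_congr (by rintro (_ | _) <;> rfl) _
  | zero => simp
  | add x y hx hy => simp only [map_add, hx, hy]

theorem Words.map_eq_self {e : S ≃ S} (h : ∀ s, e s = s) (x : Words P deg S) :
    Words.map P deg e x = x := by
  induction x using Words.induction with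
  | word n l q μ hμ =>
    rw [Words.map_word, P.map_eq_self]
    rintro (_ | _)
    · rfl
    · simp [h]
  | zero => simp
  | add x y hx hy => simp only [map_add, hx, hy]

theorem Words.map_congr {S' : Type} [Finite S'] {e e' : S ≃ S'} (h : ∀ s, e s = e' s)
    (x : Words P deg S) : Words.map P deg e x = Words.map P deg e' x := by
  rw [Equiv.ext h]

end Words

/-! ## Partial composition -/

namespace Operad
variable {k : Type u} [CommRing k] (P : Operad k)

/-- The partial composite of operations some of whose inputs are reserved for letters. -/
def wcomp {A B S T : Type} [Finite A] [Finite B] [Finite S] [Finite T] :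
    P.obj (A ⊕ Option S) →ₗ[k] P.obj (B ⊕ T) →ₗ[k] P.obj ((B ⊕ A) ⊕ (T ⊕ S)) :=
  (P.comp.compr₂ (P.map (Equiv.sumSumSumComm B T A S))) ∘ₗ P.map (optionSumRight A S)

theorem wcomp_apply {A B S T : Type} [Finite A] [Finite B] [Finite S] [Finite T]
    (x : P.obj (A ⊕ Option S)) (y : P.obj (B ⊕ T)) :
    P.wcomp x y =
      P.map (Equiv.sumSumSumComm B T A S) (P.comp (P.map (optionSumRight A S) x) y) := rfl

theorem wcomp_map {A B S T A' B' S' T' : Type} [Finite A] [Finite B] [Finite S] [Finite T]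
    [Finite A'] [Finite B'] [Finite S'] [Finite T'] (f : A ≃ A') (g : B ≃ B') (a : S ≃ S')
    (b : T ≃ T') (x : P.obj (A ⊕ Option S)) (y : P.obj (B ⊕ T)) :
    P.wcomp (P.map (Equiv.sumCongr f (Equiv.optionCongr a)) x) (P.map (Equiv.sumCongr g b) y) =
      P.map (Equiv.sumCongr (Equiv.sumCongr g f) (Equiv.sumCongr b a)) (P.wcomp x y) := by
  have h := P.comp_map (Equiv.sumCongr f a) (Equiv.sumCongr g b) (P.map (optionSumRight A S) x) y
  rw [P.map_map] at h
  rw [wcomp_apply, wcomp_apply, P.map_map, P.map_map]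
  rw [P.map_congr (e' := (optionSumRight A S).trans (Equiv.optionCongr (Equiv.sumCongr f a)))
    (by rintro (_ | _ | _) <;> rfl), h, P.map_map]
  exact P.map_congr (by rintro ((_ | _) | (_ | _)) <;> rfl) _

theorem wcomp_map_left {A B S T A' : Type} [Finite A] [Finite B] [Finite S] [Finite T]
    [Finite A'] (f : A ≃ A') (x : P.obj (A ⊕ Option S)) (y : P.obj (B ⊕ T)) :
    P.wcomp (P.map (Equiv.sumCongr f (Equiv.refl (Option S))) x) y =
      P.map (Equiv.sumCongr (Equiv.sumCongr (Equiv.refl B) f) (Equiv.refl (T ⊕ S)))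
        (P.wcomp x y) := by
  have h := P.wcomp_map f (Equiv.refl B) (Equiv.refl S) (Equiv.refl T) x y
  rw [P.map_eq_self (e := Equiv.sumCongr (Equiv.refl B) (Equiv.refl T))
    (by rintro (_ | _) <;> rfl)] at h
  rw [P.map_congr (e' := Equiv.sumCongr f (Equiv.optionCongr (Equiv.refl S)))
    (by rintro (_ | _ | _) <;> rfl), h]
  exact P.map_congr (by rintro ((_ | _) | (_ | _)) <;> rfl) _

theorem wcomp_map_right {A B S T B' : Type} [Finite A] [Finite B] [Finite S] [Finite T]
    [Finite B'] (g : B ≃ B') (x : P.obj (A ⊕ Option S)) (y : P.obj (B ⊕ T)) :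
    P.wcomp x (P.map (Equiv.sumCongr g (Equiv.refl T)) y) =
      P.map (Equiv.sumCongr (Equiv.sumCongr g (Equiv.refl A)) (Equiv.refl (T ⊕ S)))
        (P.wcomp x y) := by
  have h := P.wcomp_map (Equiv.refl A) g (Equiv.refl S) (Equiv.refl T) x y
  rw [P.map_eq_self (e := Equiv.sumCongr (Equiv.refl A) (Equiv.optionCongr (Equiv.refl S)))
    (by rintro (_ | _ | _) <;> rfl)] at h
  rw [h]
  exact P.map_congr (by rintro ((_ | _) | (_ | _)) <;> rfl) _

theorem wcomp_sgnPow {A B S T : Type} [Finite A] [Finite B] [Finite S] [Finite T]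
    (a : ℤ) (x : P.obj (A ⊕ Option S)) {q : ℤ} {y : P.obj (B ⊕ T)} (hy : y ∈ (P.obj (B ⊕ T)).gr q) :
    P.wcomp x ((P.obj (B ⊕ T)).sgnPow a y) = (a * q).negOnePow • P.wcomp x y := by
  rw [GMod.sgnPow_of_mem _ _ hy, map_unitsSmul]

theorem wcomp_mem {A B S T : Type} [Finite A] [Finite B] [Finite S] [Finite T] {p q : ℤ}
    {x : P.obj (A ⊕ Option S)} {y : P.obj (B ⊕ T)} (hx : x ∈ (P.obj _).gr p)
    (hy : y ∈ (P.obj (B ⊕ T)).gr q) : P.wcomp x y ∈ (P.obj _).gr (p + q) :=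
  P.map_mem _ (P.comp_mem (P.map_mem _ hx) hy)

end Operad

section comp
variable {k : Type u} [CommRing k] (P : Operad k) {β : Type u} (deg : β → ℤ)
variable {S T : Type} [Finite S] [Finite T]

/-- The partial composite, on representatives. -/
def Words.compAux {n m : ℕ} (l : Fin n → β) (v : Fin m → β) :
    P.obj (Fin m ⊕ T) →ₗ[k] P.obj (Fin n ⊕ Option S) →ₗ[k] Words P deg (T ⊕ S) :=
  -- The letters `l` of the outer operation move past the inner operation y and its letters `v`,
  -- which costs the sign with exponent |l|(|y| + |v|). The factor depending on |y| is the operator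
  -- `sgnPow`, so that the definition is linear in y without assuming y homogeneous.
  ((wordDegree deg l * wordDegree deg v).negOnePow : ℤ) •
    ((P.wcomp.flip ∘ₗ (P.obj (Fin m ⊕ T)).sgnPow (wordDegree deg l)).compr₂
      (wordOf P deg (sumEnum (Equiv.refl _) (Equiv.refl _)) (Sum.elim v l)))

variable {P deg} in
theorem Words.compAux_apply {n m : ℕ} (l : Fin n → β) (v : Fin m → β)
    (x : P.obj (Fin n ⊕ Option S)) (y : P.obj (Fin m ⊕ T)) :
    Words.compAux P deg l v y x = (wordDegree deg l * wordDegree deg v).negOnePow •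
      wordOf P deg (sumEnum (Equiv.refl _) (Equiv.refl _)) (Sum.elim v l)
        (P.wcomp x ((P.obj (Fin m ⊕ T)).sgnPow (wordDegree deg l) y)) := rfl

theorem inversionSign_sumEnum_left {A B : Type} [Fintype A] [Fintype B] {m n : ℕ}
    (e : A ≃ Fin m) (f : A ≃ Fin m) (e' : B ≃ Fin n) (q : A ⊕ B → ℤ) :
    inversionSign (sumEnum e e') (sumEnum f e') q = inversionSign e f (q ∘ .inl) := by
  rw [inversionSign_sumEnum, inversionSign_self e' e' _ (fun _ _ => Iff.rfl), mul_one]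

theorem inversionSign_sumEnum_right {A B : Type} [Fintype A] [Fintype B] {m n : ℕ}
    (e : A ≃ Fin m) (e' : B ≃ Fin n) (f' : B ≃ Fin n) (q : A ⊕ B → ℤ) :
    inversionSign (sumEnum e e') (sumEnum e f') q = inversionSign e' f' (q ∘ .inr) := by
  rw [inversionSign_sumEnum, inversionSign_self e e _ (fun _ _ => Iff.rfl), one_mul]

theorem sumEnum_trans {A B A' B' : Type} {m n : ℕ} (f : A ≃ A') (g : B ≃ B') (e : A' ≃ Fin m)
    (e' : B' ≃ Fin n) :
    (Equiv.sumCongr f g).trans (sumEnum e e') = sumEnum (f.trans e) (g.trans e') := by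
  ext i
  rcases i with _ | _ <;> rfl

variable {P deg} in
theorem Words.compAux_map_left {n m : ℕ} (l : Fin n → β) (v : Fin m → β)
    (x : P.obj (Fin n ⊕ Option S)) (y : P.obj (Fin m ⊕ T)) (σ : Equiv.Perm (Fin n)) :
    Words.compAux P deg l v y (P.map (Equiv.sumCongr σ (Equiv.refl (Option S))) x) =
      koszulSign σ (deg ∘ l) • Words.compAux P deg (l ∘ σ) v y x := by
  rw [Words.compAux_apply, Words.compAux_apply, wordDegree_comp_equiv, smul_comm,
    P.wcomp_map_left, wordOf_map, sumEnum_trans,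
    wordOf_eq P deg _ (sumEnum (Equiv.refl _) (Equiv.refl _)), Equiv.trans_refl, Equiv.trans_refl,
    inversionSign_sumEnum_right, inversionSign_symm, koszulSign_eq_inversionSign]
  have : Sum.elim v l ∘ (Equiv.sumCongr (Equiv.refl (Fin m)) σ) = Sum.elim v (l ∘ σ) := by
    funext i
    rcases i with _ | _ <;> rfl
  rw [this]
  rfl

variable {P deg} in
theorem Words.compAux_map_right {n m : ℕ} (l : Fin n → β) (v : Fin m → β)
    (x : P.obj (Fin n ⊕ Option S)) (y : P.obj (Fin m ⊕ T)) (σ : Equiv.Perm (Fin m)) :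
    Words.compAux P deg l v (P.map (Equiv.sumCongr σ (Equiv.refl T)) y) x =
      koszulSign σ (deg ∘ v) • Words.compAux P deg l (v ∘ σ) y x := by
  rw [Words.compAux_apply, Words.compAux_apply, wordDegree_comp_equiv, smul_comm,
    P.map_sgnPow, P.wcomp_map_right, wordOf_map, sumEnum_trans,
    wordOf_eq P deg _ (sumEnum (Equiv.refl _) (Equiv.refl _)), Equiv.trans_refl, Equiv.trans_refl,
    inversionSign_sumEnum_left, inversionSign_symm, koszulSign_eq_inversionSign]
  have : Sum.elim v l ∘ (Equiv.sumCongr σ (Equiv.refl (Fin n))) = Sum.elim (v ∘ σ) l := by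
    funext i
    rcases i with _ | _ <;> rfl
  rw [this]
  rfl

/-- The partial composition with a word. -/
def Words.compWord {n : ℕ} (l : Fin n → β) :
    Words P deg T →ₗ[k] P.obj (Fin n ⊕ Option S) →ₗ[k] Words P deg (T ⊕ S) :=
  Words.lift P deg (fun _ v => Words.compAux P deg l v) fun _ v y σ =>
    LinearMap.ext fun x => Words.compAux_map_right l v x y σ

/-- The partial composition of operations in letters. -/
def Words.comp : Words P deg (Option S) →ₗ[k] Words P deg T →ₗ[k] Words P deg (T ⊕ S) :=
  Words.lift P deg (fun _ l => (Words.compWord P deg l).flip) fun n l x σ => by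
    refine Words.hom_ext P deg fun m v y => ?_
    rw [LinearMap.smul_apply, LinearMap.flip_apply, LinearMap.flip_apply, Words.compWord,
      Words.compWord, Words.lift_word, Words.lift_word]
    exact Words.compAux_map_left l v x y σ

variable {P deg}

theorem Words.comp_word {n m : ℕ} (l : Fin n → β) (v : Fin m → β)
    (x : P.obj (Fin n ⊕ Option S)) {q : ℤ} {y : P.obj (Fin m ⊕ T)}
    (hy : y ∈ (P.obj (Fin m ⊕ T)).gr q) :
    Words.comp P deg (word P deg l x) (word P deg v y) =
      (wordDegree deg l * (q + wordDegree deg v)).negOnePow •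
        wordOf P deg (sumEnum (Equiv.refl _) (Equiv.refl _)) (Sum.elim v l) (P.wcomp x y) := by
  rw [Words.comp, Words.lift_word, LinearMap.flip_apply, Words.compWord, Words.lift_word,
    Words.compAux_apply,
    P.wcomp_sgnPow _ _ hy, map_unitsSmul, smul_smul, ← Int.negOnePow_add]
  congr 2
  ring

/-- Letters indexed by arbitrary finite sets are needed for iterated composites: the letters of a
composite are indexed by a sum type, and renumbering them at each step is avoided. -/
theorem Words.comp_wordOf {A B : Type} [Fintype A] [Fintype B] {n m : ℕ} (e : A ≃ Fin n)
    (e' : B ≃ Fin m) (l : A → β) (v : B → β)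
    (x : P.obj (A ⊕ Option S)) {q : ℤ} {y : P.obj (B ⊕ T)}
    (hy : y ∈ (P.obj (B ⊕ T)).gr q) :
    Words.comp P deg (wordOf P deg e l x) (wordOf P deg e' v y) =
      (wordDegree deg l * (q + wordDegree deg v)).negOnePow •
        wordOf P deg (sumEnum e' e) (Sum.elim v l) (P.wcomp x y) := by
  rw [wordOf, wordOf, LinearMap.comp_apply, LinearMap.comp_apply,
    Words.comp_word _ _ _ (P.map_mem _ hy), wordDegree_comp_equiv, wordDegree_comp_equiv]
  congr 1
  rw [P.wcomp_map_left, P.wcomp_map_right, wordOf_map, wordOf_map, sumEnum_trans, sumEnum_trans,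
    Equiv.refl_trans, Equiv.trans_refl, Equiv.trans_refl]
  congr 2
  funext i
  rcases i with _ | _ <;> simp

/-- Homogeneous components of operations in letters. -/
def Words.gr (P : Operad k) (deg : β → ℤ) (S : Type) [Finite S] (p : ℤ) :
    Submodule k (Words P deg S) :=
  Submodule.span k {x | ∃ (n : ℕ) (l : Fin n → β) (q : ℤ) (μ : P.obj (Fin n ⊕ S)),
    μ ∈ (P.obj (Fin n ⊕ S)).gr q ∧ q + wordDegree deg l = p ∧ x = word P deg l μ}

theorem Words.word_mem_gr {n : ℕ} (l : Fin n → β) {q : ℤ} {μ : P.obj (Fin n ⊕ S)}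
    (hμ : μ ∈ (P.obj (Fin n ⊕ S)).gr q) :
    word P deg l μ ∈ Words.gr P deg S (q + wordDegree deg l) :=
  Submodule.subset_span ⟨n, l, q, μ, hμ, rfl, rfl⟩

theorem Words.wordOf_mem_gr {A : Type} [Fintype A] {n : ℕ} (e : A ≃ Fin n) (l : A → β) {q : ℤ}
    {μ : P.obj (A ⊕ S)} (hμ : μ ∈ (P.obj (A ⊕ S)).gr q) :
    wordOf P deg e l μ ∈ Words.gr P deg S (q + wordDegree deg l) := by
  rw [← wordDegree_comp_equiv deg e.symm l]
  exact Words.word_mem_gr _ (P.map_mem _ hμ)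

theorem Words.gr_induction {d : ℤ} {p : Words P deg S → Prop}
    (word : ∀ (n : ℕ) (l : Fin n → β) (q : ℤ) (μ : P.obj (Fin n ⊕ S)),
      μ ∈ (P.obj (Fin n ⊕ S)).gr q → q + wordDegree deg l = d → p (word P deg l μ))
    (zero : p 0) (add : ∀ x y, p x → p y → p (x + y)) {x : Words P deg S}
    (hx : x ∈ Words.gr P deg S d) : p x := by
  refine Submodule.closure_induction (p := fun x _ => p x) zero
    (fun x y _ _ => add x y) ?_ hx
  rintro r _ ⟨n, l, q, μ, hμ, h, rfl⟩
  rw [← map_smul]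
  exact word n l q _ (Submodule.smul_mem _ r hμ) h

theorem Words.map_mem {S' : Type} [Finite S'] (g : S ≃ S') {p : ℤ} {x : Words P deg S}
    (hx : x ∈ Words.gr P deg S p) : Words.map P deg g x ∈ Words.gr P deg S' p := by
  refine Words.gr_induction (p := fun x => Words.map P deg g x ∈ Words.gr P deg S' p)
    ?_ ?_ ?_ hx
  · intro n l q μ hμ h
    rw [Words.map_word, ← h]
    exact Words.word_mem_gr l (P.map_mem _ hμ)
  · simp
  · intro x y hx hy
    rw [_root_.map_add]
    exact add_mem hx hy

theorem Words.comp_mem {p q : ℤ} {x : Words P deg (Option S)} {y : Words P deg T}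
    (hx : x ∈ Words.gr P deg (Option S) p) (hy : y ∈ Words.gr P deg T q) :
    Words.comp P deg x y ∈ Words.gr P deg (T ⊕ S) (p + q) := by
  refine Words.gr_induction
    (p := fun x => Words.comp P deg x y ∈ Words.gr P deg (T ⊕ S) (p + q)) ?_ ?_ ?_ hx
  · intro n l p' x hx h
    refine Words.gr_induction (p := fun y => Words.comp P deg (word P deg l x) y ∈
      Words.gr P deg (T ⊕ S) (p + q)) ?_ ?_ ?_ hy
    · intro m v q' y hy h'
      rw [Words.comp_word _ _ _ hy]
      refine unitsSmul_mem _ ?_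
      have := Words.wordOf_mem_gr (deg := deg)
        (sumEnum (Equiv.refl (Fin m)) (Equiv.refl (Fin n))) (Sum.elim v l) (P.wcomp_mem hx hy)
      rw [wordDegree_sumElim] at this
      rwa [show p + q = p' + q' + (wordDegree deg v + wordDegree deg l) by omega]
    · simp
    · intro x y hx hy
      rw [_root_.map_add]
      exact add_mem hx hy
  · simp
  · intro x y hx hy
    rw [_root_.map_add, LinearMap.add_apply]
    exact add_mem hx hy

/-- Equivariance of the partial composition. -/
theorem Words.comp_map {S' T' : Type} [Finite S'] [Finite T'] (a : S ≃ S') (b : T ≃ T')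
    (x : Words P deg (Option S)) (y : Words P deg T) :
    Words.comp P deg (Words.map P deg (Equiv.optionCongr a) x) (Words.map P deg b y) =
      Words.map P deg (Equiv.sumCongr b a) (Words.comp P deg x y) := by
  induction x using Words.induction with
  | word n l p x hx =>
    induction y using Words.induction with
    | word m v q y hy =>
      rw [Words.map_word, Words.map_word, Words.comp_word _ _ _ (P.map_mem _ hy),
        Words.comp_word _ _ _ hy, map_unitsSmul, Words.map_wordOf, P.wcomp_map]
      congr 2
      exact P.map_congr (by rintro ((_ | _) | (_ | _)) <;> rfl) _
    | zero => simp
    | add x y hx hy => simp only [map_add, hx, hy]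
  | zero => simp
  | add x y hx hy => simp only [map_add, LinearMap.add_apply, hx, hy]

end comp

/-! ### Associativity and commutativity of the partial composition -/

namespace Operad
variable {k : Type u} [CommRing k] (P : Operad k)

theorem comp_map_left {S S' T : Type} [Finite S] [Finite S'] [Finite T]
    (e : S ≃ S') (x : P.obj (Option S)) (y : P.obj T) :
    P.comp (P.map (Equiv.optionCongr e) x) y =
      P.map (Equiv.sumCongr (Equiv.refl T) e) (P.comp x y) := by
  rw [← P.comp_map, P.map_refl]

theorem comp_map_right {S T T' : Type} [Finite S] [Finite T] [Finite T']
    (e : T ≃ T') (x : P.obj (Option S)) (y : P.obj T) :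
    P.comp x (P.map e y) = P.map (Equiv.sumCongr e (Equiv.refl S)) (P.comp x y) := by
  rw [← P.comp_map, P.map_eq_self (by rintro (_ | _) <;> rfl)]

/-- Equivariance moves every relabelling to the outside. What is left is the sequential axiom of P
and an equality of two bijections, which is checked on each summand. -/
theorem wcomp_wcomp {A B C S T U : Type} [Finite A] [Finite B] [Finite C] [Finite S] [Finite T]
    [Finite U] (x : P.obj (A ⊕ Option S)) (y : P.obj (B ⊕ Option T)) (z : P.obj (C ⊕ U)) :
    P.wcomp (P.map (Equiv.sumCongr (Equiv.refl _) (optionSumLeft T S)) (P.wcomp x y)) z =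
      P.map (Equiv.sumCongr (Equiv.sumAssoc C B A) (Equiv.sumAssoc U T S))
        (P.wcomp x (P.wcomp y z)) := by
  have h := P.comp_comp (P.map (optionSumRight A S) x) (P.map (optionSumRight B T) y) z
  have h1 : P.wcomp (P.map (Equiv.sumCongr (Equiv.refl _) (optionSumLeft T S)) (P.wcomp x y)) z
      = P.map ((Equiv.sumCongr (Equiv.refl (C ⊕ U)) (Equiv.sumSumSumComm B T A S)).trans
          (Equiv.sumSumSumComm C U (B ⊕ A) (T ⊕ S)))
        (P.comp (P.map (optionSumLeft (B ⊕ T) (A ⊕ S))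
          (P.comp (P.map (optionSumRight A S) x) (P.map (optionSumRight B T) y))) z) := by
    rw [← P.map_map, ← P.comp_map_left, P.comp_map_right, wcomp_apply, wcomp_apply]
    simp only [P.map_map]
    congr 3
    exact P.map_congr (by rintro ((_ | _ | _) | (_ | _)) <;> rfl) _
  rw [h1, h, wcomp_apply P x, wcomp_apply P y, P.comp_map_right, P.map_map, P.map_map, P.map_map]
  exact P.map_congr (by rintro (((_ | _) | (_ | _)) | (_ | _)) <;> rfl) _

theorem wcomp_comm {A B C S T U : Type} [Finite A] [Finite B] [Finite C] [Finite S] [Finite T]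
    [Finite U] {p q : ℤ} (x : P.obj (A ⊕ Option (Option S))) {y : P.obj (B ⊕ T)}
    {z : P.obj (C ⊕ U)} (hy : y ∈ (P.obj (B ⊕ T)).gr p) (hz : z ∈ (P.obj (C ⊕ U)).gr q) :
    P.wcomp (P.map (Equiv.sumCongr (Equiv.refl _) (optionSumRight T S)) (P.wcomp x y)) z =
      (p * q).negOnePow •
        P.map (Equiv.sumCongr (sumLeftComm B C A) (sumLeftComm T U S))
          (P.wcomp (P.map (Equiv.sumCongr (Equiv.refl _) (optionSumRight U S))
            (P.wcomp (P.map (Equiv.sumCongr (Equiv.refl _) (optionSwap S)) x) z)) y) := by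
  -- Normal form with the relabellings outside and a bare double composite of P inside. It is stated
  -- for arbitrary sets because it is applied to both sides, with the roles of (B, T) and (C, U)
  -- exchanged.
  have key : ∀ {B C T U : Type} [Finite B] [Finite C] [Finite T] [Finite U]
      (x : P.obj (A ⊕ Option (Option S))) (y : P.obj (B ⊕ T)) (z : P.obj (C ⊕ U)),
      P.wcomp (P.map (Equiv.sumCongr (Equiv.refl _) (optionSumRight T S)) (P.wcomp x y)) z =
      P.map ((Equiv.sumCongr (Equiv.refl (C ⊕ U)) (Equiv.sumSumSumComm B T A S)).trans
          (Equiv.sumSumSumComm C U (B ⊕ A) (T ⊕ S)))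
        (P.comp (P.map (optionSumRight (B ⊕ T) (A ⊕ S))
          (P.comp (P.map ((optionSumRight A (Option S)).trans
            (Equiv.optionCongr (optionSumRight A S))) x) y)) z) := by
    intro B C T U _ _ _ _ x y z
    have h : P.comp (P.map ((optionSumRight A (Option S)).trans
        (Equiv.optionCongr (optionSumRight A S))) x) y =
        P.map (Equiv.sumCongr (Equiv.refl _) (optionSumRight A S))
          (P.comp (P.map (optionSumRight A (Option S)) x) y) := by
      rw [← P.map_map, P.comp_map_left]
    rw [h, ← P.map_map, ← P.comp_map_left, wcomp_apply, wcomp_apply]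
    simp only [P.map_map]
    congr 3
    refine P.map_congr (fun s => ?_) _
    rcases s with (_ | _) | (_ | _ | _) <;> rfl
  rw [key, key, P.comp_comm _ hy hz, map_unitsSmul, P.map_map, P.map_map, P.map_map, P.map_map]
  congr 1
  rw [P.map_congr (e := (Equiv.sumCongr (Equiv.refl A) (optionSwap S)).trans
      ((optionSumRight A (Option S)).trans (Equiv.optionCongr (optionSumRight A S))))
    (e' := ((optionSumRight A (Option S)).trans
            (Equiv.optionCongr (optionSumRight A S))).trans (optionSwap (A ⊕ S)))
    (by rintro (_ | _ | _ | _) <;> rfl)]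
  exact P.map_congr (by rintro ((_ | _) | ((_ | _) | (_ | _))) <;> rfl) _

end Operad

/-- Only the pairs with one member in B and one in C are inverted; the block A stays last. -/
theorem inversionSign_sumEnum_leftComm {A B C : Type} [Fintype A] [Fintype B] [Fintype C]
    {m n p : ℕ} (a : A ≃ Fin m) (b : B ≃ Fin n) (c : C ≃ Fin p) (q : B ⊕ (C ⊕ A) → ℤ) :
    inversionSign ((sumLeftComm B C A).trans (sumEnum c (sumEnum b a)))
      (sumEnum b (sumEnum c a)) q =
      ((∑ t, q (.inl t)) * ∑ v, q (.inr (.inl v))).negOnePow := by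
  rw [inversionSign, Finset.sum_mul_sum, Finset.sum_comm]
  congr 1
  have l1 : ∀ t, sumLeftComm B C A (.inl t) = .inr (.inl t) := fun _ => rfl
  have l2 : ∀ t, sumLeftComm B C A (.inr (.inl t)) = .inl t := fun _ => rfl
  have l3 : ∀ t, sumLeftComm B C A (.inr (.inr t)) = .inr (.inr t) := fun _ => rfl
  have h1 : ∀ i j, ¬ (b i < b j ∧ b j < b i) := fun i j h => lt_asymm h.1 h.2
  have h2 : ∀ i j, ¬ (c i < c j ∧ c j < c i) := fun i j h => lt_asymm h.1 h.2
  have h3 : ∀ i j, ¬ (a i < a j ∧ a j < a i) := fun i j h => lt_asymm h.1 h.2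
  simp only [Fintype.sum_sum_type, Equiv.trans_apply, l1, l2, l3, sumEnum_inl_lt_inl,
    sumEnum_inl_lt_inr, sumEnum_inr_lt_inl, sumEnum_inr_lt_inr, h1, h2, h3]
  simp [mul_comm]

section comp
variable {k : Type u} [CommRing k] {P : Operad k} {β : Type u} {deg : β → ℤ}
variable {S T U : Type} [Finite S] [Finite T] [Finite U]

theorem wordOf_sumCongr {A B : Type} [Finite A] [Finite B] {n : ℕ} (f : A ≃ B) (g : S ≃ T)
    (e : B ≃ Fin n) (l : B → β) (μ : P.obj (A ⊕ S)) :
    wordOf P deg e l (P.map (Equiv.sumCongr f g) μ) =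
      Words.map P deg g (wordOf P deg (f.trans e) (l ∘ f) μ) := by
  rw [← wordOf_map, Words.map_wordOf, P.map_map]
  congr 1
  exact P.map_congr (by rintro (_ | _) <;> rfl) _

/-- Sequential composition. -/
theorem Words.comp_comp (x : Words P deg (Option S)) (y : Words P deg (Option T))
    (z : Words P deg U) :
    Words.comp P deg (Words.map P deg (optionSumLeft T S) (Words.comp P deg x y)) z =
      Words.map P deg (Equiv.sumAssoc U T S) (Words.comp P deg x (Words.comp P deg y z)) := by
  induction x using Words.induction with
  | zero => simp
  | add x x' hx hx' => simp only [map_add, LinearMap.add_apply, hx, hx']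
  | word n l p x hx =>
  induction y using Words.induction with
  | zero => simp
  | add y y' hy hy' => simp only [map_add, LinearMap.add_apply, hy, hy']
  | word m v q y hy =>
  induction z using Words.induction with
  | zero => simp
  | add z z' hz hz' => simp only [map_add, hz, hz']
  | word o w r z hz =>
  rw [Words.comp_word _ _ _ hy, Words.comp_word _ _ _ hz, map_unitsSmul, map_unitsSmul,
    map_unitsSmul, LinearMap.smul_apply, Words.map_wordOf, ← wordOf_refl P deg w,
    Words.comp_wordOf _ _ _ _ _ hz, ← wordOf_refl P deg l,
    Words.comp_wordOf _ _ _ _ _ (P.wcomp_mem hy hz), map_unitsSmul,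
    P.wcomp_wcomp, map_unitsSmul, smul_smul, smul_smul, ← Int.negOnePow_add,
    ← Int.negOnePow_add, wordDegree_sumElim, wordDegree_sumElim, wordOf_sumCongr]
  have hl : Sum.elim w (Sum.elim v l) ∘ Equiv.sumAssoc (Fin o) (Fin m) (Fin n) =
      Sum.elim (Sum.elim w v) l := by
    funext i
    rcases i with (_ | _) | _ <;> rfl
  -- Both bracketings list the letters in the order w, v, l, so no sign arises from renumbering and
  -- only the exponents remain to be compared.
  rw [hl, wordOf_eq_of_lt P deg (e' := sumEnum (sumEnum (Equiv.refl _) (Equiv.refl _))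
    (Equiv.refl _))]
  · congr 2
    ring
  · rintro ((_ | _) | _) ((_ | _) | _) <;> simp

/-- Parallel composition. -/
theorem Words.comp_comm (x : Words P deg (Option (Option S))) {p q : ℤ} {y : Words P deg T}
    {z : Words P deg U} (hy : y ∈ Words.gr P deg T p) (hz : z ∈ Words.gr P deg U q) :
    Words.comp P deg (Words.map P deg (optionSumRight T S) (Words.comp P deg x y)) z =
      (p * q).negOnePow • Words.map P deg (sumLeftComm T U S)
        (Words.comp P deg (Words.map P deg (optionSumRight U S)
          (Words.comp P deg (Words.map P deg (optionSwap S) x) z)) y) := by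
  induction x using Words.induction with
  | zero => simp
  | add x x' hx hx' => simp only [map_add, LinearMap.add_apply, smul_add, hx, hx']
  | word n l r x hx =>
  refine Words.gr_induction (p := fun y => Words.comp P deg (Words.map P deg (optionSumRight T S)
    (Words.comp P deg (word P deg l x) y)) z = (p * q).negOnePow • Words.map P deg
      (sumLeftComm T U S) (Words.comp P deg (Words.map P deg (optionSumRight U S)
          (Words.comp P deg (Words.map P deg (optionSwap S) (word P deg l x)) z)) y))
    ?_ (by simp)
    (fun y y' h h' => by simp only [map_add, LinearMap.add_apply, smul_add, h, h']) hy
  intro m v p' y hy hp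
  refine Words.gr_induction (p := fun z => Words.comp P deg (Words.map P deg (optionSumRight T S)
    (Words.comp P deg (word P deg l x) (word P deg v y))) z = (p * q).negOnePow • Words.map P deg
      (sumLeftComm T U S) (Words.comp P deg (Words.map P deg (optionSumRight U S)
        (Words.comp P deg (Words.map P deg (optionSwap S) (word P deg l x)) z)) (word P deg v y)))
    ?_ (by simp)
    (fun y y' h h' => by simp only [map_add, LinearMap.add_apply, smul_add, h, h']) hz
  intro o w q' z hz hq
  rw [Words.comp_word _ _ _ hy, Words.map_word, Words.comp_word _ _ _ hz, map_unitsSmul,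
    map_unitsSmul, map_unitsSmul, map_unitsSmul, LinearMap.smul_apply,
    LinearMap.smul_apply, Words.map_wordOf, Words.map_wordOf, ← wordOf_refl P deg w,
    ← wordOf_refl P deg v,
    Words.comp_wordOf _ _ _ _ _ hz, Words.comp_wordOf _ _ _ _ _ hy, map_unitsSmul,
    P.wcomp_comm _ hy hz, map_unitsSmul, wordOf_sumCongr]
  have hl : Sum.elim w (Sum.elim v l) ∘ sumLeftComm (Fin m) (Fin o) (Fin n) =
      Sum.elim v (Sum.elim w l) := by
    funext i
    rcases i with _ | (_ | _) <;> rfl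
  rw [hl, wordOf_eq P deg _ (sumEnum (Equiv.refl (Fin m))
    (sumEnum (Equiv.refl (Fin o)) (Equiv.refl (Fin n)))), inversionSign_sumEnum_leftComm]
  simp only [map_unitsSmul, smul_smul, ← Int.negOnePow_add]
  congr 1
  rw [Int.negOnePow_eq_iff, wordDegree_sumElim, wordDegree_sumElim, ← hp, ← hq]
  change Even (_ + (_ + (_ + wordDegree deg v * wordDegree deg w)) - _)
  generalize wordDegree deg v = a
  generalize wordDegree deg w = b
  generalize wordDegree deg l = c
  -- The exponents differ by twice the product of the degree of the letters `w` and the degree `p'`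
  -- of the operation y.
  exact ⟨-(b * p'), by ring⟩

end comp

/-! # The free algebra on a graded set of letters -/

/-- The operad `P` with its differentials replaced by zero. -/
abbrev Operad.forget {k : Type u} [CommRing k] (P : Operad k) : Operad k where
  obj S _ :=
    { toGMod := (P.obj S).toGMod
      d := 0
      d_mem := fun _ => Submodule.zero_mem _
      d_d := fun _ => rfl }
  map e := P.map e
  map_mem := P.map_mem
  map_d e x := map_zero (P.map e)
  map_refl := P.map_refl
  map_map := P.map_map
  comp := P.comp
  comp_mem := P.comp_mem
  d_comp := by intros; simp
  comp_map := P.comp_map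
  comp_comp := P.comp_comp
  comp_comm := P.comp_comm
  one := P.one
  one_mem := P.one_mem
  d_one := rfl
  one_comp := P.one_comp
  comp_one := P.comp_one

theorem koszulSign_of_succ {n : ℕ} {σ : Equiv.Perm (Fin (n + 1))} {τ : Equiv.Perm (Fin n)}
    (h0 : σ 0 = 0) (hs : ∀ i, σ (Fin.succ i) = Fin.succ (τ i)) (q : Fin (n + 1) → ℤ) :
    koszulSign σ q = koszulSign τ (Fin.tail q) := by
  rw [koszulSign, koszulSign]
  simp [Fin.sum_univ_succ, h0, hs, Fin.tail]

theorem koszulSign_swap_zero_one {n : ℕ} (q : Fin (n + 2) → ℤ) :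
    koszulSign (Equiv.swap 0 1) q = (q 0 * q 1).negOnePow := by
  have h : ∀ i : Fin n, Equiv.swap (0 : Fin (n + 2)) 1 i.succ.succ = i.succ.succ := fun i =>
    Equiv.swap_apply_of_ne_of_ne (Fin.succ_ne_zero _) (by
      rw [← Fin.succ_zero_eq_one]
      exact fun h => Fin.succ_ne_zero _ (Fin.succ_injective _ h))
  have h2 : ∀ i j : Fin n, ¬ (i < j ∧ j < i) := fun i j h => lt_asymm h.1 h.2
  rw [koszulSign]
  simp only [Fin.sum_univ_succ, h, Fin.succ_zero_eq_one, Equiv.swap_apply_left,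
    Equiv.swap_apply_right, Fin.succ_lt_succ_iff, h2]
  simp [Fin.lt_def, mul_comm]

/-! ### Plugging operations of arity zero into inputs -/

section words
variable {k : Type u} [CommRing k] {P : Operad k} {β : Type u} {deg : β → ℤ}
variable {S T U : Type} [Finite S] [Finite T] [Finite U]

variable (P deg) in
/-- The composite with an operation of arity zero. -/
def Words.plug : Words P deg (Option S) →ₗ[k] Words P deg Empty →ₗ[k] Words P deg S :=
  (Words.comp P deg).compr₂ (Words.map P deg (Equiv.emptySum Empty S))

theorem Words.plug_apply (x : Words P deg (Option S)) (a : Words P deg Empty) :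
    Words.plug P deg x a = Words.map P deg (Equiv.emptySum Empty S) (Words.comp P deg x a) := rfl

theorem Words.comp_map_left (e : S ≃ U) (x : Words P deg (Option S)) (y : Words P deg T) :
    Words.comp P deg (Words.map P deg (Equiv.optionCongr e) x) y =
      Words.map P deg (Equiv.sumCongr (Equiv.refl T) e) (Words.comp P deg x y) := by
  rw [← Words.comp_map, Words.map_eq_self (fun _ => rfl)]

theorem Words.comp_map_right (e : T ≃ U) (x : Words P deg (Option S)) (y : Words P deg T) :
    Words.comp P deg x (Words.map P deg e y) =
      Words.map P deg (Equiv.sumCongr e (Equiv.refl S)) (Words.comp P deg x y) := by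
  rw [← Words.comp_map, Words.map_eq_self (e := Equiv.optionCongr (Equiv.refl S))
    (by rintro (_ | _) <;> rfl)]

theorem Words.plug_map (e : S ≃ T) (x : Words P deg (Option S)) (a : Words P deg Empty) :
    Words.plug P deg (Words.map P deg (Equiv.optionCongr e) x) a =
      Words.map P deg e (Words.plug P deg x a) := by
  rw [Words.plug_apply, Words.plug_apply, Words.comp_map_left, Words.map_map, Words.map_map]
  exact Words.map_congr (by rintro (_ | _) <;> first | contradiction | rfl) _

theorem Words.plug_mem {p q : ℤ} {x : Words P deg (Option S)} {a : Words P deg Empty}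
    (hx : x ∈ Words.gr P deg (Option S) p) (ha : a ∈ Words.gr P deg Empty q) :
    Words.plug P deg x a ∈ Words.gr P deg S (p + q) :=
  Words.map_mem _ (Words.comp_mem hx ha)

/-- The parallel axiom with both inner input sets empty. This is the source of the Koszul signs in
the symmetry of `Words.act`. -/
theorem Words.plug_comm (x : Words P deg (Option (Option S))) {p q : ℤ}
    {a b : Words P deg Empty} (ha : a ∈ Words.gr P deg Empty p) (hb : b ∈ Words.gr P deg Empty q) :
    Words.plug P deg (Words.plug P deg x a) b = (p * q).negOnePow •
      Words.plug P deg (Words.plug P deg (Words.map P deg (optionSwap S) x) b) a := by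
  have key : ∀ (x : Words P deg (Option (Option S))) (a b : Words P deg Empty),
      Words.plug P deg (Words.plug P deg x a) b =
        Words.map P deg ((Equiv.emptySum Empty (Empty ⊕ S)).trans (Equiv.emptySum Empty S))
          (Words.comp P deg
            (Words.map P deg (optionSumRight Empty S) (Words.comp P deg x a)) b) := by
    intro x a b
    rw [Words.plug_apply x a, Words.map_congr
      (e' := (optionSumRight Empty S).trans (Equiv.optionCongr (Equiv.emptySum Empty S)))
      (by rintro (_ | _ | _) <;> first | contradiction | rfl), ← Words.map_map, Words.plug_map,
      Words.plug_apply, Words.map_map]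
  rw [key, key, Words.comp_comm x ha hb, map_unitsSmul, Words.map_map]
  congr 1
  exact Words.map_congr (by rintro (_ | _ | _) <;> first | contradiction | rfl) _

theorem Words.plug_comp (x : Words P deg (Option S)) (y : Words P deg (Option T))
    (a : Words P deg Empty) :
    Words.plug P deg (Words.map P deg (optionSumLeft T S) (Words.comp P deg x y)) a =
      Words.comp P deg x (Words.plug P deg y a) := by
  rw [Words.plug_apply, Words.plug_apply, Words.comp_comp, Words.comp_map_right, Words.map_map]
  exact Words.map_congr (by rintro ((_ | _) | _) <;> first | contradiction | rfl) _

variable (P deg) in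
/-- The composition of an operation in letters with operations of arity zero. -/
def Words.act : (n : ℕ) → Words P deg (Fin n) →ₗ[k]
    MultilinearMap k (fun _ : Fin n => Words P deg Empty) (Words P deg Empty)
  | 0 => (MultilinearMap.constLinearEquivOfIsEmpty k k
        (fun _ : Fin 0 => Words P deg Empty) (Words P deg Empty)).toLinearMap ∘ₗ
      Words.map P deg finZeroEquiv
  | n + 1 => (multilinearCurryLeftEquiv k (fun _ : Fin (n + 1) => Words P deg Empty)
        (Words P deg Empty)).symm.toLinearMap ∘ₗ
      ((Words.plug P deg ∘ₗ Words.map P deg (finSuccEquiv n)).compr₂ (Words.act n))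

theorem Words.act_zero (x : Words P deg (Fin 0)) (a : Fin 0 → Words P deg Empty) :
    Words.act P deg 0 x a = Words.map P deg finZeroEquiv x := rfl

theorem Words.act_succ {n : ℕ} (x : Words P deg (Fin (n + 1)))
    (a : Fin (n + 1) → Words P deg Empty) :
    Words.act P deg (n + 1) x a = Words.act P deg n
      (Words.plug P deg (Words.map P deg (finSuccEquiv n) x) (a 0)) (Fin.tail a) := rfl

theorem Words.act_cast {m n : ℕ} (h : m = n) (x : Words P deg (Fin m))
    (a : Fin n → Words P deg Empty) :
    Words.act P deg n (Words.map P deg (finCongr h) x) a = Words.act P deg m x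
    (a ∘ finCongr h) := by
  subst h
  rw [Words.map_eq_self (fun _ => rfl)]
  rfl

theorem Words.act_mem {n : ℕ} {p : ℤ} {q : Fin n → ℤ} {x : Words P deg (Fin n)}
    {a : Fin n → Words P deg Empty} (hx : x ∈ Words.gr P deg (Fin n) p)
    (ha : ∀ i, a i ∈ Words.gr P deg Empty (q i)) :
    Words.act P deg n x a ∈ Words.gr P deg Empty (p + ∑ i, q i) := by
  induction n generalizing p with
  | zero =>
    rw [Words.act_zero, Fin.sum_univ_zero, add_zero]
    exact Words.map_mem _ hx
  | succ n ih =>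
    rw [Words.act_succ, Fin.sum_univ_succ, ← add_assoc]
    exact ih (Words.plug_mem (Words.map_mem _ hx) (ha 0)) fun i => ha i.succ

/-- Arguments are plugged in one after the other, starting with the first. An exchange of the first
two is therefore `plug_comm`, and a later exchange concerns only the arguments left after one
plugging, which is the induction hypothesis. -/
theorem Words.act_swap {n : ℕ} (i : Fin n) {q : Fin (n + 1) → ℤ} (x : Words P deg (Fin (n + 1)))
    {a : Fin (n + 1) → Words P deg Empty} (ha : ∀ i, a i ∈ Words.gr P deg Empty (q i)) :
    Words.act P deg (n + 1) (Words.map P deg (Equiv.swap i.castSucc i.succ) x) a =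
      koszulSign (Equiv.swap i.castSucc i.succ) q •
        Words.act P deg (n + 1) x (a ∘ Equiv.swap i.castSucc i.succ) := by
  induction n with
  | zero => exact i.elim0
  | succ n ih =>
    refine Fin.cases ?_ (fun i => ?_) i
    · have key : ∀ (x : Words P deg (Fin (n + 2))) (a : Fin (n + 2) → Words P deg Empty),
          Words.act P deg (n + 2) x a = Words.act P deg n (Words.plug P deg (Words.plug P deg
            (Words.map P deg ((finSuccEquiv (n + 1)).trans (Equiv.optionCongr (finSuccEquiv n))) x)
              (a 0)) (a 1)) (Fin.tail (Fin.tail a)) := by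
        intro x a
        rw [Words.act_succ, Words.act_succ, ← Words.plug_map, Words.map_map]
        rfl
      rw [Fin.castSucc_zero, Fin.succ_zero_eq_one, key, key, koszulSign_swap_zero_one,
        Function.comp_apply, Function.comp_apply, Equiv.swap_apply_left, Equiv.swap_apply_right,
        Words.plug_comm _ (ha 1) (ha 0), Words.map_map, Words.map_map]
      have h : ∀ i : Fin n, Equiv.swap (0 : Fin (n + 2)) 1 i.succ.succ = i.succ.succ := fun i =>
        Equiv.swap_apply_of_ne_of_ne (Fin.succ_ne_zero _) (by
          rw [← Fin.succ_zero_eq_one]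
          exact fun h => Fin.succ_ne_zero _ (Fin.succ_injective _ h))
      have ht : Fin.tail (Fin.tail (a ∘ Equiv.swap 0 1)) = Fin.tail (Fin.tail a) := by
        funext i
        simp only [Fin.tail, Function.comp_apply, h]
      -- The sign of the transposition and the sign from `plug_comm` have equal exponents and
      -- cancel.
      rw [ht, map_unitsSmul, smul_apply, smul_smul, ← Int.negOnePow_add,
        mul_comm (q 1), Int.negOnePow_even _ ⟨_, rfl⟩, one_smul]
      refine congrArg (fun X => Words.act P deg n (Words.plug P deg (Words.plug P deg X
        (a 0)) (a 1)) (Fin.tail (Fin.tail a))) (Words.map_congr (fun s => ?_) _)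
      refine Fin.cases ?_ (fun s => Fin.cases ?_ (fun s => ?_) s) s
      · simp
        rfl
      · simp
        rfl
      · simp only [Equiv.trans_apply, h]
        rfl
    · have h0 : Equiv.swap i.succ.castSucc i.succ.succ 0 = 0 :=
        Equiv.swap_apply_of_ne_of_ne (by simp [Fin.ext_iff]) (by simp [Fin.ext_iff])
      have hs : ∀ j : Fin (n + 1), Equiv.swap i.succ.castSucc i.succ.succ j.succ =
          (Equiv.swap i.castSucc i.succ j).succ := by
        intro j
        rw [← Fin.succ_castSucc]
        exact (Fin.succ_injective _).swap_apply _ _ _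
      rw [Words.act_succ (n := n + 1), Words.act_succ (n := n + 1), koszulSign_of_succ h0 hs,
        Words.map_map,
        Words.map_congr (e' := (finSuccEquiv (n + 1)).trans
          (Equiv.optionCongr (Equiv.swap i.castSucc i.succ))), ← Words.map_map, Words.plug_map,
        ih i (q := Fin.tail q) (a := Fin.tail a) _ (fun j => ha j.succ)]
      · rw [Function.comp_apply, h0]
        congr 2
        funext j
        simp only [Fin.tail, Function.comp_apply, hs]
      · intro j
        refine Fin.cases ?_ (fun j => ?_) j
        · rw [Equiv.trans_apply, Equiv.trans_apply, h0]
          rfl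
        · rw [Equiv.trans_apply, Equiv.trans_apply, hs, finSuccEquiv_succ, finSuccEquiv_succ]
          rfl

/-- Adjacent transpositions generate the symmetric group as a monoid, and both sides are
multiplicative in σ by `koszulSign_mul`. -/
theorem Words.act_map {n : ℕ} {q : Fin n → ℤ} (σ : Equiv.Perm (Fin n)) (x : Words P deg (Fin n))
    {a : Fin n → Words P deg Empty} (ha : ∀ i, a i ∈ Words.gr P deg Empty (q i)) :
    Words.act P deg n (Words.map P deg σ x) a = koszulSign σ q • Words.act P deg n x (a ∘ σ) := by
  have one : ∀ (n : ℕ) (q : Fin n → ℤ) (x : Words P deg (Fin n))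
      (a : Fin n → Words P deg Empty), Words.act P deg n
      (Words.map P deg (1 : Equiv.Perm (Fin n)) x) a =
        koszulSign 1 q • Words.act P deg n x (a ∘ (1 : Equiv.Perm (Fin n))) := by
    intro n q x a
    rw [Words.map_eq_self (fun _ => rfl), koszulSign_eq_inversionSign,
      inversionSign_self (Equiv.refl _) 1 _ (fun _ _ => Iff.rfl), one_smul]
    rfl
  cases n with
  | zero => rw [Subsingleton.elim σ 1]; exact one 0 q x a
  | succ n =>
    have hσ : σ ∈ Submonoid.closure (Set.range fun i : Fin n => Equiv.swap i.castSucc i.succ) := by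
      rw [Equiv.Perm.mclosure_swap_castSucc_succ]; trivial
    induction hσ using Submonoid.closure_induction generalizing x a q with
    | mem σ h =>
      obtain ⟨i, rfl⟩ := h
      exact Words.act_swap i x ha
    | one => exact one _ q x a
    | mul σ τ _ _ hσ hτ =>
      have : Words.map P deg (σ * τ) x = Words.map P deg σ (Words.map P deg τ x) := by
        rw [Words.map_map]
        rfl
      rw [this, hσ _ ha, hτ (q := q ∘ σ) (a := a ∘ σ) _ (fun i => ha (σ i)), smul_smul,
        koszulSign_mul]
      rfl

/-- Induction on the arity of y. By `plug_comp`, plugging the first argument into the composite is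
the same as plugging it into y, with no sign since y occupies the first input of x. Once y has arity
zero, the composite is itself a plugging. -/
theorem Words.act_comp {m n : ℕ} (x : Words P deg (Option (Fin m))) (y : Words P deg (Fin n))
    (a : Fin (n + m) → Words P deg Empty) :
    Words.act P deg (n + m) (Words.map P deg finSumFinEquiv (Words.comp P deg x y)) a =
      Words.act P deg m (Words.plug P deg x (Words.act P deg n y (a ∘ Fin.castAdd m)))
        (a ∘ Fin.natAdd n) := by
  induction n with
  | zero =>
    have h : y = Words.map P deg finZeroEquiv.symm (Words.map P deg finZeroEquiv y) := by
      rw [Words.map_map, Words.map_eq_self (by simp)]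
    rw [Words.act_zero, h, Words.comp_map_right, Words.map_map, ← h, Words.plug_apply,
      ← Words.map_congr (e := (Equiv.emptySum Empty (Fin m)).trans
        (finCongr (Nat.zero_add m).symm)), ← Words.map_map, Words.act_cast]
    · congr 1
      funext i
      simp only [Function.comp_apply]
      congr 1
      ext
      simp
    · rintro (i | i)
      · contradiction
      · ext
        simp
  | succ n ih =>
    have h : n + 1 + m = n + m + 1 := by omega
    have hx : Words.map P deg finSumFinEquiv (Words.comp P deg x y) =
        Words.map P deg (finCongr h.symm) (Words.map P deg (finSumFinEquiv.trans (finCongr h))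
          (Words.comp P deg x y)) := by
      rw [Words.map_map]
      exact Words.map_congr (fun s => by ext; simp) _
    rw [hx, Words.act_cast, Words.act_succ, Words.act_succ, Words.map_map,
      Words.map_congr (e' := ((Equiv.sumCongr (finSuccEquiv n) (Equiv.refl (Fin m))).trans
        (optionSumLeft (Fin n) (Fin m))).trans (Equiv.optionCongr finSumFinEquiv)),
      ← Words.map_map, Words.plug_map, ← Words.map_map, ← Words.comp_map_right,
      Words.plug_comp, ih]
    · have e1 : Fin.tail (a ∘ finCongr h.symm) ∘ Fin.natAdd n = a ∘ Fin.natAdd (n + 1) := by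
        funext i
        simp only [Function.comp_apply, Fin.tail]
        congr 1
        ext
        simp
        omega
      have e2 : Fin.tail (a ∘ finCongr h.symm) ∘ Fin.castAdd m =
          Fin.tail (a ∘ Fin.castAdd m) := by
        funext i
        rfl
      rw [e1, e2]
      rfl
    · intro s
      rcases s with s | s
      · refine Fin.cases ?_ (fun s => ?_) s
        · have : (finSumFinEquiv.trans (finCongr h)) (.inl (0 : Fin (n + 1))) =
            (0 : Fin (n + m + 1)) := by ext; simp
          rw [Equiv.trans_apply, this]
          rfl
        · have : (finSumFinEquiv.trans (finCongr h)) (.inl s.succ) =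
            (Fin.castAdd m s).succ := by ext; simp
          rw [Equiv.trans_apply, this, finSuccEquiv_succ]
          simp [optionSumLeft]
      · have : (finSumFinEquiv.trans (finCongr h)) (.inr s) =
            (Fin.natAdd n s).succ := by ext; simp; omega
        rw [Equiv.trans_apply, this, finSuccEquiv_succ]
        simp [optionSumLeft]

end words

section multilinear
variable {k : Type u} [CommRing k]

/-- Currying reduces the claim to linear maps, which are determined on homogeneous elements. It
allows signs to be checked on homogeneous arguments while the conclusions hold for all arguments. -/
theorem GMod.multilinear_ext {M : GMod k} {N : Type*} [AddCommGroup N] [Module k N] {n : ℕ}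
    {f g : MultilinearMap k (fun _ : Fin n => M.carrier) N}
    (h : ∀ (q : Fin n → ℤ) (a : Fin n → M), (∀ i, a i ∈ M.gr (q i)) → f a = g a) : f = g := by
  induction n with
  | zero => ext a; exact h Fin.elim0 a fun i => i.elim0
  | succ n ih =>
    have key : f.curryLeft = g.curryLeft := GMod.ext_gr (M := M) fun p x hx => ih fun q a ha => by
      rw [MultilinearMap.curryLeft_apply, MultilinearMap.curryLeft_apply]
      exact h (Fin.cons p q) _ fun i => Fin.cases hx ha i
    ext a
    have := congrArg (fun F => F (a 0) (Fin.tail a)) key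
    simpa using this

end multilinear

/-! ### Algebras with arguments indexed by finite sets -/

section actOf
variable {k : Type u} [CommRing k] {P : Operad k}

/-- The algebra structure for operations with arbitrary sets of inputs, the arguments being
enumerated by `e`. -/
def Operad.Alg.actOf (C : P.Alg) {T : Type} [Finite T] {n : ℕ} (e : T ≃ Fin n) (μ : P.obj T)
    (a : T → C) : C := C.act n (P.map e μ) (a ∘ e.symm)

/-- The enumeration of `S ⊔ {*}` which starts with `*`. -/
def optionEnum {S : Type} {n : ℕ} (e : S ≃ Fin n) : Option S ≃ Fin (n + 1) :=
  (Equiv.optionCongr e).trans (finSuccEquiv n).symm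

@[simp] theorem optionEnum_none {S : Type} {n : ℕ} (e : S ≃ Fin n) : optionEnum e none = 0 := rfl
@[simp] theorem optionEnum_some {S : Type} {n : ℕ} (e : S ≃ Fin n) (s : S) :
    optionEnum e (some s) = (e s).succ := rfl

variable (C : P.Alg) {S T U : Type} [Finite S] [Finite T] [Finite U]

theorem Operad.Alg.actOf_refl {n : ℕ} (μ : P.obj (Fin n)) (a : Fin n → C) :
    C.actOf (Equiv.refl _) μ a = C.act n μ a := by
  rw [actOf, P.map_refl]
  rfl

theorem Operad.Alg.actOf_map {n : ℕ} (f : T ≃ U) (e : U ≃ Fin n) (μ : P.obj T) (a : U → C) :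
    C.actOf e (P.map f μ) a = C.actOf (f.trans e) μ (a ∘ f) := by
  rw [actOf, actOf, P.map_map]
  congr 1
  funext i
  simp

theorem Operad.Alg.actOf_eq {T : Type} [Fintype T] {m n : ℕ} (e : T ≃ Fin m) (e' : T ≃ Fin n)
    {q : T → ℤ} (μ : P.obj T) {a : T → C} (ha : ∀ t, a t ∈ C.gr (q t)) :
    C.actOf e μ a = inversionSign e e' q • C.actOf e' μ a := by
  obtain rfl : m = n := by simpa using Fintype.card_congr (e.symm.trans e')
  have h := C.act_map (q := q ∘ e.symm) (e'.symm.trans e) (P.map e' μ) (a := a ∘ e.symm)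
    fun i => ha _
  rw [P.map_map] at h
  have h1 : (a ∘ e.symm) ∘ (e'.symm.trans e) = a ∘ e'.symm := by funext i; simp
  have h2 : koszulSign (e'.symm.trans e) (q ∘ e.symm) = inversionSign e e' q := by
    rw [koszulSign_eq_inversionSign, ← inversionSign_comp e', inversionSign_symm]
    congr 1
    · ext i; simp
    · funext i; simp
  rw [h1, h2] at h
  rw [actOf, actOf, ← h]
  congr 1
  rw [P.map_congr]
  simp

theorem Operad.Alg.actOf_comp {m n : ℕ} (e : T ≃ Fin n) (e' : S ≃ Fin m) (μ : P.obj (Option S))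
    (ν : P.obj T) (a : T → C) (b : S → C) :
    C.actOf (sumEnum e e') (P.comp μ ν) (Sum.elim a b) =
      C.actOf (optionEnum e') μ (fun o => o.elim (C.actOf e ν a) b) := by
  have h := C.act_comp (P.map (Equiv.optionCongr e') μ) (P.map e ν)
    (Sum.elim a b ∘ (sumEnum e e').symm)
  rw [P.comp_map, P.map_map, P.map_map] at h
  rw [actOf, actOf]
  refine h.trans ?_
  congr 1
  have h1 : (Sum.elim a b ∘ (sumEnum e e').symm) ∘ Fin.castAdd m = a ∘ e.symm := by
    funext i
    simp [sumEnum]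
  have h2 : (Sum.elim a b ∘ (sumEnum e e').symm) ∘ Fin.natAdd n = b ∘ e'.symm := by
    funext i
    simp [sumEnum]
  rw [h1, h2]
  funext i
  refine Fin.cases ?_ (fun i => ?_) i
  · rfl
  · simp [optionEnum]
    rfl

end actOf

/-! ### Closed operations, letters and the free graded algebra -/

section words
variable {k : Type u} [CommRing k] {P : Operad k} {β : Type u} {deg : β → ℤ}
variable {S T U : Type} [Finite S] [Finite T] [Finite U]

variable (P deg) in
/-- The operations of `P`, as operations without letters. -/
def Words.closed : P.obj S →ₗ[k] Words P deg S :=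
  word P deg Fin.elim0 ∘ₗ P.map (Equiv.emptySum (Fin 0) S).symm

theorem Words.closed_eq_wordOf {A : Type} [Finite A] [IsEmpty A] (e : A ≃ Fin 0) (l : A → β)
    (μ : P.obj S) :
    Words.closed P deg μ = wordOf P deg e l (P.map (Equiv.emptySum A S).symm μ) := by
  rw [Words.closed, wordOf, LinearMap.comp_apply, LinearMap.comp_apply, P.map_map,
    Subsingleton.elim (l ∘ e.symm) Fin.elim0]
  exact congrArg _ (P.map_congr (by intro _; rfl) _)

theorem Words.closed_map (e : S ≃ T) (μ : P.obj S) :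
    Words.closed P deg (P.map e μ) = Words.map P deg e (Words.closed P deg μ) := by
  rw [Words.closed, Words.closed, LinearMap.comp_apply, LinearMap.comp_apply, Words.map_word,
    P.map_map, P.map_map]
  exact congrArg _ (P.map_congr (by intro _; rfl) _)

theorem Words.closed_mem {p : ℤ} {μ : P.obj S} (hμ : μ ∈ (P.obj S).gr p) :
    Words.closed P deg μ ∈ Words.gr P deg S p := by
  have := Words.word_mem_gr (deg := deg) Fin.elim0
    (P.map_mem (Equiv.emptySum (Fin 0) S).symm hμ)
  rwa [wordDegree, Fin.sum_univ_zero, add_zero] at this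

theorem Words.closed_comp (μ : P.obj (Option S)) (ν : P.obj T) :
    Words.closed P deg (P.comp μ ν) =
      Words.comp P deg (Words.closed P deg μ) (Words.closed P deg ν) := by
  induction ν using (P.obj T).toGMod.induction_gr with
  | zero => simp
  | add x y hx hy => simp only [map_add, hx, hy]
  | hom q ν hν =>
    rw [Words.closed_eq_wordOf (sumEnum (Equiv.refl (Fin 0)) (Equiv.refl (Fin 0)))
      (Sum.elim Fin.elim0 Fin.elim0), Words.closed, Words.closed, LinearMap.comp_apply,
      LinearMap.comp_apply, Words.comp_word _ _ _ (P.map_mem _ hν), P.wcomp_apply, P.map_map,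
      P.map_congr (e' := Equiv.optionCongr (Equiv.emptySum (Fin 0) S).symm), P.comp_map,
      P.map_map]
    · rw [wordDegree, Fin.sum_univ_zero, zero_mul, Int.negOnePow_zero, one_smul]
      congr 1
      exact P.map_congr (by rintro (_ | _) <;> rfl) _
    · rintro (_ | _) <;> rfl

variable (P deg) in
/-- The letters. -/
def Words.letter (b : β) : Words P deg Empty :=
  wordOf P deg (Equiv.ofUnique Unit (Fin 1)) (fun _ => b) (P.map (Equiv.sumEmpty Unit Empty).symm
    P.one)

theorem Words.letter_mem (b : β) : Words.letter P deg b ∈ Words.gr P deg Empty (deg b) := by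
  have := Words.wordOf_mem_gr (deg := deg) (Equiv.ofUnique Unit (Fin 1)) (fun _ => b)
    (P.map_mem (Equiv.sumEmpty Unit Empty).symm P.one_mem)
  rw [zero_add, wordDegree, Fintype.sum_unique] at this
  exact this

/-- The left unit axiom of P; the closed identity operation carries no letters, so no sign and no
reordering occur. -/
theorem Words.plug_closed_one (a : Words P deg Empty) :
    Words.plug P deg (Words.closed P deg (P.map unitEquivOptionEmpty P.one)) a = a := by
  induction a using Words.induction with
  | zero => simp
  | add x y hx hy => simp only [map_add, hx, hy]
  | word n l q μ hμ =>
    have h1 : P.wcomp (P.map (Equiv.emptySum (Fin 0) (Option Empty)).symm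
        (P.map unitEquivOptionEmpty P.one)) μ =
          P.map (Equiv.sumCongr (Equiv.sumEmpty (Fin n) (Fin 0)).symm
            (Equiv.emptySum Empty Empty).symm) μ := by
      rw [P.wcomp_apply, P.map_map, P.map_map, P.map_congr (e' := (unitEquivOptionEmpty).trans
        (Equiv.optionCongr (Equiv.emptySum (Fin 0) Empty).symm)) (by rintro ⟨⟩; rfl),
        ← P.map_map, P.comp_map_left, P.one_comp, P.map_map, P.map_map]
      exact P.map_congr (by rintro (_ | _) <;> first | contradiction | rfl) _
    rw [Words.closed, LinearMap.comp_apply, Words.plug_apply, Words.comp_word _ _ _ hμ, h1,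
      wordDegree, Fin.sum_univ_zero, zero_mul, Int.negOnePow_zero, one_smul, wordOf_sumCongr,
      Words.map_map, Words.map_eq_self (fun _ => rfl), ← wordOf_refl P deg l,
      wordOf_eq_of_lt P deg _ (Equiv.refl (Fin n))]
    · rfl
    · intro i j
      exact sumEnum_inl_lt_inl (Equiv.refl (Fin n)) (Equiv.refl (Fin 0)) i j

/-- On words in the letters `l`, the projection to degree p is the projection of the operation to
degree p − |l|. It respects the relations because permuting letters preserves |l| and relabelling
preserves the degree of the operation. -/
theorem Words.isInternal_gr : DirectSum.IsInternal (Words.gr P deg S) := by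
  let pr : ℤ → Words P deg S →ₗ[k] Words P deg S := fun p =>
    Words.lift P deg (fun n l =>
      word P deg l ∘ₗ (P.obj (Fin n ⊕ S)).toGMod.proj (p - wordDegree deg l)) (by
      intro n l μ σ
      rw [LinearMap.comp_apply, LinearMap.comp_apply, wordDegree_comp_equiv, ← word_map,
        GMod.map_proj_zero (M := (P.obj (Fin n ⊕ S)).toGMod) (N := (P.obj (Fin n ⊕ S)).toGMod)
          (P.map (Equiv.sumCongr σ (Equiv.refl S))) (fun hx => P.map_mem _ hx)])
  refine GMod.isInternal_of_proj _ pr ?_ ?_ ?_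
  · intro p x hx
    refine Words.gr_induction (p := fun x => pr p x = x) ?_ (map_zero _)
      (fun x y hx hy => by rw [map_add, hx, hy]) hx
    intro n l q μ hμ h
    rw [Words.lift_word, LinearMap.comp_apply, GMod.proj_of_mem]
    rwa [← h, add_sub_cancel_right]
  · intro p p' hp x hx
    refine Words.gr_induction (p := fun x => pr p' x = 0) ?_ (map_zero _)
      (fun x y hx hy => by rw [map_add, hx, hy, add_zero]) hx
    intro n l q μ hμ h
    rw [Words.lift_word, LinearMap.comp_apply, GMod.proj_of_mem_of_ne _ _ hμ, map_zero]
    omega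
  · rw [eq_top_iff]
    rintro x -
    induction x using Words.induction with
    | zero => exact zero_mem _
    | add x y hx hy => exact add_mem hx hy
    | word n l q μ hμ => exact Submodule.mem_iSup_of_mem _ (Words.word_mem_gr l hμ)

variable (P deg) in
/-- The free graded algebra on a graded set of letters. -/
def Words.alg : P.forget.Alg where
  carrier := Words P deg Empty
  gr := Words.gr P deg Empty
  internal := Words.isInternal_gr
  d := 0
  d_mem := fun _ => Submodule.zero_mem _
  d_d := fun _ => rfl
  act n := Words.act P deg n ∘ₗ Words.closed P deg
  act_mem hμ ha := Words.act_mem (Words.closed_mem hμ) ha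
  d_act {n p q μ a} _ _ := by
    have : ∀ i, Words.act P deg n (Words.closed P deg μ) (Function.update a i 0) = 0 := fun i =>
      MultilinearMap.map_coord_zero _ i (by simp)
    simp [this]
  act_map σ μ a ha := by
    rw [LinearMap.comp_apply, LinearMap.comp_apply, ← Words.act_map σ _ ha, ← Words.closed_map]
  act_one a := by
    rw [LinearMap.comp_apply, Words.act_succ, Words.act_zero, Words.closed_map, Words.map_map,
      Words.map_congr (e' := unitEquivOptionEmpty.trans
        (Equiv.optionCongr finZeroEquiv.symm)) (by rintro ⟨⟩; rfl), ← Words.map_map,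
      Words.plug_map, Words.map_map, Words.map_eq_self (by simp), ← Words.closed_map,
      Words.plug_closed_one]
  act_comp μ ν a := by
    rw [LinearMap.comp_apply, LinearMap.comp_apply, LinearMap.comp_apply, Words.closed_map,
      Words.closed_comp, Words.act_comp, Words.closed_map, Words.act_succ, Words.map_map,
      Words.map_eq_self (by simp)]
    rfl

/-- The operation `μ` applied to the letters `l`. -/
abbrev Words.monomial {n : ℕ} (l : Fin n → β) (μ : P.obj (Fin n)) : Words P deg Empty :=
  word P deg l (P.map (Equiv.sumEmpty (Fin n) Empty).symm μ)

/-- The composition puts the new letter in front of `l`, with the sign for exchanging the two.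
Moving it behind `l` produces the same sign again, so plugging at the end is free of signs. -/
theorem Words.plug_letter {A : Type} [Fintype A] {n : ℕ} (e : A ≃ Fin n) (l : A → β)
    (x : P.obj (A ⊕ Option S)) (b : β) :
    Words.plug P deg (wordOf P deg e l x) (Words.letter P deg b) =
      wordOf P deg (sumEnum e (Equiv.ofUnique Unit (Fin 1))) (Sum.elim l fun _ => b)
        (P.map ((Equiv.sumCongr (Equiv.refl A) (optionEquivUnitSum S)).trans
          (Equiv.sumAssoc A Unit S).symm) x) := by
  have h1 : P.wcomp x (P.map (Equiv.sumEmpty Unit Empty).symm P.one) =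
      P.map (((Equiv.sumCongr (Equiv.refl A) (optionEquivUnitSum S)).trans
          (Equiv.sumAssoc A Unit S).symm).trans (Equiv.sumCongr (Equiv.sumComm A Unit)
            (Equiv.emptySum Empty S).symm)) x := by
    rw [P.wcomp_apply, P.comp_map_right, P.comp_one, P.map_map, P.map_map, P.map_map]
    exact P.map_congr (by rintro (_ | (_ | _)) <;> rfl) _
  rw [Words.letter, Words.plug_apply,
    Words.comp_wordOf _ _ _ _ _ (P.map_mem _ P.one_mem), h1, ← P.map_map, wordOf_sumCongr,
    map_unitsSmul, Words.map_map, Words.map_eq_self (by simp),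
    wordOf_eq P deg _ (sumEnum e (Equiv.ofUnique Unit (Fin 1))), inversionSign_symm,
    inversionSign_sumEnum_swap, smul_smul, ← Int.negOnePow_add]
  have hl : Sum.elim (fun _ => b) l ∘ Equiv.sumComm A Unit = Sum.elim l fun _ => b := by
    funext i
    rcases i with _ | _ <;> rfl
  rw [hl, Int.negOnePow_even, one_smul]
  refine ⟨wordDegree deg l * deg b, ?_⟩
  simp [wordDegree]

theorem Words.act_letter {A : Type} [Fintype A] {m n : ℕ} (e : A ≃ Fin n) (l : A → β)
    (x : P.obj (A ⊕ Fin m)) (v : Fin m → β) :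
    Words.act P deg m (wordOf P deg e l x) (fun i => Words.letter P deg (v i)) =
      wordOf P deg (sumEnum e (Equiv.refl _)) (Sum.elim l v)
        (P.map (Equiv.sumEmpty _ Empty).symm x) := by
  induction m generalizing A n with
  | zero =>
    rw [Words.act_zero, Words.map_wordOf, P.map_congr (e := (Equiv.sumEmpty _ Empty).symm)
      (e' := (Equiv.sumCongr (Equiv.refl A) finZeroEquiv).trans (Equiv.sumCongr
        (Equiv.sumEmpty A (Fin 0)).symm (Equiv.refl Empty))), ← P.map_map, wordOf_map,
      wordOf_eq_of_lt P deg e]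
    · rfl
    · intro i j
      exact (sumEnum_inl_lt_inl e (Equiv.refl (Fin 0)) i j).symm
    · rintro (_ | i)
      · rfl
      · exact i.elim0
  | succ m ih =>
    rw [Words.act_succ, Words.map_wordOf, Words.plug_letter, P.map_map]
    refine (ih _ _ _ _).trans ?_
    have h : ∀ i : Fin m, (finSuccEquiv m).symm (some i) = i.succ := fun _ => rfl
    rw [P.map_map, P.map_congr (e' := (Equiv.sumEmpty _ Empty).symm.trans (Equiv.sumCongr
        ((Equiv.sumCongr (Equiv.refl A) ((finSuccEquiv m).trans (optionEquivUnitSum _))).trans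
          (Equiv.sumAssoc A Unit (Fin m)).symm) (Equiv.refl Empty))), ← P.map_map, wordOf_map,
      wordOf_eq_of_lt P deg _ (sumEnum e (Equiv.refl _))]
    · congr 2
      funext i
      rcases i with _ | i
      · rfl
      · refine Fin.cases ?_ (fun i => ?_) i
        · rfl
        · simp [optionEquivUnitSum]
    · rintro (i | i) (j | j)
      · simp
      · refine Fin.cases ?_ (fun j => ?_) j
        · simp [optionEquivUnitSum]
        · simp [optionEquivUnitSum]
      · refine Fin.cases ?_ (fun i => ?_) i
        · simp [optionEquivUnitSum]
        · simp [optionEquivUnitSum]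
      · refine Fin.cases ?_ (fun i => ?_) i <;> refine Fin.cases ?_ (fun j => ?_) j <;>
          simp [optionEquivUnitSum]
    · rintro (_ | i)
      · rfl
      · refine Fin.cases ?_ (fun i => ?_) i
        · rfl
        · simp [optionEquivUnitSum]

/-- This shows that the letters generate, and fixes the normalization: no sign relates the action on
letters to the corresponding word. -/
theorem Words.alg_act_letter {n : ℕ} (l : Fin n → β) (μ : P.obj (Fin n)) :
    (Words.alg P deg).act n μ (fun i => Words.letter P deg (l i)) = Words.monomial l μ := by
  change Words.act P deg n (Words.closed P deg μ) _ = _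
  rw [Words.closed_eq_wordOf (Equiv.refl _) Fin.elim0, Words.act_letter, P.map_map,
    P.map_congr (e := (Equiv.emptySum (Fin 0) (Fin n)).symm.trans (Equiv.sumEmpty _ Empty).symm)
      (e' := (Equiv.sumEmpty (Fin n) Empty).symm.trans
      (Equiv.sumCongr (Equiv.emptySum (Fin 0) (Fin n)).symm (Equiv.refl Empty)))
      (fun _ => rfl), ← P.map_map, wordOf_map, wordOf_eq_of_lt P deg _ (Equiv.refl (Fin n)),
    wordOf_refl]
  · rfl
  · intro i j
    simp

end words

/-- The marked input moves from just behind A to the front, thus past every element of A and nothing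
else. -/
theorem inversionSign_optionEnum {A S : Type} [Fintype A] [Fintype S] {m n : ℕ}
    (e : A ≃ Fin n) (s : S ≃ Fin m) (q : Option (A ⊕ S) → ℤ) :
    inversionSign ((optionSumRight A S).symm.trans (sumEnum e (optionEnum s)))
      (optionEnum (sumEnum e s)) q = ((∑ a, q (some (.inl a))) * q none).negOnePow := by
  have l1 : (optionSumRight A S).symm none = .inr none := rfl
  have l2 : ∀ a, (optionSumRight A S).symm (some (.inl a)) = .inl a := fun _ => rfl
  have l3 : ∀ a, (optionSumRight A S).symm (some (.inr a)) = .inr (some a) := fun _ => rfl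
  have h2 : ∀ i j, ¬ (e i < e j ∧ e j < e i) := fun i j h => lt_asymm h.1 h.2
  have h3 : ∀ i j, ¬ (s i < s j ∧ s j < s i) := fun i j h => lt_asymm h.1 h.2
  rw [inversionSign, Finset.sum_mul]
  congr 1
  simp only [Fintype.sum_option, Fintype.sum_sum_type, Equiv.trans_apply, l1, l2, l3,
    optionEnum_none, optionEnum_some, sumEnum_inl_lt_inl,
    sumEnum_inl_lt_inr, sumEnum_inr_lt_inl, sumEnum_inr_lt_inr, Fin.succ_lt_succ_iff, h2, h3]
  simp

section actOf
variable {k : Type u} [CommRing k] {P : Operad k}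

theorem Operad.Alg.actOf_mem (C : P.Alg) {T : Type} [Fintype T] {n : ℕ} (e : T ≃ Fin n) {p : ℤ}
    {q : T → ℤ} {μ : P.obj T} {a : T → C} (hμ : μ ∈ (P.obj T).gr p)
    (ha : ∀ t, a t ∈ C.gr (q t)) : C.actOf e μ a ∈ C.gr (p + ∑ t, q t) := by
  rw [← e.symm.sum_comp]
  exact C.act_mem (P.map_mem e hμ) fun i => ha _

/-- The algebra axiom `act_comp` composes only into the first input. The inner value z must
therefore move in front of the arguments `a`, which gives the sign with exponent |a||z|; this is the
sign built into the composition of words. -/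
theorem Operad.Alg.actOf_wcomp (C : P.Alg) {A B S : Type} [Fintype A] [Fintype B] [Fintype S]
    {m n r : ℕ} (e : A ≃ Fin n) (e' : B ≃ Fin r) (s : S ≃ Fin m) (x : P.obj (A ⊕ Option S))
    {p : ℤ} {y : P.obj (B ⊕ Empty)} (hy : y ∈ (P.obj _).gr p) {qa : A → ℤ} {qb : B → ℤ}
    {qc : S → ℤ} {a : A → C} {b : B → C} {c : S → C} (ha : ∀ i, a i ∈ C.gr (qa i))
    (hb : ∀ i, b i ∈ C.gr (qb i)) (hc : ∀ i, c i ∈ C.gr (qc i)) :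
    C.actOf (sumEnum e (optionEnum s)) x
        (Sum.elim a fun o => o.elim (C.actOf e' (P.map (Equiv.sumEmpty B Empty) y) b) c) =
      ((∑ i, qa i) * (p + ∑ i, qb i)).negOnePow • C.actOf (sumEnum (sumEnum e' e) s)
        (P.map (Equiv.sumCongr (Equiv.refl _) (Equiv.emptySum Empty S)) (P.wcomp x y))
        (Sum.elim (Sum.elim b a) c) := by
  set z := C.actOf e' (P.map (Equiv.sumEmpty B Empty) y) b with hz
  have hz' : z ∈ C.gr (p + ∑ i, qb i) := C.actOf_mem e' (P.map_mem _ hy) hb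
  have h1 := C.actOf_map (optionSumRight A S)
    ((optionSumRight A S).symm.trans (sumEnum e (optionEnum s))) x
    (fun o => o.elim z (Sum.elim a c))
  have e1 : (optionSumRight A S).trans
      ((optionSumRight A S).symm.trans (sumEnum e (optionEnum s))) =
        sumEnum e (optionEnum s) := by
    rw [← Equiv.trans_assoc, Equiv.self_trans_symm, Equiv.refl_trans]
  have e2 : (fun o : Option (A ⊕ S) => o.elim z (Sum.elim a c)) ∘ optionSumRight A S =
      Sum.elim a fun o => o.elim z c := by
    funext i
    rcases i with _ | _ | _ <;> rfl
  rw [e1, e2] at h1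
  rw [← h1, C.actOf_eq _ (optionEnum (sumEnum e s))
    (q := fun o => o.elim (p + ∑ i, qb i) (Sum.elim qa qc)), inversionSign_optionEnum,
    hz, ← C.actOf_comp]
  · have h2 : P.map (Equiv.sumCongr (Equiv.refl _) (Equiv.emptySum Empty S)) (P.wcomp x y) =
        P.map (Equiv.sumAssoc B A S).symm (P.comp (P.map (optionSumRight A S) x)
          (P.map (Equiv.sumEmpty B Empty) y)) := by
      rw [P.comp_map_right, P.wcomp_apply, P.map_map, P.map_map]
      exact P.map_congr (by rintro ((_ | _) | (_ | _)) <;> first | contradiction | rfl) _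
    rw [h2, C.actOf_map, C.actOf_eq ((Equiv.sumAssoc B A S).symm.trans _)
      (sumEnum e' (sumEnum e s)) (q := Sum.elim qb (Sum.elim qa qc)), inversionSign_self,
      one_smul]
    · congr 2
      funext i
      rcases i with _ | _ | _ <;> rfl
    · rintro (_ | _ | _) (_ | _ | _) <;> simp
    · rintro (i | i | i)
      · exact hb i
      · exact ha i
      · exact hc i
  · rintro (_ | i | i)
    · exact hz'
    · exact ha i
    · exact hc i

theorem Operad.Alg.actOf_congr (C : P.Alg) {T : Type} [Finite T] {n : ℕ} (e : T ≃ Fin n)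
    {μ ν : P.obj T} (h : μ = ν) {a b : T → C} (h' : ∀ t, a t = b t) :
    C.actOf e μ a = C.actOf e ν b := by
  rw [h, funext h']

end actOf

/-! ### Universal property of the free graded algebra -/

section lift
variable {k : Type u} [CommRing k] {P : Operad k} {β : Type u} {deg : β → ℤ}

/-- The morphism of graded algebras on the free algebra which extends a map of the letters. -/
def Words.toAlg (C : P.forget.Alg) (κ : β → C) (hκ : ∀ b, κ b ∈ C.gr (deg b)) :
    Words P deg Empty →ₗ[k] C :=
  Words.lift P deg (fun n l =>
    { toFun := fun μ => C.act n (P.map (Equiv.sumEmpty (Fin n) Empty) μ) (κ ∘ l)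
      map_add' := fun x y => by rw [map_add, map_add, add_apply]
      map_smul' := fun r x => by rw [map_smul, map_smul, smul_apply, RingHom.id_apply] })
    (by
      intro n l μ σ
      have h := C.act_map σ (P.map (Equiv.sumEmpty (Fin n) Empty) μ) (a := κ ∘ l)
        fun i => hκ (l i)
      rw [P.map_map] at h
      change C.act n (P.map _ (P.map _ μ)) (κ ∘ l) = koszulSign σ (deg ∘ l) •
        C.act n (P.map (Equiv.sumEmpty (Fin n) Empty) μ) ((κ ∘ l) ∘ σ)
      rw [P.map_map, ← P.map_congr (e := (Equiv.sumEmpty (Fin n) Empty).trans σ)]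
      · exact h
      · rintro (_ | _) <;> first | contradiction | rfl)

variable (C : P.forget.Alg) (κ : β → C) (hκ : ∀ b, κ b ∈ C.gr (deg b))

theorem Words.toAlg_word {n : ℕ} (l : Fin n → β) (μ : P.obj (Fin n ⊕ Empty)) :
    Words.toAlg C κ hκ (word P deg l μ) =
      C.act n (P.map (Equiv.sumEmpty (Fin n) Empty) μ) (κ ∘ l) :=
  Words.lift_word P deg _ _ l μ

theorem Words.toAlg_wordOf {T : Type} [Finite T] {n : ℕ} (e : T ≃ Fin n) (l : T → β)
    (μ : P.obj (T ⊕ Empty)) :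
    Words.toAlg C κ hκ (wordOf P deg e l μ) =
      C.actOf e (P.map (Equiv.sumEmpty T Empty) μ) (κ ∘ l) := by
  rw [wordOf, LinearMap.comp_apply, Words.toAlg_word, P.map_map, Operad.Alg.actOf]
  change _ = C.act n (P.map e (P.map _ μ)) _
  rw [P.map_map, P.map_congr (e' := (Equiv.sumEmpty T Empty).trans e)]
  · rfl
  · rintro (_ | _) <;> first | contradiction | rfl

theorem Words.toAlg_monomial {n : ℕ} (l : Fin n → β) (μ : P.obj (Fin n)) :
    Words.toAlg C κ hκ (Words.monomial l μ) = C.act n μ (κ ∘ l) := by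
  rw [Words.toAlg_word, P.map_map, P.map_eq_self (by simp)]

theorem Words.toAlg_letter (b : β) : Words.toAlg C κ hκ (Words.letter P deg b) = κ b := by
  rw [Words.letter, Words.toAlg_wordOf, P.map_map, P.map_eq_self (by simp)]
  exact C.act_one _

theorem Words.toAlg_mem {p : ℤ} {x : Words P deg Empty} (hx : x ∈ Words.gr P deg Empty p) :
    Words.toAlg C κ hκ x ∈ C.gr p := by
  refine Words.gr_induction (p := fun x => Words.toAlg C κ hκ x ∈ C.gr p) ?_ (by simp)
    (fun x y hx hy => by rw [map_add]; exact add_mem hx hy) hx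
  intro n l q μ hμ h
  rw [Words.toAlg_word, ← h]
  exact C.act_mem (P.map_mem _ hμ) fun i => hκ (l i)

/-- The core of the universal property. Induction on the number of open inputs: plugging a word into
the first one enlarges the set of letters, hence the quantification over A inside the statement, and
`actOf_wcomp` evaluates the result in C with the matching sign. -/
theorem Words.toAlg_act_wordOf {m : ℕ} : ∀ {A : Type} [Fintype A] {n : ℕ} (e : A ≃ Fin n)
    (l : A → β) (x : P.obj (A ⊕ Fin m)) {q : Fin m → ℤ} {a : Fin m → Words P deg Empty}
    (_ : ∀ i, a i ∈ Words.gr P deg Empty (q i)),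
    Words.toAlg C κ hκ (Words.act P deg m (wordOf P deg e l x) a) =
      C.actOf (sumEnum e (Equiv.refl (Fin m))) x (Sum.elim (κ ∘ l) (Words.toAlg C κ hκ ∘ a)) := by
  induction m with
  | zero =>
    intro A _ n e l x q a ha
    rw [Words.act_zero, Words.map_wordOf, Words.toAlg_wordOf, P.map_map]
    refine (Operad.Alg.actOf_map C _ _ _ _).trans ?_
    rw [C.actOf_eq _ (sumEnum e (Equiv.refl (Fin 0))) (q := Sum.elim (deg ∘ l) Fin.elim0) x,
      inversionSign_self, one_smul]
    · congr 1
      funext i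
      rcases i with _ | i
      · rfl
      · exact i.elim0
    · rintro (i | i) (j | j)
      · exact (sumEnum_inl_lt_inl e (Equiv.refl (Fin 0)) i j).symm
      all_goals first | exact i.elim0 | exact j.elim0
    · rintro (i | i)
      · exact hκ _
      · exact i.elim0
  | succ m ih =>
    intro A _ n e l x q a ha
    rw [Words.act_succ, Words.map_wordOf]
    have h₀ := ha 0
    have ht : ∀ i, Fin.tail a i ∈ Words.gr P deg Empty (Fin.tail q i) := fun i => ha i.succ
    have hsplit : Words.toAlg C κ hκ ∘ a =
        Fin.cons (Words.toAlg C κ hκ (a 0)) (Words.toAlg C κ hκ ∘ Fin.tail a) := by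
      funext i
      refine Fin.cases ?_ (fun i => ?_) i <;> rfl
    rw [hsplit]
    have hc : ∀ i, (Words.toAlg C κ hκ ∘ Fin.tail a) i ∈ C.gr (Fin.tail q i) := fun i =>
      Words.toAlg_mem C κ hκ (ht i)
    generalize a 0 = a₀ at h₀
    refine Words.gr_induction (p := fun a₀ => Words.toAlg C κ hκ (Words.act P deg m
      (Words.plug P deg (wordOf P deg e l (P.map (Equiv.sumCongr (Equiv.refl A) (finSuccEquiv m))
        x)) a₀) (Fin.tail a)) = C.actOf (sumEnum e (Equiv.refl (Fin (m + 1)))) x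
          (Sum.elim (κ ∘ l) (Fin.cons (Words.toAlg C κ hκ a₀)
            (Words.toAlg C κ hκ ∘ Fin.tail a)))) ?_ ?_ ?_ h₀
    · intro r v p y hy hp
      rw [← wordOf_refl P deg v, Words.plug_apply, Words.comp_wordOf _ _ _ _ _ hy, map_unitsSmul,
        Words.map_wordOf, map_unitsSmul, smul_apply, map_unitsSmul, ih _ _ _ ht,
        Words.toAlg_wordOf]
      generalize Words.toAlg C κ hκ ∘ Fin.tail a = c at hc
      have h := C.actOf_wcomp e (Equiv.refl (Fin r)) (Equiv.refl (Fin m))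
        (P.map (Equiv.sumCongr (Equiv.refl A) (finSuccEquiv m)) x) hy (fun i => hκ (l i))
        (fun i => hκ (v i)) hc
      rw [Sum.comp_elim]
      refine h.symm.trans ?_
      refine (C.actOf_map _ _ x _).trans ?_
      rw [sumEnum_trans, Equiv.refl_trans]
      have e1 : (finSuccEquiv m).trans (optionEnum (Equiv.refl (Fin m))) = Equiv.refl _ := by
        ext i
        refine Fin.cases ?_ (fun i => ?_) i <;> simp
      rw [e1]
      refine C.actOf_congr _ rfl ?_
      rintro (i | i)
      · rfl
      · refine Fin.cases ?_ (fun i => ?_) i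
        · rfl
        · simp
    · rw [map_zero, map_zero, map_zero, zero_apply, map_zero]
      refine (MultilinearMap.map_coord_zero _ (sumEnum e (Equiv.refl _) (.inr 0)) ?_).symm
      simp
    · intro y y' hy hy'
      rw [map_add, map_add, add_apply, map_add, hy, hy', map_add]
      -- Exhibits the argument under induction as a single updated coordinate, so that additivity of
      -- the multilinear action applies.
      have key : ∀ z : C, (Sum.elim (κ ∘ l) (Fin.cons z (Words.toAlg C κ hκ ∘ Fin.tail a)) ∘
          (sumEnum e (Equiv.refl (Fin (m + 1)))).symm) = Function.update
          (Sum.elim (κ ∘ l) (Fin.cons 0 (Words.toAlg C κ hκ ∘ Fin.tail a)) ∘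
            (sumEnum e (Equiv.refl (Fin (m + 1)))).symm)
            (sumEnum e (Equiv.refl _) (.inr 0)) z := by
        intro z
        funext i
        obtain ⟨i, rfl⟩ := (sumEnum e (Equiv.refl (Fin (m + 1)))).surjective i
        rw [Function.update_apply]
        simp only [EmbeddingLike.apply_eq_iff_eq, Function.comp_apply, Equiv.symm_apply_apply]
        rcases i with i | i
        · simp
        · refine Fin.cases ?_ (fun i => ?_) i <;> simp
      rw [Operad.Alg.actOf, Operad.Alg.actOf, Operad.Alg.actOf, key (Words.toAlg C κ hκ y),
        key (Words.toAlg C κ hκ y'), key (Words.toAlg C κ hκ y + Words.toAlg C κ hκ y')]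
      exact (MultilinearMap.map_update_add _ _ _ _ _).symm

theorem Words.toAlg_act {n : ℕ} (μ : P.obj (Fin n)) (a : Fin n → Words P deg Empty) :
    Words.toAlg C κ hκ ((Words.alg P deg).act n μ a) = C.act n μ (Words.toAlg C κ hκ ∘ a) := by
  have key : (Words.toAlg C κ hκ).compMultilinearMap ((Words.alg P deg).act n μ) =
      (C.act n μ).compLinearMap fun _ => Words.toAlg C κ hκ := by
    refine GMod.multilinear_ext (M := (Words.alg P deg).toGMod) fun q a ha => ?_
    change Words.toAlg C κ hκ (Words.act P deg n (Words.closed P deg μ) a) = _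
    rw [Words.closed_eq_wordOf (Equiv.refl (Fin 0)) Fin.elim0,
      Words.toAlg_act_wordOf C κ hκ _ _ _ ha]
    refine (C.actOf_map _ _ μ _).trans ?_
    have e1 : (Equiv.emptySum (Fin 0) (Fin n)).symm.trans
        (sumEnum (Equiv.refl (Fin 0)) (Equiv.refl (Fin n))) = finCongr (Nat.zero_add n).symm := by
      ext i
      simp [sumEnum]
    rw [e1, C.actOf_eq _ (Equiv.refl (Fin n)) (q := q), inversionSign_self, one_smul,
      C.actOf_refl]
    · rfl
    · intro i j
      simp
    · exact fun i => Words.toAlg_mem C κ hκ (ha i)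
  exact congrArg (fun f => f a) key

theorem Words.alg_induction {p : Words P deg Empty → Prop}
    (letter : ∀ b, p (Words.letter P deg b)) (zero : p 0) (add : ∀ x y, p x → p y → p (x + y))
    (act : ∀ (n : ℕ) (r : ℤ) (q : Fin n → ℤ) (μ : P.obj (Fin n)) (a : Fin n → Words P deg Empty),
      μ ∈ (P.obj (Fin n)).gr r → (∀ i, a i ∈ Words.gr P deg Empty (q i)) →
      (∀ i, p (a i)) → p ((Words.alg P deg).act n μ a)) (x : Words P deg Empty) : p x := by
  induction x using Words.induction with
  | zero => exact zero
  | add x y hx hy => exact add x y hx hy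
  | word n l q μ hμ =>
    have := act n q (fun i => deg (l i)) (P.map (Equiv.sumEmpty (Fin n) Empty) μ)
      (fun i => Words.letter P deg (l i)) (P.map_mem _ hμ) (fun i => Words.letter_mem _)
      (fun i => letter _)
    rwa [Words.alg_act_letter, Words.monomial, P.map_map, P.map_eq_self (by simp)] at this

end lift

/-! # Derivations of free algebras -/

namespace Operad
variable {k : Type u} [CommRing k] (P : Operad k)

theorem d_comp_sgn {S T : Type} [Finite S] [Finite T] (x : P.obj (Option S)) (y : P.obj T) :
    (P.obj (T ⊕ S)).d (P.comp x y) =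
      P.comp ((P.obj (Option S)).d x) y + P.comp ((P.obj (Option S)).sgn x) ((P.obj T).d y) := by
  induction x using (P.obj (Option S)).toGMod.induction_gr with
  | hom p x hx => rw [P.d_comp y hx, GMod.sgn_of_mem _ hx, map_unitsSmul,
      LinearMap.smul_apply]
  | zero => simp
  | add x x' h h' =>
    simp only [map_add, LinearMap.add_apply, h, h']
    abel

theorem sgn_comp {S T : Type} [Finite S] [Finite T] (x : P.obj (Option S)) (y : P.obj T) :
    (P.obj (T ⊕ S)).sgn (P.comp x y) =
      P.comp ((P.obj (Option S)).sgn x) ((P.obj T).sgn y) := by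
  induction x using (P.obj (Option S)).toGMod.induction_gr with
  | hom p x hx =>
    induction y using (P.obj T).toGMod.induction_gr with
    | hom q y hy =>
      rw [GMod.sgn_of_mem _ hx, GMod.sgn_of_mem _ hy, GMod.sgn_of_mem _ (P.comp_mem hx hy),
        map_unitsSmul, map_unitsSmul, LinearMap.smul_apply, smul_smul, Int.negOnePow_add,
        mul_comm]
    | zero => simp
    | add x x' h h' => simp only [map_add, h, h']
  | zero => simp
  | add x x' h h' => simp only [map_add, LinearMap.add_apply, h, h']

end Operad

theorem sum_sum_eq_zero {T M : Type*} [Fintype T] [AddCommGroup M] (F : T → T → M)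
    (h : ∀ i j, i ≠ j → F i j + F j i = 0) (h0 : ∀ i, F i i = 0) : ∑ i, ∑ j, F i j = 0 := by
  classical
  rw [← Fintype.sum_prod_type']
  refine Finset.sum_involution (fun p _ => (p.2, p.1)) ?_ ?_ ?_ ?_
  · intro p _
    by_cases hp : p.1 = p.2
    · simp only [hp, h0, add_zero]
    · exact h p.1 p.2 hp
  · intro p _ hp heq
    have : p.1 = p.2 := congrArg Prod.snd heq
    exact hp (by rw [this, h0])
  · intro p _
    exact Finset.mem_univ _
  · intro p _
    rfl

namespace Operad.Alg
variable {k : Type u} [CommRing k] {P : Operad k}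

theorem act_units_smul_univ (C : P.forget.Alg) {n : ℕ} (μ : P.obj (Fin n)) (s : Fin n → ℤˣ)
    (a : Fin n → C) : C.act n μ (fun i => s i • a i) = (∏ i, s i) • C.act n μ a := by
  have h := (C.act n μ).map_smul_univ (fun i => (((s i : ℤˣ) : ℤ) : k)) a
  simp only [Int.cast_smul_eq_zsmul, ← Int.cast_prod] at h
  rw [Units.smul_def, Units.coe_prod, ← h]
  rfl

theorem prod_negOnePow {n : ℕ} (q : Fin n → ℤ) :
    ∏ i, (q i).negOnePow = (∑ i, q i).negOnePow := by
  induction n with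
  | zero => simp
  | succ n ih => rw [Fin.prod_univ_succ, Fin.sum_univ_succ, Int.negOnePow_add, ih]

/-- Degrees add up under the action, so the parity involution is multiplicative. Expressing signs
through this involution permits Leibniz formulas without homogeneity assumptions. -/
theorem sgn_act (C : P.forget.Alg) {n : ℕ} (μ : P.obj (Fin n)) (a : Fin n → C) :
    C.sgn (C.act n μ a) = C.act n ((P.obj (Fin n)).sgn μ) (fun i => C.sgn (a i)) := by
  have key : C.sgn.compMultilinearMap (C.act n μ) =
      (C.act n ((P.obj (Fin n)).sgn μ)).compLinearMap fun _ => C.sgn := by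
    refine GMod.multilinear_ext (M := C.toGMod) fun q a ha => ?_
    change C.sgn (C.act n μ a) = C.act n ((P.obj (Fin n)).sgn μ) (fun i => C.sgn (a i))
    have ha' : (fun i => C.sgn (a i)) = fun i => (q i).negOnePow • a i :=
      funext fun i => C.sgn_of_mem (ha i)
    rw [ha', act_units_smul_univ, prod_negOnePow]
    induction μ using (P.obj (Fin n)).toGMod.induction_gr with
    | hom p μ hμ =>
      rw [C.sgn_of_mem (C.act_mem hμ ha), GMod.sgn_of_mem _ hμ, map_unitsSmul, smul_apply,
        smul_smul, Int.negOnePow_add, mul_comm]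
    | zero => simp
    | add x x' h h' => simp only [map_add, add_apply, h, h', smul_add]
  exact congrArg (fun f => f a) key

/-- The arguments `±a₁, …, ±aᵢ₋₁, bᵢ, aᵢ₊₁, …, aₙ`. -/
def mixed (C : P.forget.Alg) {n : ℕ} (a b : Fin n → C) (i j : Fin n) : C :=
  if j < i then C.sgn (a j) else if j = i then b j else a j

/-- The value on `μ(a₁, …, aₙ)` of a derivation with the values `bᵢ` on the `aᵢ`. -/
def leibniz (C : P.forget.Alg) {n : ℕ} (μ : P.obj (Fin n)) (a b : Fin n → C) : C :=
  C.act n ((P.obj (Fin n)).d μ) a + ∑ i, C.act n ((P.obj (Fin n)).sgn μ) (C.mixed a b i)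

theorem act_mixed (C : P.forget.Alg) {n : ℕ} (μ : P.obj (Fin n)) {q : Fin n → ℤ}
    {a : Fin n → C} (ha : ∀ i, a i ∈ C.gr (q i)) (b : Fin n → C) (i : Fin n) :
    C.act n μ (C.mixed a b i) = (∑ j, if j < i then q j else 0).negOnePow •
      C.act n μ (Function.update a i (b i)) := by
  rw [← prod_negOnePow, ← act_units_smul_univ]
  congr 1
  funext j
  rcases lt_trichotomy j i with h | h | h
  · rw [mixed, if_pos h, if_pos h, C.sgn_of_mem (ha j), Function.update_of_ne h.ne]
  · subst h
    simp [mixed]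
  · rw [mixed, if_neg h.not_gt, if_neg h.ne', if_neg h.not_gt, Function.update_of_ne h.ne']
    simp

theorem leibniz_eq (C : P.forget.Alg) {n : ℕ} (μ : P.obj (Fin n)) {q : Fin n → ℤ}
    {a : Fin n → C} (ha : ∀ i, a i ∈ C.gr (q i)) (b : Fin n → C) :
    C.leibniz μ a b = C.act n ((P.obj (Fin n)).d μ) a +
      ∑ i, (∑ j, if j < i then q j else 0).negOnePow •
        C.act n ((P.obj (Fin n)).sgn μ) (Function.update a i (b i)) := by
  rw [leibniz]
  simp only [C.act_mixed _ ha]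

theorem leibniz_of_mem (C : P.forget.Alg) {n : ℕ} {p : ℤ} {μ : P.obj (Fin n)}
    (hμ : μ ∈ (P.obj (Fin n)).gr p) {q : Fin n → ℤ}
    {a : Fin n → C} (ha : ∀ i, a i ∈ C.gr (q i)) (b : Fin n → C) :
    C.leibniz μ a b = C.act n ((P.obj (Fin n)).d μ) a +
      ∑ i, (p + ∑ j, if j < i then q j else 0).negOnePow •
        C.act n μ (Function.update a i (b i)) := by
  rw [C.leibniz_eq μ ha, GMod.sgn_of_mem _ hμ]
  simp only [map_unitsSmul, smul_apply, smul_smul, ← Int.negOnePow_add, add_comm p]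

/-- Termwise equivariance of the action, where the i-th term has one argument of degree raised by 1.
The change of the Koszul sign caused by this shift is `koszulSign_update`. -/
theorem leibniz_map (C : P.forget.Alg) {n : ℕ} (σ : Equiv.Perm (Fin n)) (μ : P.obj (Fin n))
    {q : Fin n → ℤ} {a b : Fin n → C} (ha : ∀ i, a i ∈ C.gr (q i))
    (hb : ∀ i, b i ∈ C.gr (q i + 1)) :
    C.leibniz (P.map σ μ) a b = koszulSign σ q • C.leibniz μ (a ∘ σ) (b ∘ σ) := by
  rw [C.leibniz_eq _ ha, C.leibniz_eq (q := q ∘ σ) (a := a ∘ σ) _ (fun i => ha (σ i)), smul_add,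
    ← P.map_d, P.sgn_map, ← Equiv.sum_comp σ, Finset.smul_sum]
  congr 1
  · exact C.act_map σ _ ha
  · refine Finset.sum_congr rfl fun i _ => ?_
    have hmem : ∀ j, Function.update a (σ i) (b (σ i)) j ∈
        C.gr (Function.update q (σ i) (q (σ i) + 1) j) := by
      intro j
      by_cases h : j = σ i
      · subst h
        simpa using hb (σ i)
      · simpa [h] using ha j
    refine (congrArg _ (C.act_map σ _ hmem)).trans ?_
    rw [smul_smul, smul_smul, ← koszulSign_update]
    congr 2
    exact Function.update_comp_eq_of_injective a σ.injective i _

/-- The derivative hits the composite operation, one of the first n arguments, or one of the last m.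
The first two kinds, apart from the differential of μ, assemble to the derivative of the inner
value; in the third kind the inner value acquires its parity sign by `sgn_act`. -/
theorem leibniz_comp (C : P.forget.Alg) {m n : ℕ} (μ : P.obj (Option (Fin m)))
    (ν : P.obj (Fin n)) (a b : Fin (n + m) → C) :
    C.leibniz (P.map finSumFinEquiv (P.comp μ ν)) a b =
      C.leibniz (P.map (finSuccEquiv m).symm μ)
        (Fin.cons (C.act n ν (a ∘ Fin.castAdd m)) (a ∘ Fin.natAdd n))
        (Fin.cons (C.leibniz ν (a ∘ Fin.castAdd m) (b ∘ Fin.castAdd m)) (b ∘ Fin.natAdd n)) := by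
  have hc : ∀ (μ : P.obj (Option (Fin m))) (ν : P.obj (Fin n)) (a : Fin (n + m) → C),
      C.act (n + m) (P.map finSumFinEquiv (P.comp μ ν)) a =
      C.act (m + 1) (P.map (finSuccEquiv m).symm μ)
        (Fin.cons (C.act n ν (a ∘ Fin.castAdd m)) (a ∘ Fin.natAdd n)) := C.act_comp
  have hcons : ∀ (ν : P.obj (Fin (m + 1))) (x y : C) (c : Fin m → C),
      C.act (m + 1) ν (Fin.cons (x + y) c) =
        C.act (m + 1) ν (Fin.cons x c) + C.act (m + 1) ν (Fin.cons y c) := fun ν x y c => by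
    have := (C.act (m + 1) ν).map_update_add (Fin.cons 0 c) 0 x y
    simpa only [Fin.update_cons_zero] using this
  have hsum : ∀ (ν : P.obj (Fin (m + 1))) (x : Fin n → C) (c : Fin m → C),
      C.act (m + 1) ν (Fin.cons (∑ i, x i) c) =
        ∑ i, C.act (m + 1) ν (Fin.cons (x i) c) := fun ν x c => by
    have := (C.act (m + 1) ν).map_update_sum Finset.univ 0 x (Fin.cons 0 c)
    simpa only [Fin.update_cons_zero] using this
  have m1 : ∀ i : Fin n, C.mixed a b (Fin.castAdd m i) ∘ Fin.castAdd m =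
      C.mixed (a ∘ Fin.castAdd m) (b ∘ Fin.castAdd m) i := by
    intro i
    funext j
    simp [mixed, Fin.lt_def, Fin.ext_iff, -Fin.val_fin_lt]
  have m2 : ∀ i : Fin n, C.mixed a b (Fin.castAdd m i) ∘ Fin.natAdd n = a ∘ Fin.natAdd n := by
    intro i
    funext j
    have h1 : ¬ Fin.natAdd n j < Fin.castAdd m i := by
      rw [Fin.lt_def, Fin.val_natAdd, Fin.val_castAdd]; omega
    have h2 : Fin.natAdd n j ≠ Fin.castAdd m i := by
      rw [Ne, Fin.ext_iff, Fin.val_natAdd, Fin.val_castAdd]; omega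
    rw [Function.comp_apply, mixed, if_neg h1, if_neg h2, Function.comp_apply]
  have m3 : ∀ i : Fin m, C.mixed a b (Fin.natAdd n i) ∘ Fin.castAdd m =
      fun j => C.sgn ((a ∘ Fin.castAdd m) j) := by
    intro i
    funext j
    have h1 : Fin.castAdd m j < Fin.natAdd n i := by
      rw [Fin.lt_def, Fin.val_natAdd, Fin.val_castAdd]; omega
    rw [Function.comp_apply, mixed, if_pos h1, Function.comp_apply]
  have m4 : ∀ i : Fin m, C.mixed a b (Fin.natAdd n i) ∘ Fin.natAdd n =
      C.mixed (a ∘ Fin.natAdd n) (b ∘ Fin.natAdd n) i := by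
    intro i
    funext j
    simp [mixed, Fin.lt_def, Fin.ext_iff, -Fin.val_fin_lt]
  have m5 : ∀ (x y : C) (a b : Fin m → C),
      C.mixed (Fin.cons x a) (Fin.cons y b) 0 = Fin.cons y a := by
    intro x y a b
    funext j
    refine Fin.cases ?_ (fun j => ?_) j <;> simp [mixed, Fin.succ_ne_zero]
  have m6 : ∀ (x y : C) (a b : Fin m → C) (i : Fin m),
      C.mixed (Fin.cons x a) (Fin.cons y b) i.succ = Fin.cons (C.sgn x) (C.mixed a b i) := by
    intro x y a b i
    funext j
    refine Fin.cases ?_ (fun j => ?_) j <;> simp [mixed]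
  rw [leibniz, leibniz, ← P.map_d, ← P.map_d, P.sgn_map, P.sgn_map, P.d_comp_sgn, P.sgn_comp,
    map_add, map_add, add_apply, hc, hc, Fin.sum_univ_add, Fin.sum_univ_succ, m5]
  have hs : C.sgn (C.act n ν (a ∘ Fin.castAdd m)) = C.act n ((P.obj (Fin n)).sgn ν)
      (fun j => C.sgn ((a ∘ Fin.castAdd m) j)) := C.sgn_act ν _
  simp only [hc, m1, m2, m3, m4, m6, hs]
  rw [leibniz, hcons, hsum]
  abel

theorem leibniz_mem (C : P.forget.Alg) {n : ℕ} {p : ℤ} {μ : P.obj (Fin n)}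
    (hμ : μ ∈ (P.obj (Fin n)).gr p) {q : Fin n → ℤ}
    {a b : Fin n → C} (ha : ∀ i, a i ∈ C.gr (q i)) (hb : ∀ i, b i ∈ C.gr (q i + 1)) :
    C.leibniz μ a b ∈ C.gr (p + ∑ i, q i + 1) := by
  rw [C.leibniz_of_mem hμ ha]
  refine add_mem ?_ (sum_mem fun i _ => unitsSmul_mem _ ?_)
  · have := C.act_mem (μ := (P.obj (Fin n)).d μ) ((P.obj (Fin n)).d_mem hμ) ha
    rwa [add_right_comm] at this
  · have hmem : ∀ j, Function.update a i (b i) j ∈ C.gr (Function.update q i (q i + 1) j) := by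
      intro j
      by_cases h : j = i
      · subst h
        simpa using hb j
      · simpa [h] using ha j
    have := C.act_mem hμ hmem
    have hs : ∑ j, Function.update q i (q i + 1) j = ∑ j, q j + 1 := by
      rw [Finset.sum_update_of_mem (Finset.mem_univ i),
        ← Finset.add_sum_erase _ _ (Finset.mem_univ i), Finset.sdiff_singleton_eq_erase]
      ring
    rwa [hs, ← add_assoc] at this

/-- `leibniz`, as a multilinear map. -/
def leibnizMap (C : P.forget.Alg) {n : ℕ} (μ : P.obj (Fin n)) :
    MultilinearMap k (fun _ : Fin n => C × C) C :=
  (C.act n ((P.obj (Fin n)).d μ)).compLinearMap (fun _ => LinearMap.fst k C C) +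
    ∑ i, (C.act n ((P.obj (Fin n)).sgn μ)).compLinearMap fun j =>
      if j < i then C.sgn ∘ₗ LinearMap.fst k C C
      else if j = i then LinearMap.snd k C C else LinearMap.fst k C C

theorem leibnizMap_apply (C : P.forget.Alg) {n : ℕ} (μ : P.obj (Fin n)) (c : Fin n → C × C) :
    C.leibnizMap μ c = C.leibniz μ (fun i => (c i).1) (fun i => (c i).2) := by
  rw [leibnizMap, leibniz, add_apply, sum_apply]
  congr 1
  refine Finset.sum_congr rfl fun i _ => ?_
  rw [MultilinearMap.compLinearMap_apply]
  congr 1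
  funext j
  rw [mixed]
  split_ifs <;> rfl

/-- The algebra `C ⊕ ε C`; a section `x ↦ x + ε δ x` is a morphism of algebras if and only if
`δ` is a derivation. -/
def tangent (C : P.forget.Alg) : P.forget.Alg where
  carrier := C × C
  gr n := (C.gr n).prod (C.gr (n + 1))
  internal := by
    refine GMod.isInternal_of_proj _ (fun n => LinearMap.prodMap (C.proj n) (C.proj (n + 1)))
      ?_ ?_ ?_
    · rintro n ⟨x, y⟩ ⟨hx, hy⟩
      exact Prod.ext (C.proj_of_mem hx) (C.proj_of_mem hy)
    · rintro m n h ⟨x, y⟩ ⟨hx, hy⟩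
      exact Prod.ext (C.proj_of_mem_of_ne h hx) (C.proj_of_mem_of_ne (by omega) hy)
    · rw [eq_top_iff]
      rintro ⟨x, y⟩ -
      have h : ((x, y) : C × C) = (x, 0) + (0, y) := by simp
      rw [h]
      refine add_mem ?_ ?_
      · induction x using C.induction_gr with
        | hom n x hx => exact Submodule.mem_iSup_of_mem n ⟨hx, zero_mem _⟩
        | zero => exact zero_mem _
        | add x x' hx hx' => simpa using add_mem (hx (by simp)) (hx' (by simp))
      · induction y using C.induction_gr with
        | hom n y hy =>
          exact Submodule.mem_iSup_of_mem (n - 1) ⟨zero_mem _, by rwa [sub_add_cancel]⟩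
        | zero => exact zero_mem _
        | add x x' hx hx' => simpa using add_mem (hx (by simp)) (hx' (by simp))
  d := 0
  d_mem := fun _ => Submodule.zero_mem _
  d_d := fun _ => rfl
  act n :=
    { toFun := fun μ =>
        ((C.act n μ).compLinearMap fun _ => LinearMap.fst k C C).prod (C.leibnizMap μ)
      map_add' := fun μ ν => by
        ext c
        · simp
        · simp only [MultilinearMap.prod_apply, leibnizMap_apply, leibniz, map_add, add_apply,
            Prod.snd_add, Finset.sum_add_distrib]
          abel
      map_smul' := fun r μ => by
        ext c
        · simp
        · simp only [MultilinearMap.prod_apply, leibnizMap_apply, leibniz, map_smul, smul_apply,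
            Prod.smul_snd, smul_add, Finset.smul_sum, RingHom.id_apply] }
  act_mem hμ hc := ⟨C.act_mem hμ fun i => (hc i).1, by
    change C.leibnizMap _ _ ∈ _
    rw [leibnizMap_apply]
    exact C.leibniz_mem hμ (fun i => (hc i).1) fun i => (hc i).2⟩
  d_act {n p q μ a} _ _ := by
    have : ∀ i, (((C.act n μ).compLinearMap fun _ => LinearMap.fst k C C).prod (C.leibnizMap μ))
        (Function.update a i 0) = 0 := fun i => MultilinearMap.map_coord_zero _ i (by simp)
    have h0 : C.leibnizMap (0 : P.obj (Fin n)) a = 0 := by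
      rw [leibnizMap_apply, leibniz]
      simp
    change (0 : C × C) = (_, C.leibnizMap (0 : P.obj (Fin n)) a) + _
    simp [this, h0]
    rfl
  act_map σ μ a ha := by
    refine Prod.ext (C.act_map σ μ fun i => (ha i).1) ?_
    rw [Units.smul_def, Prod.smul_snd, ← Units.smul_def]
    change C.leibnizMap _ _ = _ • C.leibnizMap _ _
    rw [leibnizMap_apply, leibnizMap_apply]
    exact C.leibniz_map σ μ (fun i => (ha i).1) fun i => (ha i).2
  act_one a := by
    refine Prod.ext (C.act_one _) ?_
    change C.leibnizMap _ _ = _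
    rw [leibnizMap_apply, leibniz, ← P.map_d, P.d_one, map_zero, map_zero, zero_apply, zero_add,
      Fin.sum_univ_one, P.sgn_map, GMod.sgn_of_mem _ P.one_mem, Int.negOnePow_zero, one_smul]
    exact C.act_one _
  act_comp μ ν a := by
    refine Prod.ext ?_ ?_
    · refine (C.act_comp μ ν _).trans ?_
      change _ = C.act _ _ _
      congr 1
      funext i
      refine Fin.cases ?_ (fun i => ?_) i <;> rfl
    · change C.leibnizMap _ _ = C.leibnizMap _ _
      rw [leibnizMap_apply, leibnizMap_apply]
      refine (C.leibniz_comp μ ν _ _).trans ?_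
      congr 1
      · funext i
        refine Fin.cases ?_ (fun i => ?_) i <;> rfl
      · funext i
        refine Fin.cases ?_ (fun i => ?_) i
        · exact (leibnizMap_apply C _ _).symm
        · rfl

end Operad.Alg

/-! ### Differentials as derivations, and their squares -/

namespace Operad.Alg
variable {k : Type u} [CommRing k] {P : Operad k}

/-- The underlying graded algebra of a dg-algebra. -/
abbrev graded (C : P.Alg) : P.forget.Alg where
  toGMod := C.toGMod
  d := 0
  d_mem := fun _ => Submodule.zero_mem _
  d_d := fun _ => rfl
  act := C.act
  act_mem := C.act_mem
  d_act {n p q μ a} _ _ := by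
    have h : ∀ i, C.act n μ (Function.update a i 0) = 0 := fun i =>
      MultilinearMap.map_coord_zero _ i (by simp)
    change (0 : C) = C.act n (0 : P.obj (Fin n)) a + _
    rw [map_zero, zero_apply, zero_add]
    refine (Finset.sum_eq_zero fun i _ => ?_).symm
    exact (congrArg _ (h i)).trans (smul_zero _)
  act_map := C.act_map
  act_one := C.act_one
  act_comp := C.act_comp

theorem d_act_eq_leibniz (C : P.Alg) {n : ℕ} {p : ℤ} {q : Fin n → ℤ} {μ : P.obj (Fin n)}
    {a : Fin n → C} (hμ : μ ∈ (P.obj (Fin n)).gr p) (ha : ∀ i, a i ∈ C.gr (q i)) :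
    C.d (C.act n μ a) = C.graded.leibniz μ a (C.d ∘ a) := by
  rw [C.graded.leibniz_of_mem hμ ha]
  exact C.d_act hμ ha

theorem map_leibniz {C D : P.forget.Alg} (f : C →ₗ[k] D)
    (hf : ∀ {n : ℤ} {x : C}, x ∈ C.gr n → f x ∈ D.gr n)
    (hact : ∀ (n : ℕ) (μ : P.obj (Fin n)) (a : Fin n → C), f (C.act n μ a) = D.act n μ (f ∘ a))
    {n : ℕ} (μ : P.obj (Fin n)) (a b : Fin n → C) :
    f (C.leibniz μ a b) = D.leibniz μ (f ∘ a) (f ∘ b) := by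
  rw [leibniz, leibniz, map_add, map_sum, hact]
  congr 1
  refine Finset.sum_congr rfl fun i _ => ?_
  rw [hact]
  congr 1
  funext j
  simp only [Function.comp_apply, mixed]
  split_ifs
  · exact (GMod.map_sgn f hf _).symm
  · rfl
  · rfl

/-- The square of an odd derivation vanishes on μ(a) once it vanishes on the arguments. The terms
with dμ cancel in pairs, since dμ has degree one more than μ. Applying D to two different arguments
in either order gives opposite signs, and applying it twice to the same argument gives zero. -/
theorem leibniz_leibniz (C : P.forget.Alg) (D : C →ₗ[k] C)
    (hD : ∀ {n : ℤ} {x : C}, x ∈ C.gr n → D x ∈ C.gr (n + 1))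
    (hact : ∀ (n : ℕ) (μ : P.obj (Fin n)) (a : Fin n → C),
      D (C.act n μ a) = C.leibniz μ a (D ∘ a))
    {n : ℕ} {p : ℤ} {q : Fin n → ℤ} {μ : P.obj (Fin n)} {a : Fin n → C}
    (hμ : μ ∈ (P.obj (Fin n)).gr p) (ha : ∀ i, a i ∈ C.gr (q i)) (h0 : ∀ i, D (D (a i)) = 0) :
    D (D (C.act n μ a)) = 0 := by
  have hmem : ∀ i j, Function.update a i (D (a i)) j ∈
      C.gr (Function.update q i (q i + 1) j) := by
    intro i j
    by_cases h : j = i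
    · subst h
      simpa using hD (ha j)
    · simpa [h] using ha j
  have e : ∀ i, D (C.act n μ (Function.update a i (D (a i)))) =
      C.act n ((P.obj (Fin n)).d μ) (Function.update a i (D (a i))) +
      ∑ j, (p + ∑ l, if l < j then Function.update q i (q i + 1) l else 0).negOnePow •
        C.act n μ (Function.update (Function.update a i (D (a i))) j
          (D (Function.update a i (D (a i)) j))) := fun i => by
    rw [hact, C.leibniz_of_mem hμ (hmem i)]
    rfl
  have e0 : D (C.act n ((P.obj (Fin n)).d μ) a) =
      ∑ i, (p + 1 + ∑ j, if j < i then q j else 0).negOnePow •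
        C.act n ((P.obj (Fin n)).d μ) (Function.update a i (D (a i))) := by
    rw [hact, C.leibniz_of_mem ((P.obj (Fin n)).d_mem hμ) ha, (P.obj (Fin n)).d_d, map_zero,
      zero_apply, zero_add]
    rfl
  rw [hact, C.leibniz_of_mem hμ ha, map_add, map_sum, e0]
  simp only [map_unitsSmul, Function.comp_apply, e, smul_add, Finset.sum_add_distrib]
  rw [← add_assoc, ← Finset.sum_add_distrib, Finset.sum_eq_zero, zero_add]
  · simp only [Finset.smul_sum]
    refine sum_sum_eq_zero _ ?_ ?_
    · have key : ∀ i j, i < j →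
        (p + ∑ l, if l < i then q l else 0).negOnePow •
          (p + ∑ l, if l < j then Function.update q i (q i + 1) l else 0).negOnePow •
            C.act n μ (Function.update (Function.update a i (D (a i))) j
              (D (Function.update a i (D (a i)) j))) +
        (p + ∑ l, if l < j then q l else 0).negOnePow •
          (p + ∑ l, if l < i then Function.update q j (q j + 1) l else 0).negOnePow •
            C.act n μ (Function.update (Function.update a j (D (a j))) i
              (D (Function.update a j (D (a j)) i))) = 0 := by
        intro i j hij
        rw [Function.update_of_ne hij.ne', Function.update_of_ne hij.ne,
          Function.update_comm hij.ne]
        -- For i < j, the first application of D at i raises the degrees in front of j by one,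
        -- whereas an application at j leaves those in front of i unchanged.
        have h1 : (∑ l, if l < j then Function.update q i (q i + 1) l else 0) =
            (∑ l, if l < j then q l else 0) + 1 := by
          have : ∀ l, (if l < j then Function.update q i (q i + 1) l else 0) =
              (if l < j then q l else 0) + if l = i then 1 else 0 := by
            intro l
            by_cases h : l = i
            · subst h
              simp [hij]
            · simp [h]
          simp [this, Finset.sum_add_distrib]
        have h2 : (∑ l, if l < i then Function.update q j (q j + 1) l else 0) =
            (∑ l, if l < i then q l else 0) := by
          refine Finset.sum_congr rfl fun l _ => ?_
          split_ifs with h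
          · rw [Function.update_of_ne (h.trans hij).ne]
          · rfl
        rw [h1, h2, smul_smul, smul_smul, ← add_assoc p, Int.negOnePow_succ, mul_neg,
          Units.neg_smul, mul_comm, neg_add_cancel]
      intro i j hij
      rcases lt_or_gt_of_ne hij with h | h
      · exact key i j h
      · rw [add_comm]
        exact key j i h
    · intro i
      rw [Function.update_self, h0, MultilinearMap.map_coord_zero _ i (by simp), smul_zero,
        smul_zero]
  · intro i _
    rw [add_right_comm, Int.negOnePow_succ, Units.neg_smul, neg_add_cancel]

end Operad.Alg

/-! ### Quasi-free algebras -/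

namespace Words
variable {k : Type u} [CommRing k] {P : Operad k} {β : Type u} {deg : β → ℤ}
variable (δ : β → Words P deg Empty) (hδ : ∀ b, δ b ∈ Words.gr P deg Empty (deg b + 1))

/-- The morphism of algebras `x ↦ x + ε D x`, for the derivation `D` with given values on the
letters. -/
def derivSection : Words P deg Empty →ₗ[k] (Words.alg P deg).tangent :=
  Words.toAlg (Words.alg P deg).tangent (fun b => (letter P deg b, δ b))
    fun b => ⟨letter_mem b, hδ b⟩

/-- The derivation of the free algebra with given values on the letters. -/
def deriv : Words P deg Empty →ₗ[k] Words P deg Empty :=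
  LinearMap.snd k (Words P deg Empty) (Words P deg Empty) ∘ₗ derivSection δ hδ

theorem derivSection_letter (b : β) : derivSection δ hδ (letter P deg b) = (letter P deg b, δ b) :=
  toAlg_letter (deg := deg) (Words.alg P deg).tangent (fun b => (letter P deg b, δ b))
    (fun b => ⟨letter_mem b, hδ b⟩) b

theorem derivSection_act {n : ℕ} (μ : P.obj (Fin n)) (a : Fin n → Words P deg Empty) :
    derivSection δ hδ ((Words.alg P deg).act n μ a) =
      ((Words.alg P deg).act n μ (fun i => (derivSection δ hδ (a i)).1),
        (Words.alg P deg).leibniz μ (fun i => (derivSection δ hδ (a i)).1)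
          fun i => (derivSection δ hδ (a i)).2) := by
  refine (toAlg_act _ _ _ μ a).trans (Prod.ext rfl ?_)
  exact Operad.Alg.leibnizMap_apply _ _ _

/-- The first component is an algebra endomorphism fixing the letters. Hence the section really is
one, and its second component satisfies the Leibniz rule over the identity. -/
theorem derivSection_fst (x : Words P deg Empty) : (derivSection δ hδ x).1 = x := by
  induction x using alg_induction with
  | letter b => rw [derivSection_letter]
  | zero => rw [map_zero]; rfl
  | add x y hx hy =>
    rw [map_add]
    exact congrArg₂ (· + ·) hx hy
  | act n r q μ a hμ ha ih =>
    rw [derivSection_act]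
    exact congrArg _ (funext ih)

theorem deriv_letter (b : β) : deriv δ hδ (letter P deg b) = δ b :=
  congrArg Prod.snd (derivSection_letter δ hδ b)

theorem deriv_act {n : ℕ} (μ : P.obj (Fin n)) (a : Fin n → Words P deg Empty) :
    deriv δ hδ ((Words.alg P deg).act n μ a) =
      (Words.alg P deg).leibniz μ a (deriv δ hδ ∘ a) := by
  refine (congrArg Prod.snd (derivSection_act δ hδ μ a)).trans ?_
  simp only [derivSection_fst]
  rfl

theorem deriv_mem {p : ℤ} {x : Words P deg Empty} (hx : x ∈ Words.gr P deg Empty p) :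
    deriv δ hδ x ∈ Words.gr P deg Empty (p + 1) :=
  (toAlg_mem (Words.alg P deg).tangent _ _ hx).2

theorem deriv_deriv (h : ∀ b, deriv δ hδ (δ b) = 0) (x : Words P deg Empty) :
    deriv δ hδ (deriv δ hδ x) = 0 := by
  induction x using alg_induction with
  | letter b => rw [deriv_letter, h]
  | zero => rw [map_zero, map_zero]
  | add x y hx hy => rw [map_add, map_add, hx, hy, add_zero]
  | act n r q μ a hμ ha ih =>
    exact (Words.alg P deg).leibniz_leibniz _ (deriv_mem δ hδ)
      (fun n μ a => deriv_act δ hδ μ a) hμ ha ih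

/-- The quasi-free algebra with a given differential on the letters. -/
def dgAlg (h : ∀ b, deriv δ hδ (δ b) = 0) : P.Alg where
  toGMod := (Words.alg P deg).toGMod
  d := deriv δ hδ
  d_mem := deriv_mem δ hδ
  d_d := deriv_deriv δ hδ h
  act := (Words.alg P deg).act
  act_mem := (Words.alg P deg).act_mem
  d_act hμ ha := by
    refine (deriv_act δ hδ _ _).trans ?_
    exact (Words.alg P deg).leibniz_of_mem hμ ha _
  act_map := (Words.alg P deg).act_map
  act_one := (Words.alg P deg).act_one
  act_comp := (Words.alg P deg).act_comp

/-- Both composites obey the same Leibniz rule along the algebra morphism, so agreement on letters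
propagates to all words. -/
theorem toAlg_deriv (C : P.Alg) (κ : β → C) (hκ : ∀ b, κ b ∈ C.gr (deg b))
    (h : ∀ b, toAlg C.graded κ hκ (δ b) = C.d (κ b)) (x : Words P deg Empty) :
    toAlg C.graded κ hκ (deriv δ hδ x) = C.d (toAlg C.graded κ hκ x) := by
  induction x using alg_induction with
  | letter b => rw [deriv_letter, h, toAlg_letter]
  | zero => rw [map_zero, map_zero, map_zero]
  | add x y hx hy => rw [map_add, map_add, map_add, hx, hy, map_add]
  | act n r q μ a hμ ha ih =>
    rw [deriv_act, toAlg_act]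
    refine (Operad.Alg.map_leibniz (C := Words.alg P deg) (D := C.graded) _ (toAlg_mem _ _ _)
      (fun n μ a => toAlg_act _ _ _ μ a) μ _ _).trans ?_
    have hm : ∀ i, (toAlg C.graded κ hκ ∘ a) i ∈ C.gr (q i) := fun i =>
      toAlg_mem C.graded κ hκ (ha i)
    refine Eq.trans ?_ (C.d_act_eq_leibniz hμ hm).symm
    congr 1
    funext i
    exact ih i

/-- The morphism from a quasi-free algebra with given values on the letters. -/
def dgLift (hd : ∀ b, deriv δ hδ (δ b) = 0) (C : P.Alg) (κ : β → C)
    (hκ : ∀ b, κ b ∈ C.gr (deg b)) (h : ∀ b, toAlg C.graded κ hκ (δ b) = C.d (κ b)) :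
    (dgAlg δ hδ hd).Hom C where
  toLin := toAlg C.graded κ hκ
  map_mem hx := toAlg_mem C.graded κ hκ hx
  map_d := toAlg_deriv δ hδ C κ hκ h
  map_act _ μ a := toAlg_act C.graded κ hκ μ a

end Words

/-! # The free algebra in terms of a homogeneous basis -/

section schur
variable {k : Type u} [CommRing k] {P : Operad k} {V W : GMod k}

/-- The class of `μ ⊗ v₁ ⋯ vₙ`, as a multilinear map in the `vᵢ`. -/
def Schur.mk {n : ℕ} : P.obj (Fin n) →ₗ[k] MultilinearMap k (fun _ : Fin n => V.carrier)
    (Schur P V) where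
  toFun μ := ((coinvRel P V).mkQ ∘ₗ DirectSum.lof k ℕ
    (fun n => (P.obj (Fin n)).carrier ⊗[k] (⨂[k] _ : Fin n, V.carrier)) n ∘ₗ
      TensorProduct.mk k _ _ μ).compMultilinearMap (PiTensorProduct.tprod k)
  map_add' μ ν := by
    ext v
    simp
  map_smul' r μ := by
    ext v
    simp

theorem Schur.mk_apply {n : ℕ} (μ : P.obj (Fin n)) (v : Fin n → V) :
    Schur.mk μ v = Submodule.Quotient.mk (p := coinvRel P V) (PreSchur.mk μ v) := rfl

theorem Schur.mk_map {n : ℕ} (σ : Equiv.Perm (Fin n)) (μ : P.obj (Fin n)) {q : Fin n → ℤ}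
    {v : Fin n → V} (hv : ∀ i, v i ∈ V.gr (q i)) :
    Schur.mk (P.map σ μ) v = koszulSign σ q • Schur.mk μ (v ∘ σ) := by
  rw [← sub_eq_zero]
  have h : PreSchur.mk (P.map σ μ) v - koszulSign σ q • PreSchur.mk μ (v ∘ σ) ∈ coinvRel P V :=
    Submodule.subset_span ⟨n, μ, σ, q, v, hv, rfl⟩
  refine Eq.trans ?_ ((Submodule.Quotient.mk_eq_zero _).2 h)
  rw [Submodule.Quotient.mk_sub, Units.smul_def, Units.smul_def]
  rfl

theorem Schur.hom_ext {M : Type*} [AddCommGroup M] [Module k M] {f g : Schur P V →ₗ[k] M}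
    (h : ∀ (n : ℕ) (μ : P.obj (Fin n)), f.compMultilinearMap (Schur.mk μ) =
      g.compMultilinearMap (Schur.mk μ)) : f = g := by
  refine Submodule.linearMap_qext _ (DirectSum.linearMap_ext k fun n => TensorProduct.ext' ?_)
  intro μ t
  have : (f ∘ₗ (coinvRel P V).mkQ ∘ₗ DirectSum.lof k ℕ _ n ∘ₗ TensorProduct.mk k _ _ μ) =
      (g ∘ₗ (coinvRel P V).mkQ ∘ₗ DirectSum.lof k ℕ _ n ∘ₗ TensorProduct.mk k _ _ μ) := by
    refine PiTensorProduct.ext ?_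
    exact h n μ
  exact congrArg (fun F => F t) this

theorem Operad.Alg.extend_mk (A : P.Alg) (ι : V →ₗ[k] A)
    (hι : ∀ {n : ℤ} {x : V}, x ∈ V.gr n → ι x ∈ A.gr n) {n : ℕ} (μ : P.obj (Fin n))
    (v : Fin n → V) : A.extend ι hι (Schur.mk μ v) = A.act n μ (ι ∘ v) := by
  rw [Schur.mk_apply, PreSchur.mk, extend]
  refine (Submodule.liftQ_apply _ _ _).trans ?_
  rw [DirectSum.toModule_lof, TensorProduct.lift.tmul]
  simp only [LinearMap.comp_apply, LinearEquiv.coe_coe, PiTensorProduct.lift.tprod]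
  rfl

theorem Schur.map_mk (f : V →ₗ[k] W) (hf : ∀ {n : ℤ} {x : V}, x ∈ V.gr n → f x ∈ W.gr n)
    {n : ℕ} (μ : P.obj (Fin n)) (v : Fin n → V) :
    Schur.map P f hf (Schur.mk μ v) = Schur.mk μ (f ∘ v) := by
  rw [Schur.mk_apply, Schur.mk_apply, ← PreSchur.map_mk]
  rfl

theorem Schur.d_mk {V : DGMod k} {n : ℕ} (μ : P.obj (Fin n)) {q : Fin n → ℤ} {v : Fin n → V}
    (hv : ∀ i, v i ∈ V.gr (q i)) :
    Schur.d P V (Schur.mk (V := V.toGMod) μ v) =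
      Schur.mk (V := V.toGMod) ((P.obj (Fin n)).d μ) v +
      ∑ i, (∑ j, if j < i then q j else 0).negOnePow •
        Schur.mk (V := V.toGMod) ((P.obj (Fin n)).sgn μ) (Function.update v i (V.d (v i))) := by
  refine (congrArg (coinvRel P V.toGMod).mkQ (PreSchur.d_mk P V μ hv)).trans ?_
  rw [map_add, map_sum]
  simp only [map_unitsSmul]
  rfl

/-- Applied below to a quasi-free algebra whose differential is linear on letters, it identifies the
differential of P(V) given by coinvariants with the derivation on words. -/
theorem Operad.Alg.extend_d {V : DGMod k} (A : P.Alg) (ι : V.Hom A.toDGMod)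
    (x : Schur P V.toGMod) :
    A.extend ι.toLin ι.map_mem (Schur.d P V x) = A.d (A.extend ι.toLin ι.map_mem x) := by
  have key : A.extend ι.toLin ι.map_mem ∘ₗ Schur.d P V = A.d ∘ₗ A.extend ι.toLin ι.map_mem := by
    refine Schur.hom_ext fun n μ => GMod.multilinear_ext fun q v hv => ?_
    simp only [LinearMap.compMultilinearMap_apply, LinearMap.comp_apply]
    induction μ using (P.obj (Fin n)).toGMod.induction_gr with
    | hom p μ hμ =>
      have hιv : ∀ i, (ι.toLin ∘ v) i ∈ A.gr (q i) := fun i => ι.map_mem (hv i)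
      rw [A.extend_mk, A.d_act_eq_leibniz hμ hιv, Schur.d_mk μ hv, map_add,
        map_sum, A.extend_mk, A.graded.leibniz_eq μ hιv]
      congr 1
      refine Finset.sum_congr rfl fun i _ => ?_
      rw [map_unitsSmul, A.extend_mk, Function.comp_update, ι.map_d]
      rfl
    | zero => simp
    | add x y hx hy => simp only [map_add, add_apply, hx, hy]
  exact congrArg (fun f => f x) key

theorem GMod.map_mem_of_basis {β : Type*} {deg : β → ℤ} (b : Module.Basis β k V)
    (hb : ∀ i, b i ∈ V.gr (deg i)) {f : V →ₗ[k] W} (hf : ∀ i, f (b i) ∈ W.gr (deg i)) {n : ℤ}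
    {x : V} (hx : x ∈ V.gr n) : f x ∈ W.gr n := by
  have key : f ∘ₗ V.proj n = W.proj n ∘ₗ f := b.ext fun i => by
    rw [LinearMap.comp_apply, LinearMap.comp_apply, V.proj_of_mem_eq n (hb i),
      W.proj_of_mem_eq n (hf i)]
    split_ifs <;> simp
  have := congrArg (fun F => F x) key
  simp only [LinearMap.comp_apply, V.proj_of_mem hx] at this
  rw [this]
  exact W.proj_mem n _

variable {β : Type u} {deg : β → ℤ} (b : Module.Basis β k V) (hb : ∀ i, b i ∈ V.gr (deg i))

variable (P deg) in
/-- The linear map which sends the basis vectors to the letters. -/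
def Words.ofBasis : V →ₗ[k] Words P deg Empty := b.constr k (Words.letter P deg)

theorem Words.ofBasis_basis (i : β) : Words.ofBasis P deg b (b i) = Words.letter P deg i :=
  b.constr_basis k _ i

theorem Words.ofBasis_mem (hb : ∀ i, b i ∈ V.gr (deg i)) {n : ℤ} {x : V} (hx : x ∈ V.gr n) :
    Words.ofBasis P deg b x ∈ Words.gr P deg Empty n :=
  GMod.map_mem_of_basis (W := (Words.alg P deg).toGMod) b hb (fun i =>
    (congrArg (· ∈ Words.gr P deg Empty (deg i)) (Words.ofBasis_basis b i)).mpr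
      (Words.letter_mem i)) hx

/-- The free algebra on the letters is the free algebra on the vector space with the letters as
basis. -/
def Words.toSchur : Words P deg Empty →ₗ[k] Schur P V :=
  Words.lift P deg (fun n l =>
    { toFun := fun μ => Schur.mk (P.map (Equiv.sumEmpty (Fin n) Empty) μ) (b ∘ l)
      map_add' := fun x y => by rw [map_add, map_add, add_apply]
      map_smul' := fun r x => by rw [map_smul, map_smul, smul_apply, RingHom.id_apply] })
    (by
      intro n l μ σ
      have h := Schur.mk_map σ (P.map (Equiv.sumEmpty (Fin n) Empty) μ) (v := b ∘ l)
        fun i => hb (l i)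
      rw [P.map_map] at h
      change Schur.mk (P.map _ (P.map _ μ)) (b ∘ l) = koszulSign σ (deg ∘ l) •
        Schur.mk (P.map (Equiv.sumEmpty (Fin n) Empty) μ) ((b ∘ l) ∘ σ)
      rw [P.map_map, ← P.map_congr (e := (Equiv.sumEmpty (Fin n) Empty).trans σ)]
      · exact h
      · rintro (_ | _) <;> first | contradiction | rfl)

theorem Words.toSchur_monomial {n : ℕ} (l : Fin n → β) (μ : P.obj (Fin n)) :
    Words.toSchur b hb (Words.monomial l μ) = Schur.mk μ (b ∘ l) := by
  refine (Words.lift_word P deg _ _ l _).trans ?_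
  change Schur.mk (P.map _ (P.map _ μ)) (b ∘ l) = _
  rw [P.map_map, P.map_eq_self (by simp)]

/-- Both sides are multilinear in v, so it suffices to take basis vectors, where the action on
letters is a monomial. -/
theorem Words.toSchur_act {n : ℕ} (μ : P.obj (Fin n)) (v : Fin n → V) :
    Words.toSchur b hb ((Words.alg P deg).act n μ (Words.ofBasis P deg b ∘ v)) =
      Schur.mk μ v := by
  have key : (Words.toSchur b hb).compMultilinearMap (((Words.alg P deg).act n μ).compLinearMap
      fun _ => Words.ofBasis P deg b) = Schur.mk μ := by
    refine Module.Basis.ext_multilinear (fun _ => b) fun l => ?_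
    have h := Words.alg_act_letter (P := P) (deg := deg) l μ
    change Words.toSchur b hb ((Words.alg P deg).act n μ
      fun i => Words.ofBasis P deg b (b (l i))) = Schur.mk μ (b ∘ l)
    rw [← Words.toSchur_monomial b hb, ← h]
    congr 2
    exact funext fun i => Words.ofBasis_basis b _
  exact congrArg (fun f => f v) key

theorem Words.induction_monomial {p : Words P deg Empty → Prop}
    (monomial : ∀ (n : ℕ) (l : Fin n → β) (q : ℤ) (μ : P.obj (Fin n)),
      μ ∈ (P.obj (Fin n)).gr q → p (Words.monomial l μ))
    (zero : p 0) (add : ∀ x y, p x → p y → p (x + y)) (x : Words P deg Empty) : p x := by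
  induction x using Words.induction with
  | zero => exact zero
  | add x y hx hy => exact add x y hx hy
  | word n l q μ hμ =>
    have := monomial n l q (P.map (Equiv.sumEmpty (Fin n) Empty) μ) (P.map_mem _ hμ)
    rwa [Words.monomial, P.map_map, P.map_eq_self (by simp)] at this

theorem Words.extend_toSchur (C : P.Alg) (κ : V →ₗ[k] C)
    (hκ : ∀ {n : ℤ} {x : V}, x ∈ V.gr n → κ x ∈ C.gr n) (x : Words P deg Empty) :
    C.extend κ hκ (Words.toSchur b hb x) =
      Words.toAlg C.graded (fun i => κ (b i)) (fun i => hκ (hb i)) x := by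
  induction x using Words.induction_monomial with
  | monomial n l q μ hμ =>
    rw [Words.toSchur_monomial, C.extend_mk, Words.toAlg_monomial]
    rfl
  | zero => simp
  | add x y hx hy => simp only [map_add, hx, hy]

/-- The inverse of `Words.toSchur`. -/
def Words.ofSchur : Schur P V →ₗ[k] Words P deg Empty :=
  Operad.Alg.extend (P := P.forget) (Words.alg P deg) (Words.ofBasis P deg b)
    (Words.ofBasis_mem b hb)

theorem Words.ofSchur_mk {n : ℕ} (μ : P.obj (Fin n)) (v : Fin n → V) :
    Words.ofSchur b hb (Schur.mk μ v) =
      (Words.alg P deg).act n μ (Words.ofBasis P deg b ∘ v) :=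
  Operad.Alg.extend_mk (P := P.forget) _ _ _ μ v

theorem Words.toSchur_ofSchur (x : Schur P V) :
    Words.toSchur (deg := deg) b hb (Words.ofSchur b hb x) = x := by
  have : Words.toSchur (P := P) (deg := deg) b hb ∘ₗ Words.ofSchur b hb = LinearMap.id := by
    refine Schur.hom_ext fun n μ => MultilinearMap.ext fun v => ?_
    simp only [LinearMap.compMultilinearMap_apply, LinearMap.comp_apply, LinearMap.id_apply]
    rw [Words.ofSchur_mk, Words.toSchur_act]
  exact congrArg (fun f => f x) this

theorem Words.ofSchur_toSchur (x : Words P deg Empty) :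
    Words.ofSchur b hb (Words.toSchur b hb x) = x := by
  induction x using Words.induction_monomial with
  | monomial n l q μ hμ =>
    rw [Words.toSchur_monomial, Words.ofSchur_mk, ← Words.alg_act_letter]
    congr 1
    funext i
    exact Words.ofBasis_basis b _
  | zero => simp
  | add x y hx hy => simp only [map_add, hx, hy]

theorem Words.toAlg_bijective (C : P.Alg) (κ : V →ₗ[k] C)
    (hκ : ∀ {n : ℤ} {x : V}, x ∈ V.gr n → κ x ∈ C.gr n)
    (h : Function.Bijective (C.extend κ hκ)) :
    Function.Bijective (Words.toAlg (deg := deg) C.graded (fun i => κ (b i))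
      fun i => hκ (hb i)) := by
  have e : ⇑(Words.toAlg (deg := deg) C.graded (fun i => κ (b i)) fun i => hκ (hb i)) =
      C.extend κ hκ ∘ Words.toSchur b hb :=
    funext fun x => (Words.extend_toSchur b hb C κ hκ x).symm
  rw [e]
  refine h.comp ⟨?_, fun x => ⟨_, Words.toSchur_ofSchur b hb x⟩⟩
  exact (Function.LeftInverse.injective (Words.ofSchur_toSchur b hb))

end schur

/-! # Weights of words -/

theorem Submodule.mem_of_eq {k M : Type*} [CommRing k] [AddCommGroup M] [Module k M]
    {p : Submodule k M} {x y : M} (h : x = y) (hy : y ∈ p) : x ∈ p := h ▸ hy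

theorem map_single_apply {k Γ M N : Type*} [CommRing k] [AddCommGroup M] [Module k M]
    [AddCommGroup N]
    [Module k N] (f : M →ₗ[k] N) (γ γ' : Γ) (x : M) :
    f (Finsupp.single γ x γ') = Finsupp.single γ (f x) γ' := by
  classical
  rw [Finsupp.single_apply, Finsupp.single_apply]
  split_ifs
  · rfl
  · exact map_zero f

/-- The term with the differential of μ cancels: the difference of two differentials on the same
free algebra sees only the difference of their values on the letters. -/
theorem Operad.Alg.leibniz_sub {k : Type u} [CommRing k] {P : Operad k} (C : P.forget.Alg) {n : ℕ}
    (μ : P.obj (Fin n)) {q : Fin n → ℤ} {a : Fin n → C} (ha : ∀ i, a i ∈ C.gr (q i))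
    (b b' : Fin n → C) :
    C.leibniz μ a b - C.leibniz μ a b' = ∑ i, (∑ j, if j < i then q j else 0).negOnePow •
      C.act n ((P.obj (Fin n)).sgn μ) (Function.update a i (b i - b' i)) := by
  rw [C.leibniz_eq μ ha, C.leibniz_eq μ ha, add_sub_add_left_eq_sub, ← Finset.sum_sub_distrib]
  refine Finset.sum_congr rfl fun i _ => ?_
  rw [MultilinearMap.map_update_sub, smul_sub]

section weight
variable {k : Type u} [CommRing k] {P : Operad k} {β : Type u} {deg : β → ℤ}
variable {S T : Type} [Finite S] [Finite T] {Γ : Type*} [AddCommMonoid Γ] (w : β → Γ)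

variable (P deg S) in
/-- The span of the words with weight in `p`; the weights of letters add up. -/
def Words.weighted (p : Set Γ) : Submodule k (Words P deg S) :=
  Submodule.span k {x | ∃ (n : ℕ) (l : Fin n → β) (μ : P.obj (Fin n ⊕ S)),
    ∑ i, w (l i) ∈ p ∧ x = word P deg l μ}

variable {w}

theorem Words.word_mem_weighted {p : Set Γ} {n : ℕ} {l : Fin n → β} (h : ∑ i, w (l i) ∈ p)
    (μ : P.obj (Fin n ⊕ S)) : word P deg l μ ∈ weighted P deg S w p :=
  Submodule.subset_span ⟨n, l, μ, h, rfl⟩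

theorem Words.wordOf_mem_weighted {A : Type} [Fintype A] {p : Set Γ} {n : ℕ} (e : A ≃ Fin n)
    {l : A → β} (h : ∑ t, w (l t) ∈ p) (μ : P.obj (A ⊕ S)) :
    wordOf P deg e l μ ∈ weighted P deg S w p := by
  refine word_mem_weighted ?_ _
  rwa [← e.symm.sum_comp] at h

theorem Words.weighted_mono {p q : Set Γ} (h : p ⊆ q) :
    weighted P deg S w p ≤ weighted P deg S w q := by
  refine Submodule.span_mono ?_
  rintro _ ⟨n, l, μ, hl, rfl⟩
  exact ⟨n, l, μ, h hl, rfl⟩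

theorem Words.map_mem_weighted (g : S ≃ T) {p : Set Γ} {x : Words P deg S}
    (hx : x ∈ weighted P deg S w p) : Words.map P deg g x ∈ weighted P deg T w p := by
  have : weighted P deg S w p ≤ (weighted P deg T w p).comap (Words.map P deg g) := by
    refine Submodule.span_le.2 ?_
    rintro _ ⟨n, l, μ, hl, rfl⟩
    rw [SetLike.mem_coe, Submodule.mem_comap, map_word]
    exact word_mem_weighted hl _
  exact this hx

theorem Words.comp_mem_weighted {p q : Set Γ} {x : Words P deg (Option S)} {y : Words P deg T}
    (hx : x ∈ weighted P deg (Option S) w p) (hy : y ∈ weighted P deg T w q) :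
    Words.comp P deg x y ∈ weighted P deg (T ⊕ S) w (Set.image2 (· + ·) p q) := by
  have h : ∀ x ∈ weighted P deg (Option S) w p, weighted P deg T w q ≤
      (weighted P deg (T ⊕ S) w (Set.image2 (· + ·) p q)).comap (Words.comp P deg x) := by
    intro x hx
    refine Submodule.span_le.2 ?_
    rintro _ ⟨m, v, ν, hv, rfl⟩
    have h' : weighted P deg (Option S) w p ≤
        (weighted P deg (T ⊕ S) w (Set.image2 (· + ·) p q)).comap
          ((Words.comp P deg).flip (word P deg v ν)) := by
      refine Submodule.span_le.2 ?_
      rintro _ ⟨n, l, μ, hl, rfl⟩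
      rw [SetLike.mem_coe, Submodule.mem_comap, LinearMap.flip_apply]
      induction ν using (P.obj (Fin m ⊕ T)).toGMod.induction_gr with
      | hom r ν hν =>
        rw [comp_word l v μ hν]
        refine unitsSmul_mem _ (wordOf_mem_weighted _ ?_ _)
        rw [Fintype.sum_sum_type, add_comm]
        exact ⟨_, hl, _, hv, rfl⟩
      | zero => simp
      | add ν ν' h h' =>
        rw [map_add, map_add]
        exact add_mem h h'
    exact h' hx
  exact h x hx hy

theorem Words.plug_mem_weighted {p q : Set Γ} {x : Words P deg (Option S)}
    {a : Words P deg Empty} (hx : x ∈ weighted P deg (Option S) w p)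
    (ha : a ∈ weighted P deg Empty w q) :
    Words.plug P deg x a ∈ weighted P deg S w (Set.image2 (· + ·) p q) :=
  map_mem_weighted _ (comp_mem_weighted hx ha)

theorem Words.act_mem_weighted {n : ℕ} {p r : Set Γ} {q : Fin n → Set Γ}
    {x : Words P deg (Fin n)} {a : Fin n → Words P deg Empty}
    (hx : x ∈ weighted P deg (Fin n) w p) (ha : ∀ i, a i ∈ weighted P deg Empty w (q i))
    (hr : ∀ g₀ ∈ p, ∀ g : Fin n → Γ, (∀ i, g i ∈ q i) → g₀ + ∑ i, g i ∈ r) :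
    Words.act P deg n x a ∈ weighted P deg Empty w r := by
  induction n generalizing p with
  | zero =>
    rw [act_zero]
    refine map_mem_weighted _ (weighted_mono (fun g hg => ?_) hx)
    simpa using hr g hg Fin.elim0 fun i => i.elim0
  | succ n ih =>
    rw [act_succ]
    refine ih (plug_mem_weighted (map_mem_weighted _ hx) (ha 0)) (fun i => ha i.succ) ?_
    rintro _ ⟨g₀, hg₀, g₁, hg₁, rfl⟩ g hg
    have := hr g₀ hg₀ (Fin.cons g₁ g) (Fin.cases hg₁ hg)
    rwa [Fin.sum_univ_succ, Fin.cons_zero, ← add_assoc] at this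

theorem Words.alg_act_mem_weighted {n : ℕ} {r : Set Γ} {q : Fin n → Set Γ}
    (μ : P.obj (Fin n)) {a : Fin n → Words P deg Empty}
    (ha : ∀ i, a i ∈ weighted P deg Empty w (q i))
    (hr : ∀ g : Fin n → Γ, (∀ i, g i ∈ q i) → ∑ i, g i ∈ r) :
    (Words.alg P deg).act n μ a ∈ weighted P deg Empty w r := by
  refine act_mem_weighted (p := {0}) (word_mem_weighted ?_ _) ha ?_
  · simp
  · rintro _ rfl g hg
    rw [zero_add]
    exact hr g hg

theorem Words.letter_mem_weighted (b : β) :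
    letter P deg b ∈ weighted P deg Empty w {w b} :=
  wordOf_mem_weighted _ (by simp) _

theorem Words.monomial_mem_weighted {p : Set Γ} {n : ℕ} {l : Fin n → β}
    (h : ∑ i, w (l i) ∈ p) (μ : P.obj (Fin n)) :
    monomial (deg := deg) l μ ∈ weighted P deg Empty w p := word_mem_weighted h _

theorem Words.weighted_induction {p : Set Γ} {M : Submodule k (Words P deg Empty)}
    (h : ∀ (n : ℕ) (l : Fin n → β) (μ : P.obj (Fin n)), ∑ i, w (l i) ∈ p →
      (Words.alg P deg).act n μ (fun i => letter P deg (l i)) ∈ M) :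
    weighted P deg Empty w p ≤ M := by
  refine Submodule.span_le.2 ?_
  rintro _ ⟨n, l, μ, hl, rfl⟩
  have := h n l (P.map (Equiv.sumEmpty (Fin n) Empty) μ) hl
  rwa [Words.alg_act_letter, monomial, P.map_map, P.map_eq_self (by simp)] at this

variable (w) in
/-- The decomposition into components of constant weight. -/
def Words.decomp : Words P deg Empty →ₗ[k] (Γ →₀ Words P deg Empty) :=
  Words.lift P deg (fun _ l => Finsupp.lsingle (∑ i, w (l i)) ∘ₗ word P deg l) (by
    intro n l μ σ
    have h : ∑ i, w ((l ∘ σ) i) = ∑ i, w (l i) := Equiv.sum_comp σ fun i => w (l i)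
    rw [LinearMap.comp_apply, LinearMap.comp_apply, word_map, map_unitsSmul, h])

theorem Words.decomp_of_mem {γ : Γ} {x : Words P deg Empty}
    (hx : x ∈ weighted P deg Empty w {γ}) : decomp w x = Finsupp.single γ x := by
  have : weighted P deg Empty w {γ} ≤
      LinearMap.eqLocus (decomp w) (Finsupp.lsingle γ : _ →ₗ[k] (Γ →₀ Words P deg Empty)) := by
    refine Submodule.span_le.2 ?_
    rintro _ ⟨n, l, μ, hl, rfl⟩
    rw [Set.mem_singleton_iff] at hl
    rw [SetLike.mem_coe, LinearMap.mem_eqLocus, decomp, lift_word, hl]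
    rfl
  exact this hx

theorem Words.decomp_apply_mem (γ : Γ) (x : Words P deg Empty) :
    decomp w x γ ∈ weighted P deg Empty w {γ} := by
  classical
  induction x using Words.induction with
  | word n l q μ hμ =>
    rw [decomp, lift_word, LinearMap.comp_apply, Finsupp.lsingle_apply, Finsupp.single_apply]
    split_ifs with h
    · exact word_mem_weighted h _
    · exact zero_mem _
  | zero => simp
  | add x y hx hy =>
    rw [map_add]
    exact add_mem hx hy

theorem Words.sum_decomp (x : Words P deg Empty) : (decomp w x).sum (fun _ y => y) = x := by
  classical
  have : Finsupp.lsum k (fun _ : Γ => (LinearMap.id : Words P deg Empty →ₗ[k] _)) ∘ₗ decomp w =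
      LinearMap.id := by
    refine Words.hom_ext P deg fun n l μ => ?_
    rw [LinearMap.comp_apply, decomp, lift_word, LinearMap.comp_apply, Finsupp.lsingle_apply,
      Finsupp.lsum_single]
  exact congrArg (fun f => f x) this

theorem Words.decomp_apply_eq_zero {p : Set Γ} {x : Words P deg Empty}
    (hx : x ∈ weighted P deg Empty w p) {γ : Γ} (hγ : γ ∉ p) : decomp w x γ = 0 := by
  classical
  have : weighted P deg Empty w p ≤ LinearMap.ker (Finsupp.lapply (R := k) γ ∘ₗ decomp w) := by
    refine Submodule.span_le.2 ?_
    rintro _ ⟨n, l, μ, hl, rfl⟩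
    rw [SetLike.mem_coe, LinearMap.mem_ker, LinearMap.comp_apply, decomp, lift_word,
      LinearMap.comp_apply, Finsupp.lsingle_apply, Finsupp.lapply_apply,
      Finsupp.single_eq_of_ne]
    rintro rfl
    exact hγ hl
  exact this hx

theorem Words.mem_weighted {p : Set Γ} {x : Words P deg Empty}
    (h : ∀ γ, decomp w x γ ≠ 0 → γ ∈ p) : x ∈ weighted P deg Empty w p := by
  rw [← sum_decomp (w := w) x]
  refine sum_mem fun γ hγ => ?_
  exact weighted_mono (Set.singleton_subset_iff.2 (h γ (Finsupp.mem_support_iff.1 hγ)))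
    (decomp_apply_mem γ x)

theorem Words.decomp_map {f : Words P deg Empty →ₗ[k] Words P deg Empty}
    (hf : ∀ γ, ∀ x ∈ weighted P deg Empty w {γ}, f x ∈ weighted P deg Empty w {γ}) (γ : Γ)
    (x : Words P deg Empty) : decomp w (f x) γ = f (decomp w x γ) := by
  classical
  induction x using Words.induction with
  | word n l q μ hμ =>
    have h : word P deg l μ ∈ weighted P deg Empty w {∑ i, w (l i)} := word_mem_weighted
      (Set.mem_singleton _) μ
    have h' := map_single_apply f (∑ i, w (l i)) γ (word P deg l μ)
    rw [← decomp_of_mem h, ← decomp_of_mem (hf _ _ h)] at h'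
    exact h'.symm
  | zero => simp
  | add x y hx hy => simp only [map_add, Finsupp.add_apply, hx, hy]

end weight

/-! ### Derivations and weights -/

section deriv
variable {k : Type u} [CommRing k] {P : Operad k} {β : Type u} {deg : β → ℤ}
variable {Γ : Type*} [AddCommMonoid Γ] {w : β → Γ}

theorem Words.update_letter_mem_weighted {n : ℕ} (l : Fin n → β) (i : Fin n) {p : Set Γ}
    {x : Words P deg Empty} (hx : x ∈ weighted P deg Empty w p) (j : Fin n) :
    Function.update (fun i => letter P deg (l i)) i x j ∈
      weighted P deg Empty w (Function.update (fun i => ({w (l i)} : Set Γ)) i p j) := by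
  by_cases h : j = i
  · subst h
    simpa using hx
  · simpa [h] using letter_mem_weighted (l j)

theorem Words.deriv_mem_weighted {δ : β → Words P deg Empty}
    (hδ : ∀ b, δ b ∈ Words.gr P deg Empty (deg b + 1))
    (hw : ∀ b, δ b ∈ weighted P deg Empty w {w b}) {γ : Γ} {x : Words P deg Empty}
    (hx : x ∈ weighted P deg Empty w {γ}) : deriv δ hδ x ∈ weighted P deg Empty w {γ} := by
  refine (weighted_induction (M := (weighted P deg Empty w {γ}).comap (deriv δ hδ)) ?_) hx
  intro n l μ hl
  rw [Set.mem_singleton_iff] at hl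
  have hd : ∀ i, (deriv δ hδ ∘ fun i => letter P deg (l i)) i = δ (l i) := fun i =>
    deriv_letter δ hδ _
  change deriv δ hδ ((Words.alg P deg).act n μ fun i => letter P deg (l i)) ∈
    weighted P deg Empty w {γ}
  rw [deriv_act,
    (Words.alg P deg).leibniz_eq (q := fun i => deg (l i)) μ fun i => letter_mem (l i)]
  refine add_mem (alg_act_mem_weighted _ (fun i => letter_mem_weighted (l i)) fun g hg => ?_)
    (sum_mem fun i _ => unitsSmul_mem _ (alg_act_mem_weighted _
      (update_letter_mem_weighted l i (hd i ▸ hw (l i))) fun g hg => ?_))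
  · rw [Set.mem_singleton_iff, ← hl]
    exact Finset.sum_congr rfl fun i _ => hg i
  · rw [Set.mem_singleton_iff, ← hl]
    refine Finset.sum_congr rfl fun j _ => ?_
    have := hg j
    by_cases h : j = i
    · subst h
      simpa using this
    · simpa [h] using this

/-- Each term of the difference replaces one letter of a monomial by something strictly lighter.
Since addition is strictly monotone, the total weight drops strictly. -/
theorem Words.deriv_sub_mem_weighted [LinearOrder Γ] [IsOrderedCancelAddMonoid Γ]
    {δ δ' : β → Words P deg Empty}
    (hδ : ∀ b, δ b ∈ Words.gr P deg Empty (deg b + 1))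
    (hδ' : ∀ b, δ' b ∈ Words.gr P deg Empty (deg b + 1))
    (hw : ∀ b, δ b - δ' b ∈ weighted P deg Empty w (Set.Iio (w b))) {γ : Γ}
    {x : Words P deg Empty} (hx : x ∈ weighted P deg Empty w {γ}) :
    deriv δ hδ x - deriv δ' hδ' x ∈ weighted P deg Empty w (Set.Iio γ) := by
  refine (weighted_induction (M := (weighted P deg Empty w (Set.Iio γ)).comap
    (deriv δ hδ - deriv δ' hδ')) ?_) hx
  intro n l μ hl
  rw [Set.mem_singleton_iff] at hl
  have hd : ∀ i, (deriv δ hδ ∘ fun i => letter P deg (l i)) i = δ (l i) := fun i =>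
    deriv_letter δ hδ _
  have hd' : ∀ i, (deriv δ' hδ' ∘ fun i => letter P deg (l i)) i = δ' (l i) := fun i =>
    deriv_letter δ' hδ' _
  have hl' : ∀ i, letter P deg (l i) ∈ (Words.alg P deg).gr (deg (l i)) := fun i =>
    letter_mem (l i)
  have e : deriv δ hδ ((Words.alg P deg).act n μ fun i => letter P deg (l i)) -
      deriv δ' hδ' ((Words.alg P deg).act n μ fun i => letter P deg (l i)) =
      ∑ i, (∑ j, if j < i then deg (l j) else 0).negOnePow •
        (Words.alg P deg).act n ((P.obj (Fin n)).sgn μ)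
          (Function.update (fun i => letter P deg (l i)) i (δ (l i) - δ' (l i))) := by
    rw [deriv_act, deriv_act]
    refine ((Words.alg P deg).leibniz_sub μ hl' _ _).trans ?_
    refine Finset.sum_congr rfl fun i _ => ?_
    congr 3
    exact congrArg₂ (· - ·) (hd i) (hd' i)
  have hm : ∀ i, (Words.alg P deg).act n ((P.obj (Fin n)).sgn μ)
      (Function.update (fun i => letter P deg (l i)) i (δ (l i) - δ' (l i))) ∈
        weighted P deg Empty w (Set.Iio γ) := fun i => by
    refine alg_act_mem_weighted _ (update_letter_mem_weighted l i (hw (l i))) fun g hg => ?_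
    rw [Set.mem_Iio, ← hl]
    have hg' : ∀ j, j ≠ i → g j = w (l j) := fun j h => by simpa [h] using hg j
    refine Finset.sum_lt_sum (fun j _ => ?_) ⟨i, Finset.mem_univ i, by simpa using hg i⟩
    by_cases h : j = i
    · subst h
      exact le_of_lt (by simpa using hg j)
    · exact (hg' j h).le
  exact Submodule.mem_of_eq (p := weighted P deg Empty w (Set.Iio γ)) e
    (sum_mem fun i _ => unitsSmul_mem _ (hm i))

theorem Words.toAlg_mem_weighted {β' : Type u} {deg' : β' → ℤ} {w' : β' → Γ}
    {κ : β → Words P deg' Empty} (hκ : ∀ b, κ b ∈ Words.gr P deg' Empty (deg b))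
    (hw : ∀ b, κ b ∈ weighted P deg' Empty w' {w b}) {p : Set Γ} {x : Words P deg Empty}
    (hx : x ∈ weighted P deg Empty w p) :
    toAlg (Words.alg P deg') κ hκ x ∈ weighted P deg' Empty w' p := by
  refine (weighted_induction (M := (weighted P deg' Empty w' p).comap
    (toAlg (Words.alg P deg') κ hκ)) ?_) hx
  intro n l μ hl
  have hm : (Words.alg P deg').act n μ
      (toAlg (Words.alg P deg') κ hκ ∘ fun i => letter P deg (l i)) ∈
        weighted P deg' Empty w' p := by
    refine alg_act_mem_weighted (q := fun i => {w (l i)}) _ (fun i => ?_) fun g hg => ?_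
    · have := hw (l i)
      rwa [← toAlg_letter (Words.alg P deg') κ hκ (l i)] at this
    · rw [Finset.sum_congr rfl fun i _ => Set.mem_singleton_iff.1 (hg i)]
      exact hl
  exact Submodule.mem_of_eq (p := weighted P deg' Empty w' p)
    (toAlg_act (Words.alg P deg') κ hκ μ _) hm

/-- Acyclicity of the kernel of an idempotent endomorphism of a quasi-free algebra, from the
acyclicity for the part of the differential that preserves the weights. -/
theorem Words.exists_deriv_eq [LinearOrder Γ] [IsOrderedCancelAddMonoid Γ] [WellFoundedLT Γ]
    {δ δ' : β → Words P deg Empty}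
    (hδ : ∀ b, δ b ∈ Words.gr P deg Empty (deg b + 1))
    (hδ' : ∀ b, δ' b ∈ Words.gr P deg Empty (deg b + 1))
    (hw : ∀ b, δ' b ∈ weighted P deg Empty w {w b})
    (hlt : ∀ b, δ b - δ' b ∈ weighted P deg Empty w (Set.Iio (w b)))
    (hd : ∀ x, deriv δ hδ (deriv δ hδ x) = 0)
    (ρ : Words P deg Empty →ₗ[k] Words P deg Empty)
    (hρw : ∀ γ, ∀ x ∈ weighted P deg Empty w {γ}, ρ x ∈ weighted P deg Empty w {γ})
    (hρ : ∀ x, ρ (ρ x) = ρ x) (hρd : ∀ x, ρ (deriv δ hδ x) = deriv δ hδ (ρ x))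
    (hρd' : ∀ x, ρ (deriv δ' hδ' x) = deriv δ' hδ' (ρ x))
    (hac : ∀ x, deriv δ' hδ' x = 0 → ρ x = 0 → ∃ y, deriv δ' hδ' y = x)
    (x : Words P deg Empty) (hx : deriv δ hδ x = 0) (hx' : ρ x = 0) :
    ∃ y, deriv δ hδ y = x := by
  have key : ∀ γ : Γ, ∀ x ∈ weighted P deg Empty w (Set.Iic γ), deriv δ hδ x = 0 → ρ x = 0 →
      ∃ y, deriv δ hδ y = x := by
    intro γ
    induction γ using WellFoundedLT.induction with
    | ind γ ih =>
      intro x hxγ hx hx'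
      have hdw : ∀ γ, ∀ x ∈ weighted P deg Empty w {γ},
          deriv δ' hδ' x ∈ weighted P deg Empty w {γ} := fun γ x hx =>
        deriv_mem_weighted hδ' hw hx
      have hlow : ∀ x ∈ weighted P deg Empty w (Set.Iic γ),
          deriv δ hδ x - deriv δ' hδ' x ∈ weighted P deg Empty w (Set.Iio γ) := by
        intro x hx
        change (deriv δ hδ - deriv δ' hδ') x ∈ _
        rw [← sum_decomp (w := w) x, Finsupp.sum, map_sum]
        refine sum_mem fun γ' hγ' => ?_
        have hle : γ' ≤ γ := by
          by_contra h
          exact Finsupp.mem_support_iff.1 hγ' (decomp_apply_eq_zero hx h)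
        exact weighted_mono (Set.Iio_subset_Iio hle)
          (deriv_sub_mem_weighted hδ hδ' hlt (decomp_apply_mem γ' x))
      -- Since x is a cocycle for δ, its differential for δ' is minus the difference of the two
      -- differentials and has no component of weight γ.
      have h1 : deriv δ' hδ' (decomp w x γ) = 0 := by
        rw [← decomp_map hdw]
        have := decomp_apply_eq_zero (hlow x hxγ) (lt_irrefl γ)
        rwa [hx, zero_sub, map_neg, Finsupp.neg_apply, neg_eq_zero] at this
      have h2 : ρ (decomp w x γ) = 0 := by
        rw [← decomp_map hρw, hx', map_zero, Finsupp.zero_apply]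
      obtain ⟨y, hy⟩ := hac _ h1 h2
      have hy1 : deriv δ' hδ' (decomp w y γ) = decomp w x γ := by
        rw [← decomp_map hdw, hy, decomp_of_mem (decomp_apply_mem γ x), Finsupp.single_eq_same]
      -- Moves the primitive of the leading component into the kernel of ρ. Its differential for δ'
      -- is unchanged, because ρ kills the leading component and commutes with that differential.
      set z := decomp w y γ - ρ (decomp w y γ) with hz
      have hzγ : z ∈ weighted P deg Empty w {γ} :=
        sub_mem (decomp_apply_mem γ y) (hρw γ _ (decomp_apply_mem γ y))
      have hz1 : deriv δ' hδ' z = decomp w x γ := by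
        rw [hz, map_sub, ← hρd', hy1, h2, sub_zero]
      have hz2 : ρ z = 0 := by
        rw [hz, map_sub, hρ, sub_self]
      have hd1 : deriv δ hδ (x - deriv δ hδ z) = 0 := by rw [map_sub, hx, hd, sub_zero]
      have hr1 : ρ (x - deriv δ hδ z) = 0 := by
        rw [map_sub, hx', hρd, hz2, map_zero, sub_zero]
      -- The correction cancels the leading component of x up to terms of lower weight.
      have hxz : x - deriv δ hδ z ∈ weighted P deg Empty w (Set.Iio γ) := by
        have e : x - deriv δ hδ z =
            (x - decomp w x γ) - (deriv δ hδ z - deriv δ' hδ' z) := by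
          rw [hz1]; abel
        rw [e]
        refine sub_mem (mem_weighted fun γ' h => ?_) (deriv_sub_mem_weighted hδ hδ' hlt hzγ)
        rw [map_sub, Finsupp.sub_apply, decomp_of_mem (decomp_apply_mem γ x)] at h
        rcases lt_trichotomy γ' γ with h' | h' | h'
        · exact h'
        · subst h'
          rw [Finsupp.single_eq_same, sub_self] at h
          exact absurd rfl h
        · rw [Finsupp.single_eq_of_ne h'.ne', decomp_apply_eq_zero hxγ (not_le.2 h'),
            sub_zero] at h
          exact absurd rfl h
      -- A nonzero remainder has finitely many weights, all below γ; the largest one is the bound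
      -- for the induction hypothesis.
      by_cases h0 : decomp w (x - deriv δ hδ z) = 0
      · refine ⟨z, ?_⟩
        have := sum_decomp (w := w) (x - deriv δ hδ z)
        rw [h0, Finsupp.sum_zero_index] at this
        exact (sub_eq_zero.1 this.symm).symm
      · have hne : (decomp w (x - deriv δ hδ z)).support.Nonempty :=
          Finsupp.support_nonempty_iff.2 h0
        have hmem := Finset.max'_mem _ hne
        have hmax : (decomp w (x - deriv δ hδ z)).support.max' hne < γ := by
          by_contra h
          exact Finsupp.mem_support_iff.1 hmem (decomp_apply_eq_zero hxz h)
        obtain ⟨y', hy'⟩ := ih _ hmax (x - deriv δ hδ z)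
          (mem_weighted fun γ' h => Finset.le_max' _ _ (Finsupp.mem_support_iff.2 h)) hd1 hr1
        exact ⟨y' + z, by rw [map_add, hy', sub_add_cancel]⟩
  by_cases h0 : decomp w x = 0
  · refine ⟨0, ?_⟩
    rw [map_zero, ← sum_decomp (w := w) x, h0, Finsupp.sum_zero_index]
  · have hne : (decomp w x).support.Nonempty := Finsupp.support_nonempty_iff.2 h0
    exact key ((decomp w x).support.max' hne) x
      (mem_weighted fun γ' h => Finset.le_max' _ _ (Finsupp.mem_support_iff.2 h)) hx hx'

end deriv

/-! # Morphisms of graded algebras -/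

section graded
variable {k : Type u} [CommRing k] {P : Operad k}

/-- A morphism of the underlying graded algebras. -/
structure GradedHom (A C : P.forget.Alg) where
  toLin : A →ₗ[k] C
  map_mem : ∀ {n : ℤ} {x : A}, x ∈ A.gr n → toLin x ∈ C.gr n
  map_act : ∀ (n : ℕ) (μ : P.obj (Fin n)) (a : Fin n → A),
    toLin (A.act n μ a) = C.act n μ (toLin ∘ a)

/-- The underlying morphism of graded algebras. -/
def Operad.Alg.Hom.gradedHom {A B : P.Alg} (f : A.Hom B) : GradedHom A.graded B.graded where
  toLin := f.toLin
  map_mem := f.map_mem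
  map_act := f.map_act

/-- `Words.toAlg`, as a morphism of graded algebras. -/
def Words.toGradedHom {β : Type u} {deg : β → ℤ} (C : P.forget.Alg) (κ : β → C)
    (hκ : ∀ b, κ b ∈ C.gr (deg b)) : GradedHom (Words.alg P deg) C where
  toLin := Words.toAlg C κ hκ
  map_mem := Words.toAlg_mem C κ hκ
  map_act _ := Words.toAlg_act C κ hκ

namespace GradedHom

/-- Composition: first `f`, then `g`. -/
def comp {A B C : P.forget.Alg} (g : GradedHom B C) (f : GradedHom A B) : GradedHom A C where
  toLin := g.toLin ∘ₗ f.toLin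
  map_mem hx := g.map_mem (f.map_mem hx)
  map_act n μ a := by
    rw [LinearMap.comp_apply, f.map_act, g.map_act]
    rfl

variable {A B C : P.forget.Alg} {β : Type u} {deg : β → ℤ}

theorem ext_words (F G : GradedHom (Words.alg P deg) C)
    (h : ∀ j, F.toLin (Words.letter P deg j) = G.toLin (Words.letter P deg j))
    (x : Words P deg Empty) : F.toLin x = G.toLin x := by
  induction x using Words.alg_induction with
  | letter b => exact h b
  | zero => exact (map_zero F.toLin).trans (map_zero G.toLin).symm
  | add x y hx hy =>
    exact (map_add F.toLin x y).trans ((congrArg₂ (· + ·) hx hy).trans (map_add G.toLin x y).symm)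
  | act n r q μ a hμ ha ih =>
    refine (F.map_act n μ a).trans (Eq.trans ?_ (G.map_act n μ a).symm)
    congr 1
    exact funext ih

theorem map_toAlg (F : GradedHom A C) (κ : β → A) (hκ : ∀ j, κ j ∈ A.gr (deg j))
    (y : Words P deg Empty) :
    F.toLin (Words.toAlg A κ hκ y) =
      Words.toAlg C (fun j => F.toLin (κ j)) (fun j => F.map_mem (hκ j)) y := by
  induction y using Words.induction_monomial with
  | monomial n l q μ hμ =>
    rw [Words.toAlg_monomial, Words.toAlg_monomial, F.map_act]
    rfl
  | zero => simp
  | add x y hx hy => simp only [map_add, hx, hy]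

theorem eq_on_toAlg (F G : GradedHom A C) (κ : β → A) (hκ : ∀ j, κ j ∈ A.gr (deg j))
    (h : ∀ j, F.toLin (κ j) = G.toLin (κ j)) (y : Words P deg Empty) :
    F.toLin (Words.toAlg A κ hκ y) = G.toLin (Words.toAlg A κ hκ y) := by
  rw [F.map_toAlg, G.map_toAlg]
  simp only [h]

/-- Compatibility with differentials propagates from generators to the subalgebra generated by them.
Only that subalgebra is concerned, so that a morphism can be a chain map on the lower stages before
it is one everywhere. -/
theorem map_d_toAlg {A : P.Alg} (F : GradedHom A.graded C) (D : C →ₗ[k] C)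
    (hD : ∀ (n : ℕ) (μ : P.obj (Fin n)) (q : Fin n → ℤ) (a : Fin n → C),
      (∀ i, a i ∈ C.gr (q i)) → D (C.act n μ a) = C.leibniz μ a (D ∘ a))
    (κ : β → A) (hκ : ∀ j, κ j ∈ A.gr (deg j))
    (h : ∀ j, F.toLin (A.d (κ j)) = D (F.toLin (κ j))) (y : Words P deg Empty) :
    F.toLin (A.d (Words.toAlg A.graded κ hκ y)) = D (F.toLin (Words.toAlg A.graded κ hκ y)) := by
  induction y using Words.alg_induction with
  | letter b => rw [Words.toAlg_letter, h]
  | zero => simp only [map_zero]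
  | add x y hx hy => simp only [map_add, hx, hy]
  | act n r q μ a hμ ha ih =>
    have hm : ∀ i, (Words.toAlg A.graded κ hκ ∘ a) i ∈ A.gr (q i) := fun i =>
      Words.toAlg_mem A.graded κ hκ (ha i)
    have hm' : ∀ i, (F.toLin ∘ Words.toAlg A.graded κ hκ ∘ a) i ∈ C.gr (q i) := fun i =>
      F.map_mem (hm i)
    rw [Words.toAlg_act, F.map_act, hD n μ q _ hm']
    refine (congrArg F.toLin (A.d_act_eq_leibniz hμ hm)).trans ?_
    refine (Operad.Alg.map_leibniz F.toLin F.map_mem F.map_act μ _ _).trans ?_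
    congr 1
    exact funext ih

end GradedHom

namespace Operad.Alg
variable {β : Type u} {deg : β → ℤ}

theorem d_act_eq_leibniz' (C : P.Alg) {n : ℕ} (μ : P.obj (Fin n)) {q : Fin n → ℤ}
    {a : Fin n → C} (ha : ∀ i, a i ∈ C.gr (q i)) :
    C.d (C.act n μ a) = C.graded.leibniz μ a (C.d ∘ a) := by
  induction μ using (P.obj (Fin n)).toGMod.induction_gr with
  | hom p μ hμ => exact C.d_act_eq_leibniz hμ ha
  | zero => simp [leibniz]
  | add x y hx hy =>
    rw [map_add, add_apply, map_add, hx, hy]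
    simp only [leibniz, map_add, add_apply, Finset.sum_add_distrib]
    abel

/-- The subalgebra generated by homogeneous elements. -/
def generated (A : P.forget.Alg) (κ : β → A) (hκ : ∀ j, κ j ∈ A.gr (deg j)) : Submodule k A :=
  LinearMap.range (Words.toAlg A κ hκ)

variable {A : P.forget.Alg} {κ : β → A} {hκ : ∀ j, κ j ∈ A.gr (deg j)}

theorem mem_generated (j : β) : κ j ∈ A.generated κ hκ := ⟨_, Words.toAlg_letter A κ hκ j⟩

theorem act_mem_generated {n : ℕ} (μ : P.obj (Fin n)) {a : Fin n → A}
    (ha : ∀ i, a i ∈ A.generated κ hκ) : A.act n μ a ∈ A.generated κ hκ := by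
  choose y hy using ha
  refine ⟨(Words.alg P deg).act n μ y, ?_⟩
  rw [Words.toAlg_act]
  congr 1
  exact funext hy

theorem proj_mem_generated (n : ℤ) {x : A} (hx : x ∈ A.generated κ hκ) :
    A.proj n x ∈ A.generated κ hκ := by
  obtain ⟨y, rfl⟩ := hx
  exact ⟨(Words.alg P deg).proj n y, GMod.map_proj_zero (M := (Words.alg P deg).toGMod)
    (Words.toAlg A κ hκ) (Words.toAlg_mem A κ hκ) n y⟩

theorem generated_induction {p : A → Prop} (act : ∀ (n : ℕ) (l : Fin n → β) (μ : P.obj (Fin n)),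
      p (A.act n μ (κ ∘ l)))
    (zero : p 0) (add : ∀ x y, p x → p y → p (x + y)) {x : A} (hx : x ∈ A.generated κ hκ) :
    p x := by
  obtain ⟨y, rfl⟩ := hx
  induction y using Words.induction_monomial with
  | monomial n l q μ hμ => rw [Words.toAlg_monomial]; exact act n l μ
  | zero => rwa [map_zero]
  | add x y hx hy => rw [map_add]; exact add _ _ hx hy

end Operad.Alg

/-! ### Morphisms out of a free graded algebra -/

section free
variable {β : Type u} {deg : β → ℤ} {A : P.forget.Alg} {κ₀ : β → A}
  {hκ₀ : ∀ j, κ₀ j ∈ A.gr (deg j)} (h : Function.Bijective (Words.toAlg A κ₀ hκ₀))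

/-- The isomorphism from the free algebra. -/
def Words.equivOfFree : Words P deg Empty ≃ₗ[k] A := LinearEquiv.ofBijective _ h

theorem Words.equivOfFree_apply (y : Words P deg Empty) :
    Words.equivOfFree h y = Words.toAlg A κ₀ hκ₀ y := rfl

theorem Words.toAlg_equivOfFree_symm (x : A) :
    Words.toAlg A κ₀ hκ₀ ((Words.equivOfFree h).symm x) = x :=
  (Words.equivOfFree h).apply_symm_apply x

/-- The extension of a map of the generators of a free algebra. -/
def GradedHom.ofFree (C : P.forget.Alg) (κ : β → C) (hκ : ∀ j, κ j ∈ C.gr (deg j)) :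
    GradedHom A C where
  toLin := Words.toAlg C κ hκ ∘ₗ (Words.equivOfFree h).symm.toLinearMap
  map_mem {n x} hx := by
    refine Words.toAlg_mem C κ hκ ?_
    -- The inverse of a bijective map of degree zero preserves degrees, because the map commutes
    -- with the projections to the components.
    have e : (Words.equivOfFree h).symm x =
        (Words.alg P deg).proj n ((Words.equivOfFree h).symm x) := by
      refine h.injective ?_
      have := GMod.map_proj_zero (M := (Words.alg P deg).toGMod) (Words.toAlg A κ₀ hκ₀)
        (Words.toAlg_mem A κ₀ hκ₀) n ((Words.equivOfFree h).symm x)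
      refine (Words.toAlg_equivOfFree_symm h x).trans (Eq.trans ?_ this.symm)
      refine (A.proj_of_mem hx).symm.trans (congrArg (A.proj n) ?_)
      exact (Words.toAlg_equivOfFree_symm h x).symm
    exact Submodule.mem_of_eq (p := Words.gr P deg Empty n) e
      ((Words.alg P deg).proj_mem n _)
  map_act n μ a := by
    have e : (Words.equivOfFree h).symm (A.act n μ a) =
        (Words.alg P deg).act n μ ((Words.equivOfFree h).symm ∘ a) := by
      refine h.injective ?_
      refine (Words.toAlg_equivOfFree_symm h _).trans (Eq.trans ?_
        (Words.toAlg_act A κ₀ hκ₀ μ _).symm)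
      congr 1
      exact funext fun i => (Words.toAlg_equivOfFree_symm h (a i)).symm
    exact (congrArg (Words.toAlg C κ hκ) e).trans (Words.toAlg_act C κ hκ μ _)

theorem GradedHom.ofFree_apply (C : P.forget.Alg) (κ : β → C) (hκ : ∀ j, κ j ∈ C.gr (deg j))
    (j : β) : (GradedHom.ofFree h C κ hκ).toLin (κ₀ j) = κ j := by
  have e : (Words.equivOfFree h).symm (κ₀ j) = Words.letter P deg j := by
    rw [LinearEquiv.symm_apply_eq, Words.equivOfFree_apply, Words.toAlg_letter]
  refine (congrArg (Words.toAlg C κ hκ) e).trans ?_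
  rw [Words.toAlg_letter]

theorem GradedHom.ext_of_free (h : Function.Bijective (Words.toAlg A κ₀ hκ₀))
    {C : P.forget.Alg} (F G : GradedHom A C)
    (hFG : ∀ j, F.toLin (κ₀ j) = G.toLin (κ₀ j)) (x : A) : F.toLin x = G.toLin x := by
  obtain ⟨y, rfl⟩ := h.surjective x
  exact F.eq_on_toAlg G κ₀ hκ₀ hFG y

theorem GradedHom.map_d_of_free {A : P.Alg} {κ₀ : β → A}
    {hκ₀ : ∀ j, κ₀ j ∈ A.gr (deg j)} (h : Function.Bijective (Words.toAlg A.graded κ₀ hκ₀))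
    {C : P.forget.Alg} (F : GradedHom A.graded C) (D : C →ₗ[k] C)
    (hD : ∀ (n : ℕ) (μ : P.obj (Fin n)) (q : Fin n → ℤ) (a : Fin n → C),
      (∀ i, a i ∈ C.gr (q i)) → D (C.act n μ a) = C.leibniz μ a (D ∘ a))
    (hF : ∀ j, F.toLin (A.d (κ₀ j)) = D (F.toLin (κ₀ j))) (x : A) :
    F.toLin (A.d x) = D (F.toLin x) := by
  obtain ⟨y, rfl⟩ := h.surjective x
  exact F.map_d_toAlg D hD κ₀ hκ₀ hF y

end free
end graded

/-! # Cohomology -/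

section cohomology
variable {k M N : Type u} [CommRing k] [AddCommGroup M] [Module k M] [AddCommGroup N] [Module k N]
  {d : M →ₗ[k] M} {d' : N →ₗ[k] N}

theorem Cohomology.mk_eq_mk {z z' : LinearMap.ker d} :
    Cohomology.mk z = Cohomology.mk z' ↔ ∃ c, d c = (z : M) - z' := by
  rw [Cohomology.mk, Cohomology.mk, Submodule.Quotient.eq, Submodule.submoduleOf,
    Submodule.mem_comap, LinearMap.mem_range]
  rfl

theorem Cohomology.mk_surjective (c : Cohomology d) : ∃ z, Cohomology.mk z = c :=
  Submodule.Quotient.mk_surjective _ c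

theorem Cohomology.mk_eq_zero {z : LinearMap.ker d} :
    Cohomology.mk z = 0 ↔ ∃ c, d c = (z : M) := by
  have h : (Cohomology.mk (0 : LinearMap.ker d)) = 0 := rfl
  rw [← h, mk_eq_mk]
  simp

theorem Cohomology.map_mk (f : M →ₗ[k] N) (hf : ∀ x, f (d x) = d' (f x)) (z : LinearMap.ker d) :
    Cohomology.map f hf (Cohomology.mk z) = Cohomology.mk (d := d') ⟨f z, by
      rw [LinearMap.mem_ker, ← hf, z.2, map_zero]⟩ := rfl

/-- Brings quasi-isomorphisms into the elementwise form used in `IsQuasiIsoOn`. -/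
theorem Cohomology.map_bijective_iff (f : M →ₗ[k] N) (hf : ∀ x, f (d x) = d' (f x)) :
    Function.Bijective (Cohomology.map f hf) ↔
      (∀ x, d x = 0 → (∃ b, d' b = f x) → ∃ y, d y = x) ∧
      ∀ b, d' b = 0 → ∃ x, d x = 0 ∧ ∃ c, d' c = b - f x := by
  refine and_congr ?_ ?_
  · rw [injective_iff_map_eq_zero]
    constructor
    · intro h x hx hb
      have := h (Cohomology.mk ⟨x, hx⟩) (by rw [map_mk, mk_eq_zero]; exact hb)
      rwa [mk_eq_zero] at this
    · intro h c hc
      obtain ⟨z, rfl⟩ := mk_surjective c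
      rw [map_mk, mk_eq_zero] at hc
      rw [mk_eq_zero]
      exact h z z.2 hc
  · constructor
    · intro h b hb
      obtain ⟨c, hc⟩ := h (Cohomology.mk ⟨b, hb⟩)
      obtain ⟨z, rfl⟩ := mk_surjective c
      rw [map_mk, eq_comm, mk_eq_mk] at hc
      exact ⟨z, z.2, hc⟩
    · intro h c
      obtain ⟨z, rfl⟩ := mk_surjective c
      obtain ⟨x, hx, hc⟩ := h z z.2
      refine ⟨Cohomology.mk ⟨x, hx⟩, ?_⟩
      rw [map_mk, eq_comm, mk_eq_mk]
      exact hc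

theorem DGMod.Hom.isQuasiIso_of_homotopy {V : DGMod.{u} k} (e : V.Hom V) (s : V →ₗ[k] V)
    (hs : ∀ x, V.d (s x) + s (V.d x) = x - e.toLin x) : e.IsQuasiIso := by
  refine (Cohomology.map_bijective_iff _ _).2 ⟨?_, ?_⟩
  · rintro x hx ⟨b, hb⟩
    refine ⟨s x + b, ?_⟩
    have := hs x
    rw [hx, map_zero, add_zero] at this
    rw [map_add, this, hb, sub_add_cancel]
  · intro b hb
    refine ⟨b, hb, s b, ?_⟩
    have := hs b
    rwa [hb, map_zero, add_zero] at this

end cohomology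

/-! ### Free algebras on complexes of letters -/

section reflects
variable {k : Type u} [CommRing k] {P : Operad k} {β : Type u} {deg : β → ℤ}

/-- By hypothesis P(e) is injective on cohomology, so a cocycle of P(V) that it sends to zero is a
boundary. The identification of P(V) with words transports this statement; the derivation extends
the differential of V and includes the differential of P. -/
theorem Operad.ReflectsHomotopyEquivalences.exists_deriv_eq
    (hP : P.ReflectsHomotopyEquivalences) (V : DGMod.{u} k) (b : Module.Basis β k V)
    (hb : ∀ i, b i ∈ V.gr (deg i)) (e : V.Hom V) (he : e.IsQuasiIso)
    {δ : β → Words P deg Empty} (hδ : ∀ i, δ i ∈ Words.gr P deg Empty (deg i + 1))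
    (hδb : ∀ i, δ i = Words.ofBasis P deg b (V.d (b i)))
    {κ : β → Words P deg Empty} (hκ : ∀ i, κ i ∈ Words.gr P deg Empty (deg i))
    (hκb : ∀ i, κ i = Words.ofBasis P deg b (e.toLin (b i)))
    (x : Words P deg Empty) (hx : Words.deriv δ hδ x = 0)
    (hx' : Words.toAlg (Words.alg P deg) κ hκ x = 0) : ∃ y, Words.deriv δ hδ y = x := by
  have hι : ∀ v, Words.ofBasis P deg b (V.d v) = Words.deriv δ hδ (Words.ofBasis P deg b v) := by
    have : Words.ofBasis P deg b ∘ₗ V.d = Words.deriv δ hδ ∘ₗ Words.ofBasis P deg b :=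
      b.ext fun i => by
        rw [LinearMap.comp_apply, LinearMap.comp_apply, Words.ofBasis_basis, Words.deriv_letter,
          hδb]
    exact fun v => congrArg (fun f => f v) this
  have hd : ∀ i, Words.deriv δ hδ (δ i) = 0 := fun i => by
    rw [hδb, ← hι, V.d_d, map_zero]
  let A : P.Alg := Words.dgAlg δ hδ hd
  let ι : V.Hom A.toDGMod := ⟨Words.ofBasis P deg b, Words.ofBasis_mem b hb, hι⟩
  have hΨ : ∀ z, Words.ofSchur b hb (Schur.d P V z) = Words.deriv δ hδ (Words.ofSchur b hb z) :=
    fun z => A.extend_d ι z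
  have hinj := ((Cohomology.map_bijective_iff _ _).1 (hP V V e he)).1 (Words.toSchur b hb x)
  have hcoc : Schur.d P V (Words.toSchur b hb x) = 0 := by
    have := hΨ (Words.toSchur b hb x)
    rw [Words.ofSchur_toSchur, hx] at this
    rw [← Words.toSchur_ofSchur (deg := deg) b hb (Schur.d P V _), this, map_zero]
  have he0 : Schur.map P e.toLin e.map_mem (Words.toSchur b hb x) = 0 := by
    have key : ∀ y : Words P deg Empty,
        Words.ofSchur b hb (Schur.map P e.toLin e.map_mem (Words.toSchur b hb y)) =
          Words.toAlg (Words.alg P deg) κ hκ y := by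
      intro y
      induction y using Words.induction_monomial with
      | monomial n l q μ hμ =>
        rw [Words.toSchur_monomial, Schur.map_mk, Words.ofSchur_mk]
        refine Eq.trans ?_ (Words.toAlg_monomial (Words.alg P deg) κ hκ l μ).symm
        congr 1
        exact funext fun i => (hκb _).symm
      | zero => simp only [map_zero]; rfl
      | add x y hx hy => simp only [map_add, hx, hy]; rfl
    rw [← Words.toSchur_ofSchur (deg := deg) b hb (Schur.map P e.toLin e.map_mem _), key]
    exact (congrArg _ hx').trans (map_zero _)
  obtain ⟨y, hy⟩ := hinj hcoc ⟨0, by rw [map_zero, he0]⟩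
  refine ⟨Words.ofSchur b hb y, ?_⟩
  rw [← hΨ, hy, Words.ofSchur_toSchur]

/-- The graded module with the letters as a basis. -/
def lettersGMod (k : Type u) [CommRing k] (deg : β → ℤ) : GMod k where
  carrier := β →₀ k
  gr n := Finsupp.supported k k {b | deg b = n}
  internal := by
    classical
    refine GMod.isInternal_of_proj _ (fun n => (Finsupp.supported k k {b | deg b = n}).subtype ∘ₗ
      Finsupp.restrictDom k k {b | deg b = n}) ?_ ?_ ?_
    · intro n x hx
      exact (Finsupp.filter_eq_self_iff _ _).2 fun b hb => hx (Finsupp.mem_support_iff.2 hb)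
    · intro m n h x hx
      refine (Finsupp.filter_eq_zero_iff _ _).2 fun b hb => ?_
      by_contra h'
      exact h ((hx (Finsupp.mem_support_iff.2 h')).symm.trans hb)
    · rw [eq_top_iff]
      rintro x -
      induction x using Finsupp.induction_linear with
      | zero => exact zero_mem _
      | add x y hx hy => exact add_mem hx hy
      | single b r =>
        exact Submodule.mem_iSup_of_mem (deg b) (Finsupp.single_mem_supported k r rfl)

/-- The letters, as a basis. -/
def lettersBasis (k : Type u) [CommRing k] (deg : β → ℤ) :
    Module.Basis β k (lettersGMod k deg) := Finsupp.basisSingleOne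

theorem lettersBasis_mem (b : β) : lettersBasis k deg b ∈ (lettersGMod k deg).gr (deg b) := by
  have : lettersBasis k deg b = Finsupp.single b 1 :=
    congrArg (fun f => f b) Finsupp.coe_basisSingleOne
  exact Submodule.mem_of_eq this (Finsupp.single_mem_supported k 1 rfl)

end reflects

/-! # Adjoining contractible letters -/

theorem GMod.map_mem_of_basis_add {k : Type u} [CommRing k] {V W : GMod k} {β : Type*}
    {deg : β → ℤ} (b : Module.Basis β k V) (hb : ∀ i, b i ∈ V.gr (deg i)) {f : V →ₗ[k] W} (c : ℤ)
    (hf : ∀ i, f (b i) ∈ W.gr (deg i + c)) {n : ℤ} {x : V} (hx : x ∈ V.gr n) :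
    f x ∈ W.gr (n + c) := by
  have key : f ∘ₗ V.proj n = W.proj (n + c) ∘ₗ f := b.ext fun i => by
    rw [LinearMap.comp_apply, LinearMap.comp_apply, V.proj_of_mem_eq n (hb i),
      W.proj_of_mem_eq (n + c) (hf i)]
    simp only [add_left_inj]
    split_ifs <;> simp
  have := congrArg (fun F => F x) key
  simp only [LinearMap.comp_apply, V.proj_of_mem hx] at this
  rw [this]
  exact W.proj_mem _ _

section letters
variable {β M : Type u} (deg : β → ℤ) (dm : M → ℤ)

/-- The degrees of the letters `b`, `x m = (false, m)`, and `d (x m) = (true, m)`. -/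
def coneDeg : β ⊕ Bool × M → ℤ :=
  Sum.elim deg fun x => if x.1 then dm x.2 + 1 else dm x.2

variable (k : Type u) [CommRing k]

/-- The differential of the letters, with the letters in `β` closed. -/
def lettersD : lettersGMod k (coneDeg deg dm) →ₗ[k] lettersGMod k (coneDeg deg dm) :=
  (lettersBasis k (coneDeg deg dm)).constr k (Sum.elim (fun _ => 0) fun x =>
    if x.1 then 0 else lettersBasis k (coneDeg deg dm) (.inr (true, x.2)))

/-- The projection which keeps the letters in `β`. -/
def lettersE : lettersGMod k (coneDeg deg dm) →ₗ[k] lettersGMod k (coneDeg deg dm) :=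
  (lettersBasis k (coneDeg deg dm)).constr k
    (Sum.elim (fun j => lettersBasis k (coneDeg deg dm) (.inl j)) fun _ => 0)

/-- The contracting homotopy. -/
def lettersS : lettersGMod k (coneDeg deg dm) →ₗ[k] lettersGMod k (coneDeg deg dm) :=
  (lettersBasis k (coneDeg deg dm)).constr k (Sum.elim (fun _ => 0) fun x =>
    if x.1 then lettersBasis k (coneDeg deg dm) (.inr (false, x.2)) else 0)

theorem lettersD_basis (i : β ⊕ Bool × M) :
    lettersD deg dm k (lettersBasis k _ i) = Sum.elim (fun _ => 0) (fun x =>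
      if x.1 then 0 else lettersBasis k (coneDeg deg dm) (.inr (true, x.2))) i :=
  Module.Basis.constr_basis _ _ _ _

theorem lettersE_basis (i : β ⊕ Bool × M) :
    lettersE deg dm k (lettersBasis k _ i) =
      Sum.elim (fun j => lettersBasis k (coneDeg deg dm) (.inl j)) (fun _ => 0) i :=
  Module.Basis.constr_basis _ _ _ _

theorem lettersS_basis (i : β ⊕ Bool × M) :
    lettersS deg dm k (lettersBasis k _ i) = Sum.elim (fun _ => 0) (fun x =>
      if x.1 then lettersBasis k (coneDeg deg dm) (.inr (false, x.2)) else 0) i :=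
  Module.Basis.constr_basis _ _ _ _

/-- The complex of letters. -/
def lettersDGMod : DGMod k where
  toGMod := lettersGMod k (coneDeg deg dm)
  d := lettersD deg dm k
  d_mem hx := by
    refine GMod.map_mem_of_basis_add (lettersBasis k (coneDeg deg dm)) lettersBasis_mem 1
      (fun i => ?_) hx
    rw [lettersD_basis]
    rcases i with j | ⟨_ | _, m⟩
    · exact zero_mem _
    · exact lettersBasis_mem (deg := coneDeg deg dm) (.inr (true, m))
    · exact zero_mem _
  d_d x := by
    have : lettersD deg dm k ∘ₗ lettersD deg dm k = 0 :=
      (lettersBasis k (coneDeg deg dm)).ext fun i => by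
        rw [LinearMap.comp_apply, lettersD_basis]
        rcases i with j | ⟨_ | _, m⟩
        · exact map_zero _
        · exact lettersD_basis deg dm k _
        · exact map_zero _
    exact congrArg (fun f => f x) this

/-- The projection to the letters in `β`, as a morphism. -/
def lettersHom : (lettersDGMod deg dm k).Hom (lettersDGMod deg dm k) where
  toLin := lettersE deg dm k
  map_mem hx := by
    refine GMod.map_mem_of_basis (W := lettersGMod k (coneDeg deg dm))
      (lettersBasis k (coneDeg deg dm)) lettersBasis_mem (fun i => ?_) hx
    rw [lettersE_basis]
    rcases i with j | ⟨_ | _, m⟩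
    · exact lettersBasis_mem (deg := coneDeg deg dm) _
    · exact zero_mem _
    · exact zero_mem _
  map_d x := by
    have : lettersE deg dm k ∘ₗ lettersD deg dm k = lettersD deg dm k ∘ₗ lettersE deg dm k :=
      (lettersBasis k (coneDeg deg dm)).ext fun i => by
        rw [LinearMap.comp_apply, LinearMap.comp_apply, lettersD_basis, lettersE_basis]
        rcases i with j | ⟨_ | _, m⟩
        · exact (map_zero (lettersE deg dm k)).trans (lettersD_basis deg dm k (.inl j)).symm
        · exact (lettersE_basis deg dm k _).trans (map_zero _).symm
        · exact (map_zero _).trans (map_zero _).symm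
    exact congrArg (fun f => f x) this

/-- The map sending the letter d(x m) back to x m, and the other letters to zero, is a homotopy from
the identity to the projection. -/
theorem lettersHom_isQuasiIso : (lettersHom deg dm k).IsQuasiIso := by
  refine DGMod.Hom.isQuasiIso_of_homotopy (V := lettersDGMod deg dm k) _ (lettersS deg dm k) ?_
  have : lettersD deg dm k ∘ₗ lettersS deg dm k + lettersS deg dm k ∘ₗ lettersD deg dm k =
      LinearMap.id - lettersE deg dm k :=
    (lettersBasis k (coneDeg deg dm)).ext fun i => by
      rw [LinearMap.add_apply, LinearMap.sub_apply, LinearMap.comp_apply, LinearMap.comp_apply,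
        lettersD_basis, lettersE_basis, lettersS_basis, LinearMap.id_apply]
      rcases i with j | ⟨_ | _, m⟩
      · simp
      · simp [lettersS_basis]
      · simp [lettersD_basis]
  exact fun x => congrArg (fun f => f x) this

end letters

/-- The identity morphism. -/
def Operad.Alg.Hom.id {k : Type u} [CommRing k] {P : Operad k} (A : P.Alg) : A.Hom A where
  toLin := LinearMap.id
  map_mem hx := hx
  map_d _ := rfl
  map_act _ _ _ := rfl

section cone
variable {k : Type u} [CommRing k] {P : Operad k} {β M : Type u} {deg : β → ℤ} (dm : M → ℤ)
  {A : P.Alg} {κ₀ : β → A} {hκ₀ : ∀ j, κ₀ j ∈ A.gr (deg j)}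
  (h : Function.Bijective (Words.toAlg A.graded κ₀ hκ₀))

/-- The inclusion of a quasi-free algebra into the one with more letters. -/
def coneIncl : GradedHom A.graded (Words.alg P (coneDeg deg dm)) :=
  GradedHom.ofFree h (Words.alg P (coneDeg deg dm))
    (fun j => Words.letter P (coneDeg deg dm) (.inl j)) fun j =>
      Words.letter_mem (P := P) (deg := coneDeg deg dm) (.inl j)

theorem coneIncl_gen (j : β) :
    (coneIncl dm h).toLin (κ₀ j) = Words.letter P (coneDeg deg dm) (.inl j) :=
  GradedHom.ofFree_apply h _ _ _ j

/-- The differential of the letters. -/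
def coneD : β ⊕ Bool × M → Words P (coneDeg deg dm) Empty :=
  Sum.elim (fun j => (coneIncl dm h).toLin (A.d (κ₀ j))) fun x =>
    if x.1 then 0 else Words.letter P (coneDeg deg dm) (.inr (true, x.2))

theorem coneD_mem (i : β ⊕ Bool × M) :
    coneD dm h i ∈ Words.gr P (coneDeg deg dm) Empty (coneDeg deg dm i + 1) := by
  rcases i with j | ⟨_ | _, m⟩
  · exact (coneIncl dm h).map_mem (A.d_mem (hκ₀ j))
  · exact Words.letter_mem (deg := coneDeg deg dm) (.inr (true, m))
  · exact zero_mem _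

theorem coneIncl_d (x : A) : (coneIncl dm h).toLin (A.d x) =
    Words.deriv (coneD dm h) (coneD_mem dm h) ((coneIncl dm h).toLin x) :=
  GradedHom.map_d_of_free h _ _ (fun _ μ _ a _ => Words.deriv_act _ _ μ a) (fun j => by
    rw [coneIncl_gen]
    exact (Words.deriv_letter (coneD dm h) (coneD_mem dm h) (.inl j)).symm) x

theorem deriv_coneD (i : β ⊕ Bool × M) :
    Words.deriv (coneD dm h) (coneD_mem dm h) (coneD dm h i) = 0 := by
  rcases i with j | ⟨_ | _, m⟩
  · refine (coneIncl_d dm h _).symm.trans ?_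
    rw [A.d_d]
    exact map_zero _
  · exact Words.deriv_letter _ _ _
  · exact map_zero _

/-- The algebra obtained by adjoining letters `x m` and `d (x m)`. -/
def cone : P.Alg := Words.dgAlg (coneD dm h) (coneD_mem dm h) (deriv_coneD dm h)

/-- The inclusion, as a morphism of dg-algebras. -/
def coneInl : A.Hom (cone dm h) where
  toLin := (coneIncl dm h).toLin
  map_mem := (coneIncl dm h).map_mem
  map_d := coneIncl_d dm h
  map_act := (coneIncl dm h).map_act

/-- The images of the letters under `coneLift`. -/
def coneVal (C : P.Alg) (κ : β → C) (m : M → C) : β ⊕ Bool × M → C :=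
  Sum.elim κ fun x => if x.1 then C.d (m x.2) else m x.2

variable {dm} in
theorem coneVal_mem (C : P.Alg) {κ : β → C} (hκ : ∀ j, κ j ∈ C.gr (deg j)) {m : M → C}
    (hm : ∀ i, m i ∈ C.gr (dm i)) (i : β ⊕ Bool × M) : coneVal C κ m i ∈ C.gr
    (coneDeg deg dm i) := by
  rcases i with j | ⟨_ | _, i⟩
  · exact hκ j
  · exact hm i
  · exact C.d_mem (hm i)

/-- Stated for morphisms of graded algebras, since it is needed to prove that `coneLift` commutes
with the differentials. -/
theorem toAlg_coneIncl {C : P.Alg} (f : GradedHom A.graded C.graded) (m : M → C)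
    (hm : ∀ i, m i ∈ C.gr (dm i)) (x : A) :
    Words.toAlg C.graded (coneVal C (fun j => f.toLin (κ₀ j)) m)
      (coneVal_mem C (fun j => f.map_mem (hκ₀ j)) hm) ((coneIncl dm h).toLin x) = f.toLin x :=
  GradedHom.ext_of_free h (GradedHom.comp (Words.toGradedHom C.graded
    (coneVal C (fun j => f.toLin (κ₀ j)) m) (coneVal_mem C (fun j => f.map_mem (hκ₀ j)) hm))
    (coneIncl dm h)) f (fun j => (congrArg (Words.toAlg C.graded
      (coneVal C (fun j => f.toLin (κ₀ j)) m) (coneVal_mem C (fun j => f.map_mem (hκ₀ j)) hm))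
      (coneIncl_gen dm h j)).trans
      (Words.toAlg_letter C.graded (coneVal C (fun j => f.toLin (κ₀ j)) m)
        (coneVal_mem C (fun j => f.map_mem (hκ₀ j)) hm) (.inl j))) x

/-- The morphism given by a morphism on `A` and by the images of the `x m`. -/
def coneLift {C : P.Alg} (f : A.Hom C) (m : M → C) (hm : ∀ i, m i ∈ C.gr (dm i)) :
    (cone dm h).Hom C :=
  Words.dgLift _ _ (deriv_coneD dm h) C (coneVal C (fun j => f.toLin (κ₀ j)) m)
    (coneVal_mem C (fun j => f.map_mem (hκ₀ j)) hm) (by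
      intro i
      rcases i with j | ⟨_ | _, i⟩
      · exact (toAlg_coneIncl dm h f.gradedHom m hm (A.d (κ₀ j))).trans (f.map_d _)
      · exact Words.toAlg_letter C.graded (coneVal C (fun j => f.toLin (κ₀ j)) m)
          (coneVal_mem C (fun j => f.map_mem (hκ₀ j)) hm) (.inr (true, i))
      · exact (map_zero _).trans (C.d_d _).symm)

theorem coneLift_inl {C : P.Alg} (f : A.Hom C) (m : M → C) (hm : ∀ i, m i ∈ C.gr (dm i)) (x : A) :
    (coneLift dm h f m hm).toLin ((coneInl dm h).toLin x) = f.toLin x :=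
  toAlg_coneIncl dm h f.gradedHom m hm x

theorem coneLift_letter {C : P.Alg} (f : A.Hom C) (m : M → C) (hm : ∀ i, m i ∈ C.gr (dm i))
    (i : β ⊕ Bool × M) : (coneLift dm h f m hm).toLin
      (Words.letter P (coneDeg deg dm) i) = coneVal C (fun j => f.toLin (κ₀ j)) m i :=
  Words.toAlg_letter C.graded (coneVal C (fun j => f.toLin (κ₀ j)) m)
    (coneVal_mem C (fun j => f.map_mem (hκ₀ j)) hm) i

/-- The retraction which kills the new letters. -/
def coneRetract : (cone dm h).Hom A :=
  coneLift dm h (Operad.Alg.Hom.id A) (fun _ => 0) fun _ => zero_mem _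

variable (P deg) in
/-- The letters in `β`, and zero for the other ones. -/
def coneProjVal : β ⊕ Bool × M → Words P (coneDeg deg dm) Empty :=
  Sum.elim (fun j => Words.letter P (coneDeg deg dm) (.inl j)) fun _ => 0

theorem coneProjVal_mem (i : β ⊕ Bool × M) :
    coneProjVal P deg dm i ∈ Words.gr P (coneDeg deg dm) Empty (coneDeg deg dm i) := by
  rcases i with j | x
  · exact Words.letter_mem (P := P) (deg := coneDeg deg dm) (.inl j)
  · exact zero_mem _

variable (P deg) in
/-- The endomorphism which kills the new letters. -/
def coneProj : Words P (coneDeg deg dm) Empty →ₗ[k] Words P (coneDeg deg dm) Empty :=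
  Words.toAlg (Words.alg P (coneDeg deg dm)) (coneProjVal P deg dm) (coneProjVal_mem dm)

/-- The projection is defined on words without reference to the differential of A, so it can be
compared with both the true differential and its leading part. This equation makes it a chain map
for the true one. -/
theorem coneProj_eq (x : Words P (coneDeg deg dm) Empty) :
    coneProj P deg dm x = (coneInl dm h).toLin ((coneRetract dm h).toLin x) := by
  refine GradedHom.ext_words (C := Words.alg P (coneDeg deg dm))
    (Words.toGradedHom _ (coneProjVal P deg dm) (coneProjVal_mem dm))
    ((coneInl dm h).gradedHom.comp (coneRetract dm h).gradedHom) (fun i => ?_) x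
  refine (Words.toAlg_letter (Words.alg P (coneDeg deg dm)) (coneProjVal P deg dm)
    (coneProjVal_mem dm) i).trans ?_
  have e : (coneRetract dm h).toLin (Words.letter P (coneDeg deg dm) i) =
      coneVal A κ₀ (fun _ => 0) i := coneLift_letter dm h _ _ _ i
  refine Eq.trans ?_ (congrArg (coneInl dm h).toLin e).symm
  rcases i with j | ⟨_ | _, m⟩
  · exact (coneIncl_gen dm h j).symm
  · exact (map_zero _).symm
  · exact ((congrArg _ (map_zero A.d)).trans (map_zero _)).symm

end cone

/-! ### Acyclicity of the contractible part -/

section acyclic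
variable {k : Type u} [CommRing k] {P : Operad k} {β M : Type u} {deg : β → ℤ} (dm : M → ℤ)

variable (P deg) in
/-- The differential of the letters, with the letters in `β` closed. -/
def coneD₀ : β ⊕ Bool × M → Words P (coneDeg deg dm) Empty :=
  Sum.elim (fun _ => 0) fun x =>
    if x.1 then 0 else Words.letter P (coneDeg deg dm) (.inr (true, x.2))

theorem coneD₀_mem (i : β ⊕ Bool × M) :
    coneD₀ P deg dm i ∈ Words.gr P (coneDeg deg dm) Empty (coneDeg deg dm i + 1) := by
  rcases i with j | ⟨_ | _, m⟩
  · exact zero_mem _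
  · exact Words.letter_mem (deg := coneDeg deg dm) (.inr (true, m))
  · exact zero_mem _

theorem deriv_coneD₀ (i : β ⊕ Bool × M) :
    Words.deriv (coneD₀ P deg dm) (coneD₀_mem dm) (coneD₀ P deg dm i) = 0 := by
  rcases i with j | ⟨_ | _, m⟩
  · exact map_zero _
  · exact Words.deriv_letter _ _ _
  · exact map_zero _

theorem coneProj_letter (i : β ⊕ Bool × M) :
    coneProj P deg dm (Words.letter P (coneDeg deg dm) i) = coneProjVal P deg dm i :=
  Words.toAlg_letter (Words.alg P (coneDeg deg dm)) (coneProjVal P deg dm) (coneProjVal_mem dm) i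

theorem coneProj_deriv₀ (x : Words P (coneDeg deg dm) Empty) :
    coneProj P deg dm (Words.deriv (coneD₀ P deg dm) (coneD₀_mem dm) x) =
      Words.deriv (coneD₀ P deg dm) (coneD₀_mem dm) (coneProj P deg dm x) := by
  refine Words.toAlg_deriv _ _ (Words.dgAlg _ _ (deriv_coneD₀ (P := P) (deg := deg) dm))
    (coneProjVal P deg dm) (coneProjVal_mem dm) (fun i => ?_) x
  rcases i with j | ⟨_ | _, m⟩
  · exact (map_zero _).trans (Words.deriv_letter (coneD₀ P deg dm) (coneD₀_mem dm) (.inl j)).symm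
  · exact (coneProj_letter dm (.inr (true, m))).trans
      (map_zero (Words.deriv (coneD₀ P deg dm) (coneD₀_mem dm))).symm
  · exact (map_zero _).trans (map_zero (Words.deriv (coneD₀ P deg dm) (coneD₀_mem dm))).symm

theorem Operad.ReflectsHomotopyEquivalences.exists_deriv_coneD₀
    (hP : P.ReflectsHomotopyEquivalences) (x : Words P (coneDeg deg dm) Empty)
    (hx : Words.deriv (coneD₀ P deg dm) (coneD₀_mem dm) x = 0) (hx' : coneProj P deg dm x = 0) :
    ∃ y, Words.deriv (coneD₀ P deg dm) (coneD₀_mem dm) y = x := by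
  refine hP.exists_deriv_eq (lettersDGMod deg dm k) (lettersBasis k (coneDeg deg dm))
    lettersBasis_mem (lettersHom deg dm k) (lettersHom_isQuasiIso deg dm k) (coneD₀_mem dm) ?_
    (coneProjVal_mem dm) ?_ x hx hx'
  · intro i
    refine Eq.trans ?_ (congrArg _ (lettersD_basis deg dm k i)).symm
    rcases i with j | ⟨_ | _, m⟩
    · exact (map_zero _).symm
    · exact (Words.ofBasis_basis _ _).symm
    · exact (map_zero _).symm
  · intro i
    refine Eq.trans ?_ (congrArg _ (lettersE_basis deg dm k i)).symm
    rcases i with j | m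
    · exact (Words.ofBasis_basis _ _).symm
    · exact (map_zero _).symm

variable {A : P.Alg} {κ₀ : β → A} {hκ₀ : ∀ j, κ₀ j ∈ A.gr (deg j)}
  (h : Function.Bijective (Words.toAlg A.graded κ₀ hκ₀))

theorem coneRetract_inl (x : A) :
    (coneRetract dm h).toLin ((coneInl dm h).toLin x) = x := coneLift_inl dm h _ _ _ x

/-- The kernel of the retraction of a triangular quasi-free algebra with additional contractible
letters is acyclic. -/
theorem Operad.ReflectsHomotopyEquivalences.cone_acyclic
    (hP : P.ReflectsHomotopyEquivalences) {Γ : Type*} [AddCommMonoid Γ] [LinearOrder Γ]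
    [IsOrderedCancelAddMonoid Γ] [WellFoundedLT Γ] (w : β → Γ)
    (hw : ∀ j, (Words.equivOfFree h).symm (A.d (κ₀ j)) ∈
      Words.weighted P deg Empty w (Set.Iio (w j)))
    (x : cone dm h) (hx : (cone dm h).d x = 0) (hx' : (coneRetract dm h).toLin x = 0) :
    ∃ y, (cone dm h).d y = x ∧ (coneRetract dm h).toLin y = 0 := by
  -- New letters have weight zero: their differential is part of the leading differential `coneD₀`,
  -- and the two differentials differ only on the old letters.
  set w' : β ⊕ Bool × M → Γ := Sum.elim w fun _ => 0 with hw'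
  have hd : ∀ x, Words.deriv (coneD dm h) (coneD_mem dm h)
      (Words.deriv (coneD dm h) (coneD_mem dm h) x) = 0 := (cone dm h).d_d
  obtain ⟨y, hy⟩ := Words.exists_deriv_eq (w := w') (coneD_mem dm h) (coneD₀_mem dm) (by
      rintro (j | ⟨_ | _, m⟩)
      · exact zero_mem _
      · exact Words.letter_mem_weighted (deg := coneDeg deg dm) (w := w') (.inr (true, m))
      · exact zero_mem _) (by
      rintro (j | ⟨_ | _, m⟩)
      · rw [show coneD₀ P deg dm (.inl j) = 0 from rfl, sub_zero]
        exact Words.toAlg_mem_weighted (w' := w')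
          (fun j => Words.letter_mem (P := P) (deg := coneDeg deg dm) (.inl j))
          (fun i => Words.letter_mem_weighted (deg := coneDeg deg dm) (w := w') (.inl i)) (hw j)
      · exact Submodule.mem_of_eq (sub_self _) (zero_mem _)
      · exact Submodule.mem_of_eq (sub_self _) (zero_mem _)) hd
    (coneProj P deg dm)
    (fun γ x hx => Words.toAlg_mem_weighted (w' := w') _ (by
      rintro (j | m)
      · exact Words.letter_mem_weighted (deg := coneDeg deg dm) (w := w') (.inl j)
      · exact zero_mem _) hx)
    (fun x => by rw [coneProj_eq dm h, coneProj_eq dm h, coneRetract_inl])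
    (fun x => by
      rw [coneProj_eq dm h, coneProj_eq dm h]
      refine (congrArg (coneInl dm h).toLin ((coneRetract dm h).map_d x)).trans ?_
      exact (coneInl dm h).map_d _)
    (coneProj_deriv₀ dm) (hP.exists_deriv_coneD₀ dm) x hx ((coneProj_eq dm h x).trans
        ((congrArg (coneInl dm h).toLin hx').trans (map_zero _)))
  change cone dm h at y
  have hy' : (cone dm h).d y = x := hy
  -- Subtracting the image of the retraction puts the primitive into the kernel; the subtracted term
  -- is closed because the retraction kills x.
  refine ⟨y - (coneInl dm h).toLin ((coneRetract dm h).toLin y), ?_, ?_⟩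
  · rw [map_sub, ← (coneInl dm h).map_d, ← (coneRetract dm h).map_d, hy', hx', map_zero, sub_zero]
  · rw [map_sub, coneRetract_inl, sub_self]

end acyclic

/-! # The stages of a Sullivan algebra -/

/-- The arguments are passed from X to its span one coordinate at a time, by linearity in that
coordinate. -/
theorem mem_of_forall_mem_span {k M N : Type*} [CommRing k] [AddCommGroup M] [Module k M]
    [AddCommGroup N] [Module k N] {n : ℕ} (f : MultilinearMap k (fun _ : Fin n => M) N)
    {X : Set M} {Q : Submodule k N} (h : ∀ a, (∀ i, a i ∈ X) → f a ∈ Q) {a : Fin n → M}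
    (ha : ∀ i, a i ∈ Submodule.span k X) : f a ∈ Q := by
  have key : ∀ s : Finset (Fin n), ∀ a : Fin n → M, (∀ i ∈ s, a i ∈ Submodule.span k X) →
      (∀ i ∉ s, a i ∈ X) → f a ∈ Q := by
    intro s
    induction s using Finset.induction_on with
    | empty => exact fun a _ ha => h a fun i => ha i (Finset.notMem_empty i)
    | insert i s hi ih =>
      intro a ha ha'
      have : Submodule.span k X ≤ Q.comap (f.toLinearMap a i) := by
        refine Submodule.span_le.2 fun x hx => ih _ (fun j hj => ?_) fun j hj => ?_
        · have hji : j ≠ i := fun e => hi (e ▸ hj)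
          simpa [hji] using ha j (Finset.mem_insert_of_mem hj)
        · by_cases hji : j = i
          · subst hji
            simpa using hx
          · simpa [hji] using ha' j (by simp [hji, hj])
      simpa using this (ha i (Finset.mem_insert_self i s))
  exact key Finset.univ a (fun i _ => ha i) fun i hi => absurd (Finset.mem_univ i) hi

theorem Submodule.proj_mem_of_graded {k : Type u} [CommRing k] {V : GMod k} {U : Submodule k V}
    (hU : U ≤ ⨆ n, U ⊓ V.gr n) (n : ℤ) {x : V} (hx : x ∈ U) : V.proj n x ∈ U := by
  have : ⨆ n, U ⊓ V.gr n ≤ U.comap (V.proj n) := by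
    refine iSup_le fun m x hx => ?_
    rw [Submodule.mem_comap, V.proj_of_mem_eq n hx.2]
    split_ifs
    · exact hx.1
    · exact zero_mem _
  exact this (hU hx)

namespace SullivanAlgebra

section basis
variable {k : Type u} [Field k] {P : Operad k} {N : ℕ} (S : SullivanAlgebra P N)

/-- Homogeneous vectors lying in a single stage span V because the stages are graded, and over a
field a spanning set contains a basis. -/
theorem exists_basis : ∃ (β : Type u) (b : Module.Basis β k S.V) (deg : β → ℤ)
    (st : β → Fin (N + 1)), (∀ j, b j ∈ S.V.gr (deg j)) ∧ ∀ j, b j ∈ S.stage (st j) := by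
  have hs : ⊤ ≤ Submodule.span k {v : S.V | ∃ n i, v ∈ S.V.gr n ∧ v ∈ S.stage i} := by
    rw [← S.stage_internal.submodule_iSup_eq_top]
    refine iSup_le fun i => (S.stage_graded i).trans (iSup_le fun n v hv => ?_)
    exact Submodule.subset_span ⟨n, i, hv.2, hv.1⟩
  have hb : ∀ j, Module.Basis.ofSpan hs j ∈
      {v : S.V | ∃ n i, v ∈ S.V.gr n ∧ v ∈ S.stage i} := fun j =>
    Module.Basis.ofSpan_subset hs ⟨j, rfl⟩
  choose deg st h using hb
  exact ⟨_, Module.Basis.ofSpan hs, deg, st, fun j => (h j).1, fun j => (h j).2⟩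

end basis

section stage
variable {k : Type u} [CommRing k] {P : Operad k} {N : ℕ} (S : SullivanAlgebra P N)
variable {β : Type u} (b : Module.Basis β k S.V) {deg : β → ℤ}
  {st : β → Fin (N + 1)} (hb : ∀ j, b j ∈ S.V.gr (deg j))

variable {S b} in
-- Expand in the basis: the contribution of basis vectors from other stages lies in the given stage
-- and in the sum of the others, hence vanishes by independence.
theorem stage_le_span (hst : ∀ j, b j ∈ S.stage (st j)) (l : Fin (N + 1)) :
    S.stage l ≤ Submodule.span k (b '' {j | st j = l}) := by
  intro x hx
  have hsup : x ∈ Submodule.span k (b '' {j | st j = l}) ⊔ ⨆ i, ⨆ (_ : i ≠ l), S.stage i := by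
    have : (⊤ : Submodule k S.V) ≤
        Submodule.span k (b '' {j | st j = l}) ⊔ ⨆ i, ⨆ (_ : i ≠ l), S.stage i := by
      rw [← b.span_eq, Submodule.span_le]
      rintro _ ⟨j, rfl⟩
      by_cases h : st j = l
      · exact Submodule.mem_sup_left (Submodule.subset_span ⟨j, h, rfl⟩)
      · exact Submodule.mem_sup_right
          (Submodule.mem_iSup_of_mem (st j) (Submodule.mem_iSup_of_mem h (hst j)))
    exact this trivial
  obtain ⟨y, hy, z, hz, rfl⟩ := Submodule.mem_sup.1 hsup
  have hyl : y ∈ S.stage l := by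
    refine (Submodule.span_le.2 ?_ : Submodule.span k (b '' {j | st j = l}) ≤ S.stage l) hy
    rintro _ ⟨j, rfl, rfl⟩
    exact hst j
  have hzl : z ∈ S.stage l := by simpa using sub_mem hx hyl
  have hz0 : z = 0 := by
    have := (DirectSum.isInternal_submodule_iff_iSupIndep_and_iSup_eq_top _).1 S.stage_internal
    exact Submodule.disjoint_def.1 (this.1 l) z hzl hz
  rwa [hz0, add_zero]

variable {S b} in
theorem iSup_stage_le_span (hst : ∀ j, b j ∈ S.stage (st j)) (i : Fin (N + 1)) :
    ⨆ l, ⨆ _ : l < i, S.stage l ≤ Submodule.span k (b '' {j | st j < i}) :=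
  iSup_le fun l => iSup_le fun hl => (stage_le_span hst l).trans
    (Submodule.span_mono (Set.image_mono fun _ hj => lt_of_eq_of_lt hj hl))

/-- The subalgebra generated by the basis vectors in the stages below the `i`-th one. -/
def gen (st : β → Fin (N + 1)) (i : Fin (N + 1)) : Submodule k S.alg :=
  Operad.Alg.generated (deg := fun j : {j // st j < i} => deg j) S.alg.graded
    (fun j : {j // st j < i} => S.ι (b j)) fun j => S.ι_mem (hb j)

theorem below_eq_gen (hst : ∀ j, b j ∈ S.stage (st j))
    (i : Fin (N + 1)) : S.below i = S.gen b hb st i := by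
  refine le_antisymm (Submodule.span_le.2 ?_) fun x hx => ?_
  · rintro _ ⟨n, μ, v, hv, rfl⟩
    refine mem_of_forall_mem_span (Q := S.gen b hb st i)
      ((S.alg.act n μ).compLinearMap fun _ => S.ι) (X := b '' {j | st j < i}) ?_
      fun j => iSup_stage_le_span hst i (hv j)
    intro a ha
    choose l hl hla using ha
    refine Operad.Alg.act_mem_generated (A := S.alg.graded) μ fun s => ?_
    rw [← hla]
    exact Operad.Alg.mem_generated (A := S.alg.graded)
      (κ := fun j : {j // st j < i} => S.ι (b j)) ⟨l s, hl s⟩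
  · refine Operad.Alg.generated_induction (A := S.alg.graded) (p := fun x : S.alg => x ∈ S.below i)
      ?_ (zero_mem _)
      (fun x y hx hy => add_mem hx hy) hx
    intro n l μ
    refine Submodule.subset_span ⟨n, μ, fun s => b (l s), fun s => ?_, rfl⟩
    exact Submodule.mem_iSup_of_mem (st (l s)) (Submodule.mem_iSup_of_mem (l s).2 (hst _))

/-- A uniform form of the two conditions on the differential, so that stage zero needs no separate
treatment in inductions. -/
theorem d_mem_gen (hst : ∀ j, b j ∈ S.stage (st j))
    (j : β) : S.alg.d (S.ι (b j)) ∈ S.gen b hb st (st j) := by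
  rw [← S.below_eq_gen b hb hst]
  by_cases h : st j = 0
  · rw [S.d_stage_zero _ (h ▸ hst j)]
    exact zero_mem _
  · exact S.d_stage _ h _ (hst j)

/-- The complexes `V₀` and `V_i ⊕ P(V₀ ⊕ ⋯ ⊕ V_{i-1})`. -/
def piece (i : Fin (N + 1)) : Submodule k S.alg :=
  if i = 0 then (S.stage 0).map S.ι else (S.stage i).map S.ι ⊔ S.below i

variable {S} in
theorem IsModel.piece {A : P.Alg} {f : S.alg.Hom A} (hf : S.IsModel f) (i : Fin (N + 1)) :
    IsQuasiIsoOn (S.piece i) f := by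
  rw [SullivanAlgebra.piece]
  split_ifs with h
  · exact hf.zero
  · exact hf.pos i h

theorem map_stage_le_gen (hst : ∀ j, b j ∈ S.stage (st j))
    {l i : Fin (N + 1)} (h : l < i) :
    (S.stage l).map S.ι ≤ S.gen b hb st i := by
  refine (Submodule.map_mono (stage_le_span hst l)).trans ?_
  rw [Submodule.map_span, Submodule.span_le]
  rintro _ ⟨_, ⟨j, rfl, rfl⟩, rfl⟩
  exact Operad.Alg.mem_generated (A := S.alg.graded)
    (κ := fun j : {j // st j < i} => S.ι (b j)) ⟨j, h⟩

theorem gen_mono {l i : Fin (N + 1)} (h : l ≤ i) : S.gen b hb st l ≤ S.gen b hb st i := by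
  intro x hx
  refine Operad.Alg.generated_induction (A := S.alg.graded)
    (p := fun x : S.alg => x ∈ S.gen b hb st i) ?_ (zero_mem _)
    (fun x y hx hy => add_mem hx hy) hx
  intro n v μ
  exact Operad.Alg.act_mem_generated (A := S.alg.graded) μ fun s =>
    Operad.Alg.mem_generated (A := S.alg.graded)
      (κ := fun j : {j // st j < i} => S.ι (b j)) ⟨v s, (v s).2.trans_le h⟩

theorem piece_le_gen (hst : ∀ j, b j ∈ S.stage (st j))
    {l i : Fin (N + 1)} (h : l < i) : S.piece l ≤ S.gen b hb st i := by
  rw [piece]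
  split_ifs with h0
  · subst h0
    exact S.map_stage_le_gen b hb hst h
  · refine sup_le (S.map_stage_le_gen b hb hst h) ?_
    rw [S.below_eq_gen b hb hst]
    exact S.gen_mono b hb h.le

theorem proj_mem_piece (b : Module.Basis β k S.V)
    (hb : ∀ j, b j ∈ S.V.gr (deg j)) (hst : ∀ j, b j ∈ S.stage (st j))
    (i : Fin (N + 1)) (n : ℤ) {x : S.alg} (hx : x ∈ S.piece i) :
    S.alg.proj n x ∈ S.piece i := by
  have h1 : ∀ l, ∀ x ∈ (S.stage l).map S.ι, S.alg.proj n x ∈ (S.stage l).map S.ι := by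
    rintro l _ ⟨v, hv, rfl⟩
    exact ⟨S.V.proj n v, Submodule.proj_mem_of_graded (S.stage_graded l) n hv,
      GMod.map_proj_zero (M := S.V) (N := S.alg.toGMod) S.ι S.ι_mem n v⟩
  rw [piece] at hx ⊢
  split_ifs at hx ⊢ with h
  · exact h1 0 x hx
  · rw [S.below_eq_gen b hb hst] at hx ⊢
    obtain ⟨y, hy, z, hz, rfl⟩ := Submodule.mem_sup.1 hx
    rw [map_add]
    exact add_mem (Submodule.mem_sup_left (h1 i y hy)) (Submodule.mem_sup_right
      (Operad.Alg.proj_mem_generated (A := S.alg.graded) n hz))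

/-- The underlying graded algebra is free on the basis. -/
theorem free_basis : Function.Bijective (Words.toAlg (deg := deg) S.alg.graded
    (fun j => S.ι (b j)) fun j => S.ι_mem (hb j)) :=
  Words.toAlg_bijective b hb S.alg S.ι S.ι_mem S.free

variable {b} in
theorem gradedHom_eq_on_gen {C : P.forget.Alg} (F G : GradedHom S.alg.graded C)
    {i : Fin (N + 1)} (h : ∀ j, st j < i → F.toLin (S.ι (b j)) = G.toLin (S.ι (b j)))
    {x : S.alg} (hx : x ∈ S.gen b hb st i) : F.toLin x = G.toLin x := by
  obtain ⟨y, rfl⟩ := hx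
  exact F.eq_on_toAlg G _ _ (fun j : {j // st j < i} => h j j.2) y

variable {b} in
theorem gradedHom_d_on_gen {C : P.Alg} (F : GradedHom S.alg.graded C.graded)
    {i : Fin (N + 1)}
    (h : ∀ j, st j < i → F.toLin (S.alg.d (S.ι (b j))) = C.d (F.toLin (S.ι (b j))))
    {x : S.alg} (hx : x ∈ S.gen b hb st i) : F.toLin (S.alg.d x) = C.d (F.toLin x) := by
  obtain ⟨y, rfl⟩ := hx
  exact F.map_d_toAlg C.d (fun n μ q a ha => C.d_act_eq_leibniz' μ ha) _ _
    (fun j : {j // st j < i} => h j j.2) y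

variable {b} in
theorem gradedHom_mem_gen (F : GradedHom S.alg.graded S.alg.graded)
    {i : Fin (N + 1)} (h : ∀ j, st j < i → F.toLin (S.ι (b j)) ∈ S.gen b hb st i)
    {x : S.alg} (hx : x ∈ S.gen b hb st i) : F.toLin x ∈ S.gen b hb st i := by
  refine Operad.Alg.generated_induction (p := fun x => F.toLin x ∈ S.gen b hb st i) ?_ ?_ ?_ hx
  · intro n l μ
    refine Submodule.mem_of_eq (F.map_act n μ _) ?_
    exact Operad.Alg.act_mem_generated (A := S.alg.graded) μ fun s => h _ (l s).2
  · exact Submodule.mem_of_eq (map_zero _) (zero_mem _)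
  · exact fun x y hx hy => Submodule.mem_of_eq (map_add _ _ _) (add_mem hx hy)

/-- The weight of a generator: the stages count lexicographically, the highest one first. -/
def weight (st : β → Fin (N + 1)) (j : β) : Lex ((Fin (N + 1))ᵒᵈ → ℕ) :=
  toLex (Pi.single (OrderDual.toDual (st j)) 1)

/-- In the stages above that of j both weights vanish, and in the stage of j the sum has 0 against
1. The number of lower letters, possibly zero, is irrelevant, as required for differentials of
arbitrary word length. -/
theorem sum_weight_lt {n : ℕ} {l : Fin n → β} {j : β} (h : ∀ s, st (l s) < st j) :
    ∑ s, weight st (l s) < weight st j := by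
  have hval : ∀ c, ofLex (∑ s, weight st (l s)) c =
      ∑ s, (Pi.single (OrderDual.toDual (st (l s))) 1 : (Fin (N + 1))ᵒᵈ → ℕ) c := by
    intro c
    rw [← Finset.sum_apply]
    rfl
  refine ⟨OrderDual.toDual (st j), fun c hc => ?_, ?_⟩
  · refine (hval c).trans ?_
    have hc' : st j < OrderDual.ofDual c := hc
    rw [Finset.sum_eq_zero fun s _ => ?_]
    · show 0 = (Pi.single (OrderDual.toDual (st j)) 1 : (Fin (N + 1))ᵒᵈ → ℕ) c
      rw [Pi.single_apply, if_neg fun e : c = OrderDual.toDual (st j) =>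
        hc'.ne' (congrArg OrderDual.ofDual e)]
    · rw [Pi.single_apply, if_neg fun e : c = OrderDual.toDual (st (l s)) =>
        ((h s).trans hc').ne' (congrArg OrderDual.ofDual e)]
  · refine (hval _).trans_lt ?_
    rw [Finset.sum_eq_zero fun s _ => ?_]
    · show 0 < (Pi.single (OrderDual.toDual (st j)) 1 : (Fin (N + 1))ᵒᵈ → ℕ) _
      rw [Pi.single_apply, if_pos rfl]
      exact Nat.zero_lt_one
    · rw [Pi.single_apply, if_neg fun e : OrderDual.toDual (st j) = OrderDual.toDual (st (l s)) =>
        (h s).ne' (congrArg OrderDual.ofDual e)]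

theorem d_mem_weighted (hst : ∀ j, b j ∈ S.stage (st j))
    (j : β) :
    (Words.equivOfFree (S.free_basis b hb)).symm (S.alg.d (S.ι (b j))) ∈
      Words.weighted P deg Empty (weight st) (Set.Iio (weight st j)) := by
  refine Operad.Alg.generated_induction (p := fun x =>
    (Words.equivOfFree (S.free_basis b hb)).symm x ∈
      Words.weighted P deg Empty (weight st) (Set.Iio (weight st j))) ?_ ?_ ?_
    (S.d_mem_gen b hb hst j)
  · intro n l μ
    have e : (Words.equivOfFree (S.free_basis b hb)).symm
        (S.alg.act n μ ((fun i : {i // st i < st j} => S.ι (b i)) ∘ l)) =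
        Words.monomial (fun s => (l s : β)) μ := by
      rw [LinearEquiv.symm_apply_eq, Words.equivOfFree_apply, Words.toAlg_monomial]
      rfl
    refine Submodule.mem_of_eq e (Words.monomial_mem_weighted (sum_weight_lt fun s => (l s).2) μ)
  · rw [map_zero]
    exact zero_mem _
  · intro x y hx hy
    rw [map_add]
    exact add_mem hx hy

end stage
end SullivanAlgebra

/-! # Lifting morphisms from a Sullivan algebra -/

/-- A factorization `A → E → B` of a morphism of algebras into an inclusion and a surjection,
with a retraction of `E` onto `A` whose kernel is acyclic and maps onto `B`. -/
structure Factorization {k : Type u} [CommRing k] {P : Operad k} {A B : P.Alg}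
    (ψ : A.Hom B) where
  E : P.Alg
  incl : A.Hom E
  retract : E.Hom A
  fib : E.Hom B
  retract_incl : ∀ x, retract.toLin (incl.toLin x) = x
  fib_incl : ∀ x, fib.toLin (incl.toLin x) = ψ.toLin x
  exists_fib : ∀ y, ∃ m, fib.toLin m = y ∧ retract.toLin m = 0
  acyclic : ∀ x, E.d x = 0 → retract.toLin x = 0 → ∃ y, E.d y = x ∧ retract.toLin y = 0

theorem Operad.ReflectsHomotopyEquivalences.exists_factorization {k : Type u} [CommRing k]
    {P : Operad k} (hP : P.ReflectsHomotopyEquivalences) {Γ : Type*} [AddCommMonoid Γ]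
    [LinearOrder Γ] [IsOrderedCancelAddMonoid Γ] [WellFoundedLT Γ] {β : Type u} {deg : β → ℤ}
    {A : P.Alg} {κ₀ : β → A} {hκ₀ : ∀ j, κ₀ j ∈ A.gr (deg j)}
    (h : Function.Bijective (Words.toAlg A.graded κ₀ hκ₀)) (w : β → Γ)
    (hw : ∀ j, (Words.equivOfFree h).symm (A.d (κ₀ j)) ∈
      Words.weighted P deg Empty w (Set.Iio (w j))) {B : P.Alg} (ψ : A.Hom B) :
    Nonempty (Factorization ψ) := by
  -- One contractible pair for each homogeneous element of B together with its degree. Sums of the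
  -- letters x m then reach all of B from inside the kernel of the retraction.
  let dm : (Σ n, B.gr n) → ℤ := Sigma.fst
  let m : (Σ n, B.gr n) → B := fun i => i.2
  have hm : ∀ i, m i ∈ B.gr (dm i) := fun i => i.2.2
  refine ⟨{
    E := cone dm h
    incl := coneInl dm h
    retract := coneRetract dm h
    fib := coneLift dm h ψ m hm
    retract_incl := coneRetract_inl dm h
    fib_incl := coneLift_inl dm h ψ m hm
    exists_fib := fun y => ?_
    acyclic := hP.cone_acyclic dm h w hw }⟩
  induction y using B.induction_gr with
  | hom n y hy =>
    exact ⟨Words.letter P (coneDeg deg dm) (.inr (false, ⟨n, y, hy⟩)),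
      coneLift_letter dm h ψ m hm _, coneLift_letter dm h _ _ _ _⟩
  | zero => exact ⟨0, map_zero _, map_zero _⟩
  | add x y hx hy =>
    obtain ⟨a, ha, ha'⟩ := hx
    obtain ⟨b, hb, hb'⟩ := hy
    refine ⟨a + b, ?_, ?_⟩
    · rw [map_add, ha, hb]
    · rw [map_add, ha', hb', add_zero]

namespace SullivanAlgebra
variable {k : Type u} [CommRing k] {P : Operad k} {N : ℕ} {S : SullivanAlgebra P N}
variable {β : Type u} {b : Module.Basis β k S.V} {deg : β → ℤ}
  {st : β → Fin (N + 1)}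

/-- One step of the obstruction theory. Acyclicity of the kernel replaces the obstruction cocycle in
E by its retraction in S, and injectivity of ψ on the cohomology of the i-th piece kills the latter.
Surjectivity on cohomology, together with surjectivity of E → B on the kernel, then corrects the
value in B exactly and not only up to homology. -/
theorem exists_lift_letter (hb : ∀ j, b j ∈ S.V.gr (deg j))
    (hst : ∀ j, b j ∈ S.stage (st j)) {B : P.Alg} {ψ : S.alg.Hom B}
    (hψ : S.IsModel ψ) (T : Factorization ψ) (h : S.alg.Hom B)
    (F : GradedHom S.alg.graded T.E.graded) {i : Fin (N + 1)}
    (hd : ∀ j, st j < i → F.toLin (S.alg.d (S.ι (b j))) = T.E.d (F.toLin (S.ι (b j))))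
    (hq : ∀ j, st j < i → T.fib.toLin (F.toLin (S.ι (b j))) = h.toLin (S.ι (b j)))
    (hr : ∀ j, st j < i → T.retract.toLin (F.toLin (S.ι (b j))) ∈ S.piece (st j))
    {j : β} (hj : st j = i) :
    ∃ e ∈ T.E.gr (deg j), T.E.d e = F.toLin (S.alg.d (S.ι (b j))) ∧
      T.fib.toLin e = h.toLin (S.ι (b j)) ∧ T.retract.toLin e ∈ S.piece i := by
  set a := S.ι (b j) with ha
  have hmem : S.alg.d a ∈ S.gen b hb st i := hj ▸ S.d_mem_gen b hb hst j
  have hdw : T.E.d (F.toLin (S.alg.d a)) = 0 := by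
    refine (gradedHom_d_on_gen S hb F hd hmem).symm.trans ?_
    rw [S.alg.d_d]
    exact map_zero _
  have hqw : T.fib.toLin (F.toLin (S.alg.d a)) = B.d (h.toLin a) :=
    (gradedHom_eq_on_gen S hb (T.fib.gradedHom.comp F) h.gradedHom hq hmem).trans (h.map_d a)
  -- The differential of `a` involves only lower generators, and `hr` keeps their retracted images
  -- among the lower generators. For i = 0 the piece contains no such subalgebra, but there the
  -- differential vanishes.
  have hz : T.retract.toLin (F.toLin (S.alg.d a)) ∈ S.piece i := by
    by_cases hi : i = 0
    · have : S.alg.d a = 0 := S.d_stage_zero _ ((hj.trans hi) ▸ hst j)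
      rw [this]
      refine Submodule.mem_of_eq ((congrArg T.retract.toLin (map_zero F.toLin)).trans
        (map_zero _)) (zero_mem _)
    · rw [piece, if_neg hi, S.below_eq_gen b hb hst]
      exact Submodule.mem_sup_right (gradedHom_mem_gen S hb (T.retract.gradedHom.comp F)
        (fun l hl => S.piece_le_gen b hb hst hl (hr l hl)) hmem)
  have hdz : S.alg.d (T.retract.toLin (F.toLin (S.alg.d a))) = 0 := by
    rw [← T.retract.map_d, hdw, map_zero]
  set w : T.E := F.toLin (S.alg.d a) with hw
  set z := T.retract.toLin w with hz'
  obtain ⟨y, hy, hy'⟩ := T.acyclic (w - T.incl.toLin z)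
    (by rw [map_sub, hdw, ← T.incl.map_d, hdz, map_zero, sub_zero])
    (by rw [map_sub, T.retract_incl, sub_self])
  -- In B both `w` and `w - T.incl.toLin z` become boundaries, of h a and of the image of y; hence
  -- so does z.
  obtain ⟨y', hy'm, hy'd⟩ := (hψ.piece i).1 z hz hdz ⟨h.toLin a - T.fib.toLin y, by
    rw [map_sub, ← T.fib.map_d, hy, map_sub, hqw, T.fib_incl, sub_sub_cancel]⟩
  have hcd : B.d (T.fib.toLin (y + T.incl.toLin y') - h.toLin a) = 0 := by
    rw [map_sub, ← T.fib.map_d, map_add, ← T.incl.map_d, hy, hy'd, sub_add_cancel, hqw, sub_self]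
  obtain ⟨x, hxm, hxd, c, hc⟩ := (hψ.piece i).2 _ hcd
  obtain ⟨m, hm, hm'⟩ := T.exists_fib c
  -- The first two terms have differential w. The closed corrections x and d m remove the
  -- discrepancy over B, and the retraction of e is y' − x, which stays in the piece.
  set e := y + T.incl.toLin y' - T.incl.toLin x - T.E.d m with he
  have hde : T.E.d e = w := by
    rw [he, map_sub, map_sub, map_add, T.E.d_d, ← T.incl.map_d, ← T.incl.map_d, hxd, hy'd, hy,
      map_zero, sub_zero, sub_zero, sub_add_cancel]
  have hqe : T.fib.toLin e = h.toLin a := by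
    rw [he, map_sub, map_sub, T.fib.map_d, hm, hc, T.fib_incl]
    abel
  have hre : T.retract.toLin e ∈ S.piece i := by
    rw [he, map_sub, map_sub, map_add, T.retract.map_d, hm', map_zero, hy', T.retract_incl,
      T.retract_incl, zero_add, sub_zero]
    exact sub_mem hy'm hxm
  have ham : a ∈ S.alg.gr (deg j) := S.ι_mem (hb j)
  have hwm : w ∈ T.E.gr (deg j + 1) := F.map_mem (S.alg.d_mem ham)
  -- The pieces are graded and all maps are homogeneous, so the component of the right degree
  -- satisfies the same conditions.
  refine ⟨T.E.proj (deg j) e, T.E.proj_mem _ _, ?_, ?_, ?_⟩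
  · rw [GMod.map_proj (M := T.E.toGMod) (N := T.E.toGMod) T.E.d 1 T.E.d_mem, hde]
    exact T.E.proj_of_mem hwm
  · rw [GMod.map_proj_zero (M := T.E.toGMod) (N := B.toGMod) T.fib.toLin T.fib.map_mem, hqe]
    exact B.proj_of_mem (h.map_mem ham)
  · rw [GMod.map_proj_zero (M := T.E.toGMod) (N := S.alg.toGMod) T.retract.toLin
      T.retract.map_mem]
    exact S.proj_mem_piece b hb hst i _ hre

/-- Freeness permits changing the values on the generators of one stage only. Differentials of
generators up to that stage involve strictly lower ones, on which the morphism is unchanged, so the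
earlier conditions persist. A graded morphism suffices, since it need not yet commute with the
differential on higher stages. -/
theorem exists_lift_stage (hb : ∀ j, b j ∈ S.V.gr (deg j))
    (hst : ∀ j, b j ∈ S.stage (st j)) {B : P.Alg} {ψ : S.alg.Hom B}
    (hψ : S.IsModel ψ) (T : Factorization ψ) (h : S.alg.Hom B) (i : ℕ) :
    ∃ F : GradedHom S.alg.graded T.E.graded, ∀ j, (st j : ℕ) < i →
      F.toLin (S.alg.d (S.ι (b j))) = T.E.d (F.toLin (S.ι (b j))) ∧
      T.fib.toLin (F.toLin (S.ι (b j))) = h.toLin (S.ι (b j)) ∧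
      T.retract.toLin (F.toLin (S.ι (b j))) ∈ S.piece (st j) := by
  induction i with
  | zero => exact ⟨T.incl.gradedHom, fun j hj => absurd hj (Nat.not_lt_zero _)⟩
  | succ i ih =>
    obtain ⟨F, hF⟩ := ih
    have hex : ∀ j, ∃ e ∈ T.E.gr (deg j), ((st j : ℕ) = i →
        T.E.d e = F.toLin (S.alg.d (S.ι (b j))) ∧ T.fib.toLin e = h.toLin (S.ι (b j)) ∧
        T.retract.toLin e ∈ S.piece (st j)) ∧ ((st j : ℕ) ≠ i → e = F.toLin (S.ι (b j))) := by
      intro j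
      by_cases hj : (st j : ℕ) = i
      · have hlt : ∀ l, st l < st j → (st l : ℕ) < i := fun l hl => hj ▸ Fin.lt_def.1 hl
        obtain ⟨e, hem, he⟩ := exists_lift_letter hb hst hψ T h F (fun l hl => (hF l (hlt l hl)).1)
          (fun l hl => (hF l (hlt l hl)).2.1) (fun l hl => (hF l (hlt l hl)).2.2) (j := j) rfl
        exact ⟨e, hem, fun _ => he, fun h => absurd hj h⟩
      · exact ⟨_, F.map_mem (S.ι_mem (hb j)), fun h => absurd h hj, fun _ => rfl⟩
    choose κ hκ hκ1 hκ2 using hex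
    let G : GradedHom S.alg.graded T.E.graded :=
      GradedHom.ofFree (S.free_basis b hb) T.E.graded κ hκ
    have hG : ∀ j, G.toLin (S.ι (b j)) = κ j := GradedHom.ofFree_apply _ _ _ _
    have hGF : ∀ j, (st j : ℕ) ≤ i →
        G.toLin (S.alg.d (S.ι (b j))) = F.toLin (S.alg.d (S.ι (b j))) := fun j hj =>
      gradedHom_eq_on_gen S hb G F (fun l hl => (hG l).trans
        (hκ2 l ((Fin.lt_def.1 hl).trans_le hj).ne)) (S.d_mem_gen b hb hst j)
    refine ⟨G, fun j hj => ?_⟩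
    rw [hG, hGF j (Nat.le_of_lt_succ hj)]
    by_cases hji : (st j : ℕ) = i
    · exact ⟨(hκ1 j hji).1.symm, (hκ1 j hji).2⟩
    · rw [hκ2 j hji]
      exact hF j (lt_of_le_of_ne (Nat.le_of_lt_succ hj) hji)

theorem exists_lift (hb : ∀ j, b j ∈ S.V.gr (deg j))
    (hst : ∀ j, b j ∈ S.stage (st j)) {B : P.Alg} {ψ : S.alg.Hom B}
    (hψ : S.IsModel ψ) (T : Factorization ψ) (h : S.alg.Hom B) :
    ∃ H : S.alg.Hom T.E, ∀ x, T.fib.toLin (H.toLin x) = h.toLin x := by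
  obtain ⟨F, hF⟩ := exists_lift_stage hb hst hψ T h (N + 1)
  have hF' := fun j => hF j (st j).2
  let H : S.alg.Hom T.E :=
    { toLin := F.toLin
      map_mem := F.map_mem
      map_d := GradedHom.map_d_of_free (S.free_basis b hb) F T.E.d
        (fun n μ q a ha => T.E.d_act_eq_leibniz' μ ha) fun j => (hF' j).1
      map_act := F.map_act }
  exact ⟨H, GradedHom.ext_of_free (S.free_basis b hb) (T.fib.gradedHom.comp F) h.gradedHom
    fun j => (hF' j).2.1⟩

end SullivanAlgebra

/-! ### Comparison on cohomology -/

theorem Operad.Alg.Hom.onH_comp {k : Type u} [CommRing k] {P : Operad k} {A B C : P.Alg}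
    (g : B.Hom C) (f : A.Hom B) (c : A.H) : (g.comp f).onH c = g.onH (f.onH c) := by
  obtain ⟨z, rfl⟩ := Cohomology.mk_surjective c
  rfl

namespace SullivanAlgebra

theorem IsModel.comp {k : Type u} [CommRing k] {P : Operad k} {N : ℕ} {S : SullivanAlgebra P N}
    {A B : P.Alg} {f : S.alg.Hom A} (hf : S.IsModel f) {φ : A.Hom B} (hφ : φ.IsQuasiIso) :
    S.IsModel (φ.comp f) := by
  obtain ⟨hφ1, hφ2⟩ := (Cohomology.map_bijective_iff _ φ.map_d).1 hφ
  have key : ∀ U : Submodule k S.alg, IsQuasiIsoOn U f → IsQuasiIsoOn U (φ.comp f) := by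
    rintro U ⟨h1, h2⟩
    refine ⟨fun x hx hdx hb => h1 x hx hdx (hφ1 _ ?_ hb), fun y hy => ?_⟩
    · rw [← f.map_d, hdx, map_zero]
    · obtain ⟨a, ha, c, hc⟩ := hφ2 y hy
      obtain ⟨x, hx, hdx, c', hc'⟩ := h2 a ha
      refine ⟨x, hx, hdx, c + φ.toLin c', ?_⟩
      rw [map_add, ← φ.map_d, hc, hc', map_sub]
      exact sub_add_sub_cancel _ _ _
  exact ⟨key _ hf.zero, fun i hi => key _ (hf.pos i hi)⟩

/-- Up to homology, every morphism from a Sullivan algebra to `B` factors through a model. -/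
theorem IsModel.exists_onH_eq {k : Type u} [Field k] {P : Operad k}
    (hP : P.ReflectsHomotopyEquivalences) {N : ℕ} {S : SullivanAlgebra P N} {B : P.Alg}
    {ψ : S.alg.Hom B} (hψ : S.IsModel ψ) (h : S.alg.Hom B) :
    ∃ g : S.alg.Hom S.alg, ∀ c, ψ.onH (g.onH c) = h.onH c := by
  obtain ⟨β, b, deg, st, hb, hst⟩ := S.exists_basis
  obtain ⟨T⟩ := hP.exists_factorization (S.free_basis b hb) (weight st)
    (S.d_mem_weighted b hb hst) ψ
  obtain ⟨H, hH⟩ := exists_lift hb hst hψ T h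
  refine ⟨T.retract.comp H, fun c => ?_⟩
  obtain ⟨z, rfl⟩ := Cohomology.mk_surjective c
  refine Cohomology.mk_eq_mk.2 ?_
  have hz : S.alg.d z = 0 := z.2
  -- A cocycle of E and its retraction differ by a cocycle in the acyclic kernel. The image of a
  -- primitive in B is a homology between the values of ψ g and h at z.
  obtain ⟨y, hy, -⟩ := T.acyclic (T.incl.toLin (T.retract.toLin (H.toLin z)) - H.toLin z)
    (by rw [map_sub, ← T.incl.map_d, ← T.retract.map_d, ← H.map_d, hz]; simp)
    (by rw [map_sub, T.retract_incl, sub_self])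
  refine ⟨T.fib.toLin y, ?_⟩
  rw [← T.fib.map_d, hy, map_sub, T.fib_incl, hH]
  rfl

end SullivanAlgebra
end

end CotripleProducts

theorem proposition3p5 {k : Type u} [Field k] (P : Operad.{u} k)
    (hP : P.ReflectsHomotopyEquivalences) (A B : P.Alg) (φ : A.Hom B) (N : ℕ)
    (S : SullivanAlgebra P N) (f : S.alg.Hom A) (hf : S.IsModel f)
    (σ : LinearMap.ker S.alg.d) (hσ : (σ : S.alg) ∈ S.positiveIdeal) :
    Set.MapsTo φ.onH (S.productSet f σ) (S.productSet (φ.comp f) σ) ∧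
    (φ.IsQuasiIso →
      S.IsModel (φ.comp f) ∧
      Set.BijOn φ.onH (S.productSet f σ) (S.productSet (φ.comp f) σ)) := by
  have hmaps : Set.MapsTo φ.onH (S.productSet f σ) (S.productSet (φ.comp f) σ) := by
    rintro _ ⟨g, hg, rfl⟩
    refine ⟨φ.comp g, fun x => ?_, (φ.onH_comp g _).symm⟩
    rw [φ.onH_comp, φ.onH_comp, hg x]
  refine ⟨hmaps, fun hφ => ⟨hf.comp hφ, hmaps, hφ.injective.injOn, ?_⟩⟩
  rintro _ ⟨h, hh, rfl⟩
  obtain ⟨g, hg⟩ := (hf.comp hφ).exists_onH_eq hP h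
  have hfg : ∀ c, φ.onH ((f.comp g).onH c) = h.onH c := fun c => by
    rw [← hg c, φ.onH_comp, f.onH_comp]
  -- The condition on V₀ is checked after applying H(φ), where it becomes the assumption that h is a
  -- defining system for φ f.
  refine ⟨_, ⟨f.comp g, fun x => hφ.injective ?_, rfl⟩, hfg _⟩
  exact (hfg _).trans ((hh x).trans (φ.onH_comp f _))
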